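/- Let $n\ge 0$, $d\ge 1$ be integers, $T>0$, and let $\Omega\subset\mathbb R^d$ be a bounded open set with $C^1$ boundary, outward unit normal $\nu$ and surface measure $da$. Uppercase indices run over $1,\dots,n$, lowercase indices over $1,\dots,d$, and repeated indices are summed. Let $\mathbb A_{IJ},\mathbb B_{IJk},\mathbb C_{IJkl}$ be real constants and let $\mathfrak f_I,\mathfrak A_{Ik}$ be smooth real functions of $U=(u,B,C)=(u_I,B_{Ii},C_{Iij})$. Consider in $\Omega\times(0,T)$ the system $$\partial_t u_I=\mathbb A_{IJ}u_J+\mathbb B_{IJk}\partial_k u_J+\mathbb C_{IJkl}\partial_l B_{Jk}+\mathfrak f_I(u,B,C)+\partial_k\big(\mathfrak A_{Ik}(u,B,C)\big),\qquad \partial_i u_I=B_{Ii},\qquad \partial_j B_{Ii}=C_{Iij},\tag{1}$$ with the initial and boundary conditions $$\begin{aligned} &u_I(x,0)=\overline u^{(i)}_I(x), && x\in\Omega,\\ &\mathfrak A_{Ik}(u,B,C)\,\nu_k+\big(\mathbb B_{IJk}u_J+\mathbb C_{IJik}B_{Ji}\big)\nu_k=\overline\tau_I, && (x,t)\in\partial\Omega_\tau\times(0,T],\\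 &u_I=\overline u^{(b)}_I, && (x,t)\in\partial\Omega_u\times(0,T],\\ &\partial_i u_I=B_{Ii}=\overline B_{Ii}, && (x,t)\in\partial\Omega_{\nabla u}\times(0,T]. \end{aligned}\tag{2}$$ Here $\partial\Omega_\tau,\partial\Omega_u,\partial\Omega_{\nabla u}$ are Borel subsets of $\partial\Omega$ (possibly empty), each contained in the closure of its interior relative to $\partial\Omega$, and the prescribed functions are bounded and continuous on the sets where they are prescribed. For dual fields $D=(\lambda_I,\gamma_{Ii},\rho_{Iij})$ of $(x,t)$ put $L=(\lambda_I,-\partial_k\lambda_I)$ and $$P=\big(\partial_t\lambda_I+\partial_i\gamma_{Ii}+\mathbb A_{JI}\lambda_J-\mathbb B_{JIk}\partial_k\lambda_J,\ \ \gamma_{Ii}+\partial_j\rho_{Iij}-\mathbb C_{JIil}\partial_l\lambda_J,\ \ \rho_{Iij}\big),$$ and let $F=(\mathfrak f_I,\mathfrak A_{Ik})$. Let $H(U,x,t)$ be a continuous real function and $M(U,L,x,t)=H(U,x,t)-L\cdot F(U)$. Suppose that $H$ is chosen so that $\partial_U M=P$ can be solved for $U$: there are an open set $\mathcal O$ of tuples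 $(P,L,x,t)$ (for instance all of them) and a $C^1$ map $U_H=(u^H,B^H,C^H)$ on $\mathcal O$ such that, for $(P,L,x,t)\in\mathcal O$ with $x\in\overline\Omega$ and $t\in[0,T]$, the function $M(\cdot,L,x,t)$ is differentiable at $U_H(P,L,x,t)$ and $$\partial_U M\big(U_H(P,L,x,t),L,x,t\big)=P .$$ Define $M^*(P,L,x,t)=U_H(P,L,x,t)\cdot P-M(U_H(P,L,x,t),L,x,t)$. Then: (a) For all $(P,L,x,t)\in\mathcal O$ with $x\in\overline\Omega$, $t\in[0,T]$, $M^*$ is differentiable in $P$ and in $L$, and $$\partial_P M^*(P,L,x,t)=U_H(P,L,x,t),\qquad \partial_L M^*(P,L,x,t)=F\big(U_H(P,L,x,t)\big).$$ (b) Let $$\begin{aligned}S_{ibvp}[\lambda,\gamma,\rho]={}&-\int_{\Omega\times(0,T)}M^*(P(x,t),L(x,t),x,t)\,dx\,dt-\int_\Omega\lambda_I(x,0)\,\overline u^{(i)}_I(x)\,dx-\int_0^T\!\!\int_{\partial\Omega_\tau}\lambda_I\,\overline\tau_I\,da\,dt\\&+\int_0^T\!\!\int_{\partial\Omega_u}\gamma_{Ii}\,\overline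 u^{(b)}_I\,\nu_i\,da\,dt+\int_0^T\!\!\int_{\partial\Omega_{\nabla u}}\rho_{Iij}\,\overline B_{Ii}\,\nu_j\,da\,dt,\end{aligned}$$ where the following values of the dual fields are arbitrarily prescribed: $\lambda(x,T)$ for $x\in\Omega$; $\lambda$ on $(\partial\Omega\setminus\partial\Omega_\tau)\times(0,T]$; $\gamma$ on $(\partial\Omega\setminus\partial\Omega_u)\times(0,T]$; $\rho$ on $(\partial\Omega\setminus\partial\Omega_{\nabla u})\times(0,T]$. Let $D=(\lambda,\gamma,\rho)$ be dual fields of class $C^2$ up to the boundary of the space-time domain (restrictions of $C^2$ functions on $\mathbb R^d\times\mathbb R$) that take the prescribed values and satisfy $(P(x,t),L(x,t),x,t)\in\mathcal O$ for all $(x,t)\in\overline\Omega\times[0,T]$. Then $D$ is stationary for $S_{ibvp}$, that is, $\frac{d}{d\varepsilon}S_{ibvp}[D+\varepsilon\,\delta D]\big|_{\varepsilon=0}$ exists and equals $0$ for every variation $\delta D$ of class $C^2$ (in the same sense) that vanishes where the dual fields are prescribed, if and only if the primal fields $(u,B,C)(x,t)=U_H(P(x,t),L(x,t),x,t)$ satisfy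 the system (1) in $\Omega\times(0,T)$ together with all the initial and boundary conditions (2). -/

import Mathlib

open Set Topology MeasureTheory
open scoped ContDiff

namespace DualIBVP

noncomputable section

/-! ### Space, arrays and their pairings -/

/-- Physical space `ℝ^d` with the Euclidean norm. -/
abbrev Space (d : ℕ) := EuclideanSpace ℝ (Fin d)

/-- Arrays `(u_I, B_{Ii}, C_{Iij})`. The arrays `P` and the triples of dual fields
`(λ_I, γ_{Ii}, ρ_{Iij})` have the same shape. -/
abbrev State (n d : ℕ) :=
  (Fin n → ℝ) × (Fin n → Fin d → ℝ) × (Fin n → Fin d → Fin d → ℝ)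

/-- Arrays of the shape of `L = (λ_I, -∂_k λ_I)` and of `F = (f_I, A_{Ik})`. -/
abbrev Flux (n d : ℕ) := (Fin n → ℝ) × (Fin n → Fin d → ℝ)

/-- `P · U`, the sum of the products of all components. -/
def dotU {n d : ℕ} (P U : State n d) : ℝ :=
  (∑ I, P.1 I * U.1 I) + (∑ I, ∑ i, P.2.1 I i * U.2.1 I i)
    + ∑ I, ∑ i, ∑ j, P.2.2 I i j * U.2.2 I i j

/-- `L · F`, the sum of the products of all components. -/
def dotL {n d : ℕ} (L F : Flux n d) : ℝ :=
  (∑ I, L.1 I * F.1 I) + ∑ I, ∑ k, L.2 I k * F.2 I k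

/-- The linear functional `U ↦ P · U`. A function on `State n d` with this derivative has `P` as the
array of its partial derivatives. -/
def dotUCLM {n d : ℕ} (P : State n d) : State n d →L[ℝ] ℝ :=
  LinearMap.toContinuousLinearMap
    { toFun := dotU P
      map_add' := fun U V => by
        simp only [dotU, Prod.fst_add, Prod.snd_add, Pi.add_apply, mul_add, Finset.sum_add_distrib]
        ring
      map_smul' := fun c U => by
        simp only [dotU, Prod.smul_fst, Prod.smul_snd, Pi.smul_apply, smul_eq_mul, RingHom.id_apply,
          mul_add, Finset.mul_sum, mul_left_comm] }

/-- The linear functional `L ↦ F · L`. -/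
def dotLCLM {n d : ℕ} (F : Flux n d) : Flux n d →L[ℝ] ℝ :=
  LinearMap.toContinuousLinearMap
    { toFun := dotL F
      map_add' := fun U V => by
        simp only [dotL, Prod.fst_add, Prod.snd_add, Pi.add_apply, mul_add, Finset.sum_add_distrib]
        ring
      map_smul' := fun c U => by
        simp only [dotL, Prod.smul_fst, Prod.smul_snd, Pi.smul_apply, smul_eq_mul, RingHom.id_apply,
          mul_add, Finset.mul_sum, mul_left_comm] }

/-- The time derivative `∂_t g (x, t)`. -/
def dt {d : ℕ} (g : Space d → ℝ → ℝ) (x : Space d) (t : ℝ) : ℝ := deriv (fun s => g x s) t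

/-- The space derivative `∂_k g (x, t)`. -/
def dx {d : ℕ} (k : Fin d) (g : Space d → ℝ → ℝ) (x : Space d) (t : ℝ) : ℝ :=
  fderiv ℝ (fun y => g y t) x (EuclideanSpace.single k 1)

/-! ### Domains with `C¹` boundary -/

/-- `φ` is a `C¹` function of the form `y ↦ s y_k - g(y)`, with `s = ±1` and `g` independent of the
coordinate `y_k`, so that `{φ < 0}` is the region on one side of a graph over the other
coordinates. -/
def IsGraphFunction {d : ℕ} (φ : Space d → ℝ) : Prop :=
  ∃ (k : Fin d) (s : ℝ) (g : Space d → ℝ), (s = 1 ∨ s = -1) ∧ ContDiff ℝ 1 g ∧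
    (∀ y z : Space d, (∀ j, j ≠ k → y j = z j) → g y = g z) ∧ ∀ y, φ y = s * y k - g y

/-- `Ω` is a bounded open set with `C¹` boundary and `ν` is its outward unit normal: near every
boundary point, `Ω` is the set `{φ < 0}` on one side of the graph of a `C¹` function, and `ν` is the
normalized gradient of `φ` at the nearby boundary points. -/
structure IsC1Domain {d : ℕ} (Ω : Set (Space d)) (ν : Space d → Space d) : Prop where
  isOpen : IsOpen Ω
  isBounded : Bornology.IsBounded Ω
  chart : ∀ x ∈ frontier Ω, ∃ (φ : Space d → ℝ) (r : ℝ), 0 < r ∧ IsGraphFunction φ ∧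
    (∀ y ∈ Metric.ball x r, y ∈ Ω ↔ φ y < 0) ∧
    ∀ y ∈ Metric.ball x r ∩ frontier Ω, ν y = ‖gradient φ y‖⁻¹ • gradient φ y

/-- Surface measure: the normalized `(d-1)`-dimensional Hausdorff measure (the counting measure if
`d = 1`). -/
abbrev surf (d : ℕ) : Measure (Space d) := Measure.euclideanHausdorffMeasure (d - 1)

/-- `Γ` is a part of the boundary of `Ω` on which boundary conditions can be prescribed: a Borel
subset of `∂Ω`, possibly empty, contained in the closure of its interior relative to `∂Ω`. -/
structure IsBoundaryPart {d : ℕ} (Ω Γ : Set (Space d)) : Prop where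
  measurableSet : MeasurableSet Γ
  subset : Γ ⊆ frontier Ω
  subset_closure : Γ ⊆ closure {x | x ∈ Γ ∧ Γ ∈ 𝓝[frontier Ω] x}

/-! ### The primal problem -/

/-- The data of the primal system: the constant arrays `𝔸, 𝔹, ℂ` and the functions `f_I`,
`A_{Ik}` of `(u, B, C)`. -/
structure PrimalSystem (n d : ℕ) where
  cA : Fin n → Fin n → ℝ
  cB : Fin n → Fin n → Fin d → ℝ
  cC : Fin n → Fin n → Fin d → Fin d → ℝ
  f : State n d → Fin n → ℝ
  a : State n d → Fin n → Fin d → ℝ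

/-- `F(U) = (f(U), A(U))`. -/
def PrimalSystem.F {n d : ℕ} (sys : PrimalSystem n d) (U : State n d) : Flux n d :=
  (sys.f U, sys.a U)

/-- The data of the initial and boundary conditions: the boundary parts `∂Ω_τ`, `∂Ω_u`, `∂Ω_∇u`
and the prescribed initial values `u⁽ⁱ⁾`, tractions `τ`, boundary values `u⁽ᵇ⁾` and boundary
gradients `B`. -/
structure IBData (n d : ℕ) where
  Γτ : Set (Space d)
  Γu : Set (Space d)
  Γg : Set (Space d)
  uInit : Space d → Fin n → ℝ
  tau : Space d → ℝ → Fin n → ℝ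
  uBdry : Space d → ℝ → Fin n → ℝ
  gBdry : Space d → ℝ → Fin n → Fin d → ℝ

/-- The prescribed functions are bounded and continuous where they are prescribed. -/
structure IBData.Regular {n d : ℕ} (bd : IBData n d) (Ω : Set (Space d)) (T : ℝ) : Prop where
  partτ : IsBoundaryPart Ω bd.Γτ
  partu : IsBoundaryPart Ω bd.Γu
  partg : IsBoundaryPart Ω bd.Γg
  contInit : ContinuousOn bd.uInit Ω
  bddInit : Bornology.IsBounded (bd.uInit '' Ω)
  contTau : ContinuousOn (Function.uncurry bd.tau) (bd.Γτ ×ˢ Ioc 0 T)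
  bddTau : Bornology.IsBounded (Function.uncurry bd.tau '' (bd.Γτ ×ˢ Ioc 0 T))
  contBdry : ContinuousOn (Function.uncurry bd.uBdry) (bd.Γu ×ˢ Ioc 0 T)
  bddBdry : Bornology.IsBounded (Function.uncurry bd.uBdry '' (bd.Γu ×ˢ Ioc 0 T))
  contGrad : ContinuousOn (Function.uncurry bd.gBdry) (bd.Γg ×ˢ Ioc 0 T)
  bddGrad : Bornology.IsBounded (Function.uncurry bd.gBdry '' (bd.Γg ×ˢ Ioc 0 T))

/-- The field `U = (u, B, C)` satisfies the first-order system in `Ω × (0,T)` together with the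
initial, traction, displacement and gradient conditions. -/
structure SolvesIBVP {n d : ℕ} (sys : PrimalSystem n d) (bd : IBData n d) (Ω : Set (Space d))
    (ν : Space d → Space d) (T : ℝ) (U : Space d → ℝ → State n d) : Prop where
  evolution : ∀ x ∈ Ω, ∀ t ∈ Ioo 0 T, ∀ I,
    dt (fun y s => (U y s).1 I) x t =
      (∑ J, sys.cA I J * (U x t).1 J)
      + (∑ J, ∑ k, sys.cB I J k * dx k (fun y s => (U y s).1 J) x t)
      + (∑ J, ∑ k, ∑ l, sys.cC I J k l * dx l (fun y s => (U y s).2.1 J k) x t)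
      + sys.f (U x t) I
      + ∑ k, dx k (fun y s => sys.a (U y s) I k) x t
  grad_u : ∀ x ∈ Ω, ∀ t ∈ Ioo 0 T, ∀ I i,
    dx i (fun y s => (U y s).1 I) x t = (U x t).2.1 I i
  grad_B : ∀ x ∈ Ω, ∀ t ∈ Ioo 0 T, ∀ I i j,
    dx j (fun y s => (U y s).2.1 I i) x t = (U x t).2.2 I i j
  initial : ∀ x ∈ Ω, ∀ I, (U x 0).1 I = bd.uInit x I
  traction : ∀ x ∈ bd.Γτ, ∀ t ∈ Ioc 0 T, ∀ I,
    (∑ k, sys.a (U x t) I k * ν x k)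
      + (∑ k, ((∑ J, sys.cB I J k * (U x t).1 J)
          + ∑ J, ∑ i, sys.cC I J i k * (U x t).2.1 J i) * ν x k) = bd.tau x t I
  displacement : ∀ x ∈ bd.Γu, ∀ t ∈ Ioc 0 T, ∀ I, (U x t).1 I = bd.uBdry x t I
  gradient : ∀ x ∈ bd.Γg, ∀ t ∈ Ioc 0 T, ∀ I i,
    dx i (fun y s => (U y s).1 I) x t = (U x t).2.1 I i ∧ (U x t).2.1 I i = bd.gBdry x t I i

/-! ### The dual functional -/

/-- The array `P` of the dual fields `D = (λ, γ, ρ)` at `(x, t)`. -/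
def PrimalSystem.P {n d : ℕ} (sys : PrimalSystem n d) (D : Space d → ℝ → State n d)
    (x : Space d) (t : ℝ) : State n d :=
  (fun I => dt (fun y s => (D y s).1 I) x t
      + (∑ i, dx i (fun y s => (D y s).2.1 I i) x t)
      + (∑ J, sys.cA J I * (D x t).1 J)
      - ∑ J, ∑ k, sys.cB J I k * dx k (fun y s => (D y s).1 J) x t,
   fun I i => (D x t).2.1 I i
      + (∑ j, dx j (fun y s => (D y s).2.2 I i j) x t)
      - ∑ J, ∑ l, sys.cC J I i l * dx l (fun y s => (D y s).1 J) x t,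
   fun I i j => (D x t).2.2 I i j)

/-- The array `L = (λ_I, -∂_k λ_I)` of the dual fields `D = (λ, γ, ρ)` at `(x, t)`. -/
def arrL {n d : ℕ} (D : Space d → ℝ → State n d) (x : Space d) (t : ℝ) : Flux n d :=
  (fun I => (D x t).1 I, fun I k => - dx k (fun y s => (D y s).1 I) x t)

/-- `M(U, L, x, t) = H(U, x, t) - L · F(U)`. -/
def PrimalSystem.M {n d : ℕ} (sys : PrimalSystem n d) (H : State n d → Space d → ℝ → ℝ)
    (U : State n d) (L : Flux n d) (x : Space d) (t : ℝ) : ℝ :=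
  H U x t - dotL L (sys.F U)

/-- `M*(P, L, x, t) = U_H · P - M(U_H, L, x, t)` with `U_H = U_H(P, L, x, t)`. -/
def PrimalSystem.Mstar {n d : ℕ} (sys : PrimalSystem n d) (H : State n d → Space d → ℝ → ℝ)
    (UH : State n d × Flux n d × Space d × ℝ → State n d)
    (P : State n d) (L : Flux n d) (x : Space d) (t : ℝ) : ℝ :=
  dotU (UH (P, L, x, t)) P - sys.M H (UH (P, L, x, t)) L x t

/-- The primal fields `(x, t) ↦ U_H(P(x,t), L(x,t), x, t)` generated by the dual fields `D`. -/
def PrimalSystem.primal {n d : ℕ} (sys : PrimalSystem n d)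
    (UH : State n d × Flux n d × Space d × ℝ → State n d) (D : Space d → ℝ → State n d)
    (x : Space d) (t : ℝ) : State n d :=
  UH (sys.P D x t, arrL D x t, x, t)

/-- The modified dual functional `S_ibvp[λ, γ, ρ]`, with `D = (λ, γ, ρ)`. -/
def PrimalSystem.S {n d : ℕ} (sys : PrimalSystem n d) (bd : IBData n d)
    (Ω : Set (Space d)) (ν : Space d → Space d) (T : ℝ) (H : State n d → Space d → ℝ → ℝ)
    (UH : State n d × Flux n d × Space d × ℝ → State n d) (D : Space d → ℝ → State n d) : ℝ :=
  - (∫ p in Ω ×ˢ Ioo 0 T, sys.Mstar H UH (sys.P D p.1 p.2) (arrL D p.1 p.2) p.1 p.2)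
  - (∫ x in Ω, ∑ I, (D x 0).1 I * bd.uInit x I)
  - (∫ t in Ioo 0 T, ∫ x in bd.Γτ, ∑ I, (D x t).1 I * bd.tau x t I ∂(surf d))
  + (∫ t in Ioo 0 T, ∫ x in bd.Γu,
      ∑ I, ∑ i, (D x t).2.1 I i * bd.uBdry x t I * ν x i ∂(surf d))
  + (∫ t in Ioo 0 T, ∫ x in bd.Γg,
      ∑ I, ∑ i, ∑ j, (D x t).2.2 I i j * bd.gBdry x t I i * ν x j ∂(surf d))

/-- `D` takes the values prescribed by `D'`: `λ` at the final time and on `∂Ω ∖ ∂Ω_τ`, `γ` on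
`∂Ω ∖ ∂Ω_u`, and `ρ` on `∂Ω ∖ ∂Ω_∇u`. -/
structure IBData.Agrees {n d : ℕ} (bd : IBData n d) (Ω : Set (Space d)) (T : ℝ)
    (D D' : Space d → ℝ → State n d) : Prop where
  final : ∀ x ∈ Ω, (D x T).1 = (D' x T).1
  lam : ∀ x ∈ frontier Ω \ bd.Γτ, ∀ t ∈ Ioc 0 T, (D x t).1 = (D' x t).1
  gam : ∀ x ∈ frontier Ω \ bd.Γu, ∀ t ∈ Ioc 0 T, (D x t).2.1 = (D' x t).2.1
  rho : ∀ x ∈ frontier Ω \ bd.Γg, ∀ t ∈ Ioc 0 T, (D x t).2.2 = (D' x t).2.2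

/-- `D` is stationary for `S_ibvp`: the first variation of `S_ibvp` at `D` exists and vanishes in the
direction of every `C²` variation that is zero where the dual fields are prescribed. -/
def PrimalSystem.IsStationary {n d : ℕ} (sys : PrimalSystem n d) (bd : IBData n d)
    (Ω : Set (Space d)) (ν : Space d → Space d) (T : ℝ) (H : State n d → Space d → ℝ → ℝ)
    (UH : State n d × Flux n d × Space d × ℝ → State n d) (D : Space d → ℝ → State n d) : Prop :=
  ∀ δD : Space d → ℝ → State n d, ContDiff ℝ 2 (Function.uncurry δD) →
    bd.Agrees Ω T δD (fun _ _ => 0) →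
    HasDerivAt (fun ε : ℝ => sys.S bd Ω ν T H UH (fun x t => D x t + ε • δD x t)) 0 0

end

end DualIBVP

/-!
Stationarity of the dual functional is the weak form of the primal problem.

*Legendre transform.* As `U_H` is a critical point of `U ↦ U · P - M(U, L, x, t)`, only the
explicit dependence of `M*` on `(P, L)` contributes to its derivative, which is therefore `(U_H,
F(U_H))` (`hasFDerivAt_Mstar`). The differentiability of `H` that this needs is that in `U` at the
critical point, where it follows from that of `M`, as `F` is smooth.

*First variation.* `S_ibvp` is an integral of `M*` plus terms that are linear in the dual fields.
The derivative may be taken under the integral sign, since the arguments of `M*` range over a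
compact subset of the open set `O` and stay in `O` for small variations
(`hasDerivAt_integral_Mstar`). In the direction `E` this gives minus the integral of `U · P[E] +
F(U) · L[E]` plus the linear terms evaluated at `E` (`hasDerivAt_S`), `U` being the primal fields.

*Integration by parts.* The product rule (`pairing_eq_residual`) moves all derivatives from `E` to
`U`, up to a divergence in space-time. The divergence theorem on `Ω` turns the latter into
boundary terms, of which those on the parts where the dual fields are prescribed vanish. What
remains (`firstVariation_eq`) is the sum of the integrals of the components of `E` against the
defects of the differential equations in the cylinder, of the initial condition at time `0`, and
of the boundary conditions on `∂Ω_τ`, `∂Ω_u` and `∂Ω_∇u`.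

*Fundamental lemma.* If `U` solves the problem, all defects vanish. Conversely, variations
supported in the cylinder give the system, and then variations of `λ`, `γ` and `ρ` that reach the
initial time or the relative interior of a boundary part give the corresponding condition there
(`IsWeakSolution.solvesIBVP`). The conditions extend by continuity to the whole boundary part
because it lies in the closure of its relative interior. For `γ` and `ρ` the defects carry a
factor `ν_i`, which can be cancelled for some `i` because the normal is a unit vector.

The divergence theorem for `C¹` domains, with the normalized Hausdorff measure as surface measure,
rests on an area formula for injective `C¹` maps into a Euclidean space
(`comap_euclideanHausdorffMeasure_eq_withDensity`), which identifies the surface measure on a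
graph with a density on the coordinate hyperplane; the theorem for a region below a graph follows
from the fundamental theorem of calculus after shearing the graph to the hyperplane
(`integral_fderiv_subgraph`), and a partition of unity gives the general case
(`IsC1Domain.integral_fderiv`). The primal fields are `C¹` only near the closed cylinder, so
before integrating by parts they are replaced by a global `C¹` field that agrees with them there
(`exists_contDiff_eventuallyEq`).
-/

namespace DualIBVP

noncomputable section

/-! ### The area formula for `C¹` embeddings -/

open scoped ENNReal NNReal
open Module Filter

/-- Two Borel measures can be compared locally. -/
theorem measure_le_of_locally_le {X : Type*} [TopologicalSpace X] [SecondCountableTopology X]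
    [MeasurableSpace X] [OpensMeasurableSpace X] {μ ν : Measure X}
    (h : ∀ x, ∃ N ∈ 𝓝 x, ∀ s ⊆ N, MeasurableSet s → μ s ≤ ν s) : μ ≤ ν := by
  choose N hN hle using h
  obtain ⟨s, hs, hcov⟩ := TopologicalSpace.countable_cover_nhds
    (f := fun x => interior (N x)) fun x => interior_mem_nhds.2 (hN x)
  rw [Measure.le_iff]
  intro t ht
  rcases s.eq_empty_or_nonempty with rfl | hne
  · have : t = ∅ := by
      apply eq_empty_of_subset_empty
      simpa [← hcov] using subset_univ t
    simp [this]
  obtain ⟨f, rfl⟩ := hs.exists_eq_range hne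
  set D := disjointed fun n => interior (N (f n)) with hD
  have hDm : ∀ n, MeasurableSet (D n) :=
    MeasurableSet.disjointed fun n => isOpen_interior.measurableSet
  have hun : t = ⋃ n, t ∩ D n := by
    rw [← inter_iUnion, iUnion_disjointed]
    simp only [biUnion_range] at hcov
    rw [hcov, inter_univ]
  have hdisj : Pairwise (Function.onFun Disjoint fun n => t ∩ D n) := fun i j hij =>
    (disjoint_disjointed _ hij).mono inter_subset_right inter_subset_right
  rw [hun, measure_iUnion hdisj fun n => ht.inter (hDm n),
    measure_iUnion hdisj fun n => ht.inter (hDm n)]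
  refine ENNReal.tsum_le_tsum fun n => hle (f n) _ ?_ (ht.inter (hDm n))
  exact inter_subset_right.trans ((disjointed_subset _ _).trans interior_subset)

/-- If `f` expands distances at most `K` times as much as `g`, then it expands the Hausdorff
measure at most `K ^ d` times as much. -/
theorem euclideanHausdorffMeasure_image_le_of_edist_le {α X Y : Type*} [EMetricSpace X]
    [MeasurableSpace X] [BorelSpace X] [EMetricSpace Y] [MeasurableSpace Y] [BorelSpace Y]
    {f : α → X} {g : α → Y} {K : ℝ≥0} {s : Set α}
    (h : ∀ x ∈ s, ∀ y ∈ s, edist (f x) (f y) ≤ K * edist (g x) (g y)) (d : ℕ) :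
    μHE[d] (f '' s) ≤ (K : ℝ≥0∞) ^ d * μHE[d] (g '' s) := by
  classical
  rcases s.eq_empty_or_nonempty with rfl | ⟨x₀, hx₀⟩
  · simp
  have : Nonempty α := ⟨x₀⟩
  set F : Y → X := fun y => f (Function.invFunOn g s y) with hF
  have hmem : ∀ y ∈ g '' s, Function.invFunOn g s y ∈ s := fun y hy => Function.invFunOn_mem hy
  have heq : ∀ y ∈ g '' s, g (Function.invFunOn g s y) = y := fun y hy => Function.invFunOn_eq hy
  have hLip : LipschitzOnWith K F (g '' s) := by
    intro y hy z hz
    have := h _ (hmem y hy) _ (hmem z hz)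
    rwa [heq y hy, heq z hz] at this
  have himg : f '' s ⊆ F '' (g '' s) := by
    rintro _ ⟨x, hx, rfl⟩
    refine ⟨g x, mem_image_of_mem _ hx, ?_⟩
    have hgx := mem_image_of_mem g hx
    have := h _ (hmem _ hgx) _ hx
    rw [heq _ hgx, edist_self, mul_zero, nonpos_iff_eq_zero, edist_eq_zero] at this
    exact this
  have hH := hLip.hausdorffMeasure_image_le (d := d) (Nat.cast_nonneg d)
  rw [ENNReal.rpow_natCast] at hH
  simp_rw [Measure.euclideanHausdorffMeasure_def, Measure.smul_apply, Measure.nnreal_smul_coe_apply]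
  calc _ ≤ _ * ((K : ℝ≥0∞) ^ d * μH[d] (g '' s)) := by
        gcongr
        exact (measure_mono himg).trans hH
    _ = _ := mul_left_comm _ _ _

variable {V W : Type*} [NormedAddCommGroup V] [InnerProductSpace ℝ V] [FiniteDimensional ℝ V]
  [MeasurableSpace V] [BorelSpace V] [NormedAddCommGroup W] [InnerProductSpace ℝ W]
  [MeasurableSpace W] [BorelSpace W]

/-- Near a point where its derivative `A` is injective, a map distorts Hausdorff measure like `A`,
up to a factor `K ^ dim` with `K` as close to `1` as desired. -/
theorem exists_nhds_euclideanHausdorffMeasure_image {G : V → W} {A : V →L[ℝ] W} {w : V}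
    (hG : HasStrictFDerivAt G A w) (hA : Function.Injective A) {K : ℝ≥0} (hK : 1 < K) :
    ∃ N ∈ 𝓝 w, ∀ s ⊆ N,
      μHE[finrank ℝ V] (G '' s) ≤
        (K : ℝ≥0∞) ^ finrank ℝ V * (ENNReal.ofReal A.toLinearMap.normDet * volume s) ∧
      ENNReal.ofReal A.toLinearMap.normDet * volume s ≤
        (K : ℝ≥0∞) ^ finrank ℝ V * μHE[finrank ℝ V] (G '' s) := by
  obtain ⟨c, hc, hac⟩ := A.toLinearMap.exists_antilipschitzWith (LinearMap.ker_eq_bot.2 hA)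
  have hanti : ∀ v, ‖v‖ ≤ c * ‖A v‖ := fun v => by
    simpa using hac.le_mul_dist v 0
  have hK' : (1 : ℝ) < K := by exact_mod_cast hK
  have hK0 : (0 : ℝ) < K := by linarith
  have hη : (0 : ℝ) < 1 - (K : ℝ)⁻¹ := by
    have := inv_lt_one_of_one_lt₀ hK'
    linarith
  have hη' : 1 - (K : ℝ)⁻¹ ≤ K - 1 := by
    have h1 : (K : ℝ) * (K : ℝ)⁻¹ = 1 := mul_inv_cancel₀ hK0.ne'
    nlinarith [sq_nonneg ((K : ℝ) - 1), inv_pos.2 hK0]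
  -- `δ` is chosen so that the error `δ ‖v‖` is at most `(1 - 1 / K) ‖A v‖`.
  set δ : ℝ≥0 := Real.toNNReal ((1 - (K : ℝ)⁻¹) / c) with hδ
  have hc' : (0 : ℝ) < c := by exact_mod_cast hc
  have hδ0 : 0 < δ := Real.toNNReal_pos.2 (by positivity)
  have hδc : (δ : ℝ) * c = 1 - (K : ℝ)⁻¹ := by
    rw [hδ, Real.coe_toNNReal _ (by positivity)]
    field_simp
  obtain ⟨N, hN, happ⟩ := hG.approximates_deriv_on_nhds (c := δ) (Or.inr hδ0)
  have hest : ∀ x ∈ N, ∀ y ∈ N, ‖G x - G y - A (x - y)‖ ≤ (1 - (K : ℝ)⁻¹) * ‖A (x - y)‖ := by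
    intro x hx y hy
    calc _ ≤ δ * ‖x - y‖ := happ x hx y hy
      _ ≤ δ * (c * ‖A (x - y)‖) := by gcongr; exact hanti _
      _ = _ := by rw [← mul_assoc, hδc]
  have hle1 : ∀ x ∈ N, ∀ y ∈ N, edist (G x) (G y) ≤ K * edist (A x) (A y) := by
    intro x hx y hy
    have h1 := hest x hx y hy
    have h2 : ‖G x - G y‖ ≤ K * ‖A (x - y)‖ := by
      have : ‖G x - G y‖ ≤ ‖G x - G y - A (x - y)‖ + ‖A (x - y)‖ := by
        simpa using norm_add_le (G x - G y - A (x - y)) (A (x - y))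
      nlinarith [norm_nonneg (A (x - y))]
    rw [edist_dist, edist_dist, ← ENNReal.ofReal_coe_nnreal (p := K),
      ← ENNReal.ofReal_mul (NNReal.coe_nonneg K)]
    apply ENNReal.ofReal_le_ofReal
    rw [dist_eq_norm, dist_eq_norm, ← map_sub]
    exact h2
  have hle2 : ∀ x ∈ N, ∀ y ∈ N, edist (A x) (A y) ≤ K * edist (G x) (G y) := by
    intro x hx y hy
    have h1 := hest x hx y hy
    have h2 : ‖A (x - y)‖ ≤ K * ‖G x - G y‖ := by
      have h3 : ‖A (x - y)‖ ≤ ‖G x - G y‖ + ‖G x - G y - A (x - y)‖ := by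
        have := norm_sub_le (G x - G y) (G x - G y - A (x - y))
        rwa [sub_sub_cancel] at this
      have h4 : (K : ℝ)⁻¹ * ‖A (x - y)‖ ≤ ‖G x - G y‖ := by linarith
      calc ‖A (x - y)‖ = K * ((K : ℝ)⁻¹ * ‖A (x - y)‖) := by
            rw [← mul_assoc, mul_inv_cancel₀ hK0.ne', one_mul]
        _ ≤ _ := by gcongr
    rw [edist_dist, edist_dist, ← ENNReal.ofReal_coe_nnreal (p := K),
      ← ENNReal.ofReal_mul (NNReal.coe_nonneg K)]
    apply ENNReal.ofReal_le_ofReal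
    rw [dist_eq_norm, dist_eq_norm, ← map_sub]
    exact h2
  refine ⟨N, hN, fun s hs => ?_⟩
  rw [← A.toLinearMap.euclideanHausdorffMeasure_image_eq_normDet_mul_volume s]
  exact ⟨euclideanHausdorffMeasure_image_le_of_edist_le
      (fun x hx y hy => hle1 x (hs hx) y (hs hy)) _,
    euclideanHausdorffMeasure_image_le_of_edist_le
      (fun x hx y hy => hle2 x (hs hx) y (hs hy)) _⟩

/-- The area formula: on the image of an injective immersion whose volume factor `J` is continuous,
the Hausdorff measure is the image of `J dw`. -/
theorem comap_euclideanHausdorffMeasure_eq_withDensity {G : V → W} (hG : ContDiff ℝ 1 G)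
    (hGm : MeasurableEmbedding G) (hinj : ∀ w, Function.Injective (fderiv ℝ G w)) {J : V → ℝ}
    (hJ : ∀ w, J w = (fderiv ℝ G w).toLinearMap.normDet) (hJc : Continuous J) :
    Measure.comap G μHE[finrank ℝ V] = volume.withDensity fun w => ENNReal.ofReal (J w) := by
  set m := finrank ℝ V
  have hJm : Measurable fun w => ENNReal.ofReal (J w) := hJc.measurable.ennreal_ofReal
  have hJpos : ∀ w, 0 < J w := by
    intro w
    rw [hJ]
    refine lt_of_le_of_ne (LinearMap.normDet_nonneg _) (Ne.symm ?_)
    rw [Ne, LinearMap.normDet_eq_zero_iff_ker_ne_bot, not_not]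
    exact LinearMap.ker_eq_bot.2 (hinj w)
  -- Comparison up to a factor `K ^ (m + 1)`.
  have key : ∀ K : ℝ≥0, 1 < K →
      Measure.comap G μHE[m] ≤
        (K ^ (m + 1)) • volume.withDensity (fun w => ENNReal.ofReal (J w)) ∧
      volume.withDensity (fun w => ENNReal.ofReal (J w)) ≤
        (K ^ (m + 1)) • Measure.comap G μHE[m] := by
    intro K hK
    have hK' : (1 : ℝ) < K := by exact_mod_cast hK
    have hloc : ∀ w, ∃ N ∈ 𝓝 w, ∀ s ⊆ N, MeasurableSet s →
        (Measure.comap G μHE[m] s ≤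
          (K ^ (m + 1) : ℝ≥0) * volume.withDensity (fun w => ENNReal.ofReal (J w)) s ∧
        volume.withDensity (fun w => ENNReal.ofReal (J w)) s ≤
          (K ^ (m + 1) : ℝ≥0) * Measure.comap G μHE[m] s) := by
      intro w
      obtain ⟨N, hN, hle⟩ := exists_nhds_euclideanHausdorffMeasure_image
        (hG.contDiffAt.hasStrictFDerivAt (x := w) (by norm_num)) (hinj w) hK
      have hN1 : ∀ᶠ x in 𝓝 w, J w < K * J x := by
        have : Continuous fun x => (K : ℝ) * J x := by fun_prop
        refine this.continuousAt.eventually_const_lt ?_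
        nlinarith [hJpos w]
      have hN2 : ∀ᶠ x in 𝓝 w, J x < K * J w := by
        refine hJc.continuousAt.eventually_lt_const ?_
        nlinarith [hJpos w]
      refine ⟨N ∩ {x | J w < K * J x ∧ J x < K * J w}, inter_mem hN (hN1.and hN2), ?_⟩
      intro s hs hsm
      have h := hle s (hs.trans inter_subset_left)
      rw [← hJ] at h
      rw [hGm.comap_apply, withDensity_apply _ hsm]
      have hlow : ENNReal.ofReal (J w) * volume s ≤ K * ∫⁻ x in s, ENNReal.ofReal (J x) := by
        rw [← lintegral_const_mul _ hJm, ← setLIntegral_const]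
        refine setLIntegral_mono (by fun_prop) fun x hx => ?_
        rw [← ENNReal.ofReal_coe_nnreal (p := K), ← ENNReal.ofReal_mul (NNReal.coe_nonneg K)]
        exact ENNReal.ofReal_le_ofReal (hs hx).2.1.le
      have hup : ∫⁻ x in s, ENNReal.ofReal (J x) ≤ K * (ENNReal.ofReal (J w) * volume s) := by
        rw [← mul_assoc, ← setLIntegral_const]
        refine setLIntegral_mono (by fun_prop) fun x hx => ?_
        rw [← ENNReal.ofReal_coe_nnreal (p := K), ← ENNReal.ofReal_mul (NNReal.coe_nonneg K)]
        exact ENNReal.ofReal_le_ofReal (hs hx).2.2.le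
      push_cast
      constructor
      · calc _ ≤ _ := h.1
          _ ≤ (K : ℝ≥0∞) ^ m * (K * ∫⁻ x in s, ENNReal.ofReal (J x)) := by gcongr
          _ = _ := by ring
      · calc _ ≤ _ := hup
          _ ≤ K * ((K : ℝ≥0∞) ^ m * μHE[m] (G '' s)) := mul_le_mul_right h.2 _
          _ = _ := by ring
    constructor
    · refine measure_le_of_locally_le fun w => ?_
      obtain ⟨N, hN, h⟩ := hloc w
      exact ⟨N, hN, fun s hs hsm => (h s hs hsm).1⟩
    · refine measure_le_of_locally_le fun w => ?_
      obtain ⟨N, hN, h⟩ := hloc w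
      exact ⟨N, hN, fun s hs hsm => (h s hs hsm).2⟩
  -- `a ≤ K ^ (m + 1) b` for all `K > 1` gives `a ≤ b`.
  have lim : ∀ a b : ℝ≥0∞, (∀ K : ℝ≥0, 1 < K → a ≤ (K ^ (m + 1) : ℝ≥0) * b) → a ≤ b := by
    intro a b hab
    have hpow : Tendsto (fun K : ℝ≥0 => ((K ^ (m + 1) : ℝ≥0) : ℝ≥0∞)) (𝓝[>] 1) (𝓝 1) := by
      have : Tendsto (fun K : ℝ≥0 => K ^ (m + 1)) (𝓝[>] 1) (𝓝 1) := by
        have h := (continuous_pow (M := ℝ≥0) (m + 1)).tendsto 1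
        rw [one_pow] at h
        exact h.mono_left nhdsWithin_le_nhds
      exact ENNReal.tendsto_coe.2 this
    have ht : Tendsto (fun K : ℝ≥0 => ((K ^ (m + 1) : ℝ≥0) : ℝ≥0∞) * b) (𝓝[>] 1) (𝓝 (1 * b)) :=
      ENNReal.Tendsto.mul_const hpow (Or.inl one_ne_zero)
    rw [one_mul] at ht
    exact ge_of_tendsto ht (eventually_nhdsWithin_of_forall fun K hK => hab K hK)
  ext s hs
  refine le_antisymm (lim _ _ fun K hK => ?_) (lim _ _ fun K hK => ?_)
  · exact (key K hK).1 s
  · exact (key K hK).2 s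

end

noncomputable section

/-! ### Graphs over a coordinate hyperplane -/

open scoped ENNReal NNReal RealInnerProductSpace
open Module Filter

theorem isClosedEmbedding_prodMkLeft {X Y : Type*} [TopologicalSpace X] [TopologicalSpace Y]
    [T1Space Y] (y : Y) : IsClosedEmbedding fun x : X => (x, y) := by
  refine ⟨isEmbedding_prodMkLeft y, ?_⟩
  have : range (fun x : X => (x, y)) = univ ×ˢ {y} := by ext ⟨a, b⟩; simp [eq_comm]
  rw [this]
  exact isClosed_univ.prod isClosed_singleton

theorem isClosedEmbedding_prodMkRight {X Y : Type*} [TopologicalSpace X] [TopologicalSpace Y]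
    [T1Space X] (x : X) : IsClosedEmbedding fun y : Y => (x, y) := by
  refine ⟨isEmbedding_prodMkRight x, ?_⟩
  have : range (fun y : Y => (x, y)) = {x} ×ˢ univ := by ext ⟨a, b⟩; simp [eq_comm]
  rw [this]
  exact isClosed_singleton.prod isClosed_univ

theorem integral_fderiv_apply_eq_zero {E : Type*} [NormedAddCommGroup E] [NormedSpace ℝ E]
    [FiniteDimensional ℝ E] [MeasurableSpace E] [BorelSpace E] {μ : Measure E}
    [μ.IsAddHaarMeasure] {h : E → ℝ} (hh : ContDiff ℝ 1 h) (hc : HasCompactSupport h) (e : E) :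
    ∫ x, fderiv ℝ h x e ∂μ = 0 := by
  have hfd := hh.continuous_fderiv (by norm_num)
  have := integral_mul_fderiv_eq_neg_fderiv_mul_of_integrable (μ := μ)
    (f := fun _ : E => (1 : ℝ)) (g := h) (v := e) (by simp)
    (by
      simp only [one_mul]
      exact (by fun_prop : Continuous _).integrable_of_hasCompactSupport (hc.fderiv_apply ℝ e))
    (by
      simp only [one_mul]
      exact hh.continuous.integrable_of_hasCompactSupport hc)
    (fun _ _ => differentiableAt_const _) (fun w _ => hh.differentiable (by norm_num) w)
  simpa using this

variable {m : ℕ}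

/-- The coordinate `y_k` of a point of `ℝ^(m+1)` is split off: `(w, τ)` is the point with
`y_k = τ` whose other coordinates are those of `w`. -/
def insCoord (k : Fin (m + 1)) : (Space m × ℝ) ≃L[ℝ] Space (m + 1) :=
  LinearEquiv.toContinuousLinearEquiv
    { toFun := fun p => WithLp.toLp 2 (k.insertNth p.2 fun j => p.1 j)
      invFun := fun y => (WithLp.toLp 2 fun j => y (k.succAbove j), y k)
      map_add' := fun p q => by
        ext j
        refine Fin.succAboveCases k ?_ (fun i => ?_) j <;> simp
      map_smul' := fun c p => by
        ext j
        refine Fin.succAboveCases k ?_ (fun i => ?_) j <;> simp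
      left_inv := fun p => by
        ext <;> simp
      right_inv := fun y => by
        ext j
        refine Fin.succAboveCases k ?_ (fun i => ?_) j <;> simp }

@[simp] theorem insCoord_same (k : Fin (m + 1)) (p : Space m × ℝ) : insCoord k p k = p.2 := by
  simp [insCoord]

@[simp] theorem insCoord_succAbove (k : Fin (m + 1)) (p : Space m × ℝ) (j : Fin m) :
    insCoord k p (k.succAbove j) = p.1 j := by
  simp [insCoord]

@[simp] theorem insCoord_symm_snd (k : Fin (m + 1)) (y : Space (m + 1)) :
    ((insCoord k).symm y).2 = y k := rfl

theorem inner_insCoord (k : Fin (m + 1)) (p q : Space m × ℝ) :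
    ⟪insCoord k p, insCoord k q⟫ = ⟪p.1, q.1⟫ + p.2 * q.2 := by
  simp only [PiLp.inner_apply, Fin.sum_univ_succAbove _ k, insCoord_same, insCoord_succAbove]
  simp [add_comm, mul_comm]

theorem norm_sq_insCoord (k : Fin (m + 1)) (p : Space m × ℝ) :
    ‖insCoord k p‖ ^ 2 = ‖p.1‖ ^ 2 + p.2 ^ 2 := by
  rw [← real_inner_self_eq_norm_sq, inner_insCoord, real_inner_self_eq_norm_sq, sq p.2]

theorem measurePreserving_insCoord (k : Fin (m + 1)) :
    MeasurePreserving (insCoord k) (volume : Measure (Space m × ℝ)) volume := by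
  have h1 : MeasurePreserving (fun p : Space m × ℝ => (p.2, WithLp.ofLp p.1)) volume volume :=
    ((MeasurePreserving.id volume).prod (PiLp.volume_preserving_ofLp (Fin m))).comp
      Measure.measurePreserving_swap
  have h2 := (volume_preserving_piFinSuccAbove (fun _ : Fin (m + 1) => ℝ) k).symm
  have h3 := PiLp.volume_preserving_toLp (Fin (m + 1))
  exact h3.comp (h2.comp h1)

section Graph

variable (k : Fin (m + 1)) (s : ℝ) (g : Space m → ℝ)

/-- The defining function `s y_k - g(w)` of the graph, with `w` the coordinates other than `y_k`. -/
def graphFun (y : Space (m + 1)) : ℝ := s * y k - g ((insCoord k).symm y).1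

/-- The shear `(w, τ) ↦ (w, y_k = s (τ + g(w)))` that straightens the graph to `{τ = 0}` when
`s = ±1`. -/
def shear (p : Space m × ℝ) : Space (m + 1) := insCoord k (p.1, s * (p.2 + g p.1))

/-- The parametrization of the graph by the other coordinates. -/
def graphParam (w : Space m) : Space (m + 1) := shear k s g (w, 0)

variable {k s g}

theorem contDiff_graphFun (hg : ContDiff ℝ 1 g) : ContDiff ℝ 1 (graphFun k s g) := by
  unfold graphFun
  fun_prop

theorem contDiff_shear (hg : ContDiff ℝ 1 g) : ContDiff ℝ 1 (shear k s g) := by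
  unfold shear
  fun_prop

theorem contDiff_graphParam (hg : ContDiff ℝ 1 g) : ContDiff ℝ 1 (graphParam k s g) :=
  (contDiff_shear hg).comp (by fun_prop)

theorem graphFun_shear (hs : s * s = 1) (p : Space m × ℝ) :
    graphFun k s g (shear k s g p) = p.2 := by
  simp only [graphFun, shear, insCoord_same, ContinuousLinearEquiv.symm_apply_apply]
  linear_combination (p.2 + g p.1) * hs

/-- The shear as a homeomorphism. -/
def shearHomeomorph (k : Fin (m + 1)) (hs : s * s = 1) (hg : ContDiff ℝ 1 g) :
    Space m × ℝ ≃ₜ Space (m + 1) where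
  toFun := shear k s g
  invFun y := (((insCoord k).symm y).1, graphFun k s g y)
  left_inv p := by
    ext1
    · simp [shear]
    · exact graphFun_shear hs p
  right_inv y := by
    simp only [shear, graphFun]
    apply (insCoord k).symm.injective
    ext1
    · simp
    · simp only [ContinuousLinearEquiv.symm_apply_apply, insCoord_symm_snd]
      linear_combination (y k) * hs
  continuous_toFun := (contDiff_shear hg).continuous
  continuous_invFun := by
    have := (contDiff_graphFun (k := k) (s := s) hg).continuous
    fun_prop

theorem measurePreserving_shear (hs : s * s = 1) (hg : ContDiff ℝ 1 g) :
    MeasurePreserving (shear k s g) volume volume := by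
  refine (measurePreserving_insCoord k).comp (g := insCoord k)
    (f := fun p : Space m × ℝ => (p.1, s * (p.2 + g p.1))) ?_
  have hgc := hg.continuous
  refine (MeasurePreserving.id volume).skew_product (g := fun w τ => s * (τ + g w))
    (by fun_prop) (Eventually.of_forall fun w => ?_)
  have hsabs : |s| = 1 := by
    have : |s| * |s| = 1 := by rw [abs_mul_abs_self, hs]
    nlinarith [abs_nonneg s]
  have hs0 : s ≠ 0 := by rintro rfl; simp at hs
  have h1 : Measure.map (fun τ : ℝ => τ + g w) volume = volume := map_add_right_eq_self _ _
  have h2 : Measure.map (fun τ : ℝ => s * τ) volume = volume := by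
    rw [Real.map_volume_mul_left hs0, abs_inv, hsabs]
    simp
  have h3 : (fun τ : ℝ => s * (τ + g w)) = (fun τ => s * τ) ∘ fun τ => τ + g w := rfl
  rw [h3, ← Measure.map_map (by fun_prop) (by fun_prop), h1, h2]

theorem range_graphParam (hs : s * s = 1) (hg : ContDiff ℝ 1 g) :
    range (graphParam k s g) = {y | graphFun k s g y = 0} := by
  ext y
  constructor
  · rintro ⟨w, rfl⟩
    exact graphFun_shear hs _
  · intro hy
    refine ⟨((insCoord k).symm y).1, ?_⟩
    have h := (shearHomeomorph k hs hg).right_inv y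
    have hy' : graphFun k s g y = 0 := hy
    simpa [shearHomeomorph, hy', graphParam] using h

theorem isClosedEmbedding_graphParam (hs : s * s = 1) (hg : ContDiff ℝ 1 g) :
    IsClosedEmbedding (graphParam k s g) :=
  (shearHomeomorph k hs hg).isClosedEmbedding.comp (isClosedEmbedding_prodMkLeft 0)

theorem fderiv_graphFun_apply (hg : ContDiff ℝ 1 g) (y : Space (m + 1)) (p : Space m × ℝ) :
    fderiv ℝ (graphFun k s g) y (insCoord k p)
      = s * p.2 - fderiv ℝ g ((insCoord k).symm y).1 p.1 := by
  have hgd := (hg.differentiable (by norm_num) ((insCoord k).symm y).1).hasFDerivAt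
  have h0 := (insCoord k).symm.hasFDerivAt (x := y)
  have h1 : HasFDerivAt (fun y : Space (m + 1) => ((insCoord k).symm y).1) _ y := h0.fst
  have h2 : HasFDerivAt (fun y : Space (m + 1) => ((insCoord k).symm y).2) _ y := h0.snd
  have h3 : HasFDerivAt (graphFun k s g) _ y := (h2.const_mul s).sub (hgd.comp y h1)
  rw [h3.fderiv]
  simp

theorem fderiv_shear_apply (hg : ContDiff ℝ 1 g) (p q : Space m × ℝ) :
    fderiv ℝ (shear k s g) p q = insCoord k (q.1, s * (q.2 + fderiv ℝ g p.1 q.1)) := by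
  have hgd := (hg.differentiable (by norm_num) p.1).hasFDerivAt
  have h1 : HasFDerivAt (fun p : Space m × ℝ => g p.1) _ p := hgd.comp p hasFDerivAt_fst
  have h2 : HasFDerivAt (fun p : Space m × ℝ => (p.1, s * (p.2 + g p.1))) _ p :=
    hasFDerivAt_fst.prodMk ((hasFDerivAt_snd.add h1).const_mul s)
  have h3 : HasFDerivAt (shear k s g) _ p := ((insCoord k).hasFDerivAt).comp p h2
  rw [h3.fderiv]
  simp [mul_add]

theorem fderiv_graphParam_apply (hg : ContDiff ℝ 1 g) (w v : Space m) :
    fderiv ℝ (graphParam k s g) w v = insCoord k (v, s * fderiv ℝ g w v) := by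
  have h1 : HasFDerivAt (fun w : Space m => (w, (0 : ℝ)))
      (ContinuousLinearMap.inl ℝ (Space m) ℝ) w := hasFDerivAt_prodMk_left w 0
  have h2 : HasFDerivAt (graphParam k s g) _ w :=
    (((contDiff_shear (k := k) (s := s) hg).differentiable (by norm_num)
      (w, (0 : ℝ))).hasFDerivAt).comp w h1
  rw [h2.fderiv]
  simp [fderiv_shear_apply hg]

theorem gradient_graphFun (hg : ContDiff ℝ 1 g) (y : Space (m + 1)) :
    gradient (graphFun k s g) y
      = insCoord k (- gradient g ((insCoord k).symm y).1, s) := by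
  refine ext_inner_right ℝ fun z => ?_
  obtain ⟨p, rfl⟩ := (insCoord k).surjective z
  rw [inner_insCoord, gradient, InnerProductSpace.toDual_symm_apply, fderiv_graphFun_apply hg,
    inner_neg_left, gradient, InnerProductSpace.toDual_symm_apply]
  ring

theorem norm_gradient_graphFun_sq (hs : s * s = 1) (hg : ContDiff ℝ 1 g) (y : Space (m + 1)) :
    ‖gradient (graphFun k s g) y‖ ^ 2 = 1 + ‖gradient g ((insCoord k).symm y).1‖ ^ 2 := by
  rw [gradient_graphFun hg, norm_sq_insCoord, norm_neg, sq s, hs, add_comm]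

/-- The volume factor of the parametrization is the length of the gradient of the defining
function. -/
theorem normDet_graphParam (hs : s * s = 1) (hg : ContDiff ℝ 1 g) (w : Space m) :
    ‖gradient (graphFun k s g) (graphParam k s g w)‖
      = (fderiv ℝ (graphParam k s g) w).toLinearMap.normDet := by
  rw [← sq_eq_sq₀ (norm_nonneg _) (LinearMap.normDet_nonneg _), norm_gradient_graphFun_sq hs hg]
  have h := LinearMap.normDet_sq_eq_det_gram (𝕜 := ℝ)
    (fderiv ℝ (graphParam k s g) w).toLinearMap (EuclideanSpace.basisFun (Fin m) ℝ)
  rw [RCLike.ofReal_real_eq_id, id] at h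
  rw [h]
  set a : Fin m → ℝ := fun i => fderiv ℝ g w (EuclideanSpace.basisFun (Fin m) ℝ i) with ha
  have hgram : Matrix.gram ℝ (fun i => (fderiv ℝ (graphParam k s g) w).toLinearMap
      (EuclideanSpace.basisFun (Fin m) ℝ i))
      = 1 + Matrix.replicateCol Unit a * Matrix.replicateRow Unit a := by
    ext i j
    simp only [Matrix.gram_apply, ContinuousLinearMap.coe_coe, fderiv_graphParam_apply hg,
      inner_insCoord, Matrix.add_apply, Matrix.mul_apply]
    rw [orthonormal_iff_ite.1 (EuclideanSpace.basisFun (Fin m) ℝ).orthonormal i j]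
    simp only [Matrix.one_apply, Matrix.replicateCol_apply, Matrix.replicateRow_apply,
      Finset.univ_unique, Finset.sum_const, Finset.card_singleton, one_smul]
    linear_combination (a i * a j) * hs
  rw [hgram, Matrix.det_one_add_replicateCol_mul_replicateRow]
  have hw : ((insCoord k).symm (graphParam k s g w)).1 = w := by simp [graphParam, shear]
  rw [hw, ← (EuclideanSpace.basisFun (Fin m) ℝ).sum_sq_norm_inner_right (gradient g w)]
  congr 1
  simp only [dotProduct, ha]
  refine Finset.sum_congr rfl fun i _ => ?_
  rw [real_inner_comm, gradient, InnerProductSpace.toDual_symm_apply, Real.norm_eq_abs, sq_abs, sq]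

theorem comap_graphParam (hs : s * s = 1) (hg : ContDiff ℝ 1 g) :
    Measure.comap (graphParam k s g) μHE[m] = volume.withDensity fun w =>
      ENNReal.ofReal ‖gradient (graphFun k s g) (graphParam k s g w)‖ := by
  have h := comap_euclideanHausdorffMeasure_eq_withDensity
    (contDiff_graphParam (k := k) (s := s) hg)
    (isClosedEmbedding_graphParam hs hg).measurableEmbedding
    (fun w v v' hv => by
      rw [fderiv_graphParam_apply hg, fderiv_graphParam_apply hg] at hv
      exact congrArg Prod.fst ((insCoord k).injective hv))
    (normDet_graphParam hs hg) ?_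
  · rwa [finrank_euclideanSpace_fin] at h
  · have h1 := (contDiff_graphFun (k := k) (s := s) hg).continuous_fderiv (by norm_num)
    have h2 := (contDiff_graphParam (k := k) (s := s) hg).continuous
    unfold gradient
    fun_prop

/-- Integration over the graph in the coordinates of the hyperplane. -/
theorem integral_graph (hs : s * s = 1) (hg : ContDiff ℝ 1 g) (F : Space (m + 1) → ℝ) :
    ∫ y in {y | graphFun k s g y = 0}, F y ∂μHE[m] = ∫ w,
      ‖gradient (graphFun k s g) (graphParam k s g w)‖ * F (graphParam k s g w) := by
  have hemb := (isClosedEmbedding_graphParam (k := k) hs hg).measurableEmbedding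
  rw [← range_graphParam hs hg, ← hemb.map_comap, hemb.integral_map, comap_graphParam hs hg]
  have h1 := (contDiff_graphFun (k := k) (s := s) hg).continuous_fderiv (by norm_num)
  have h2 := (contDiff_graphParam (k := k) (s := s) hg).continuous
  have hc : Continuous fun w => ‖gradient (graphFun k s g) (graphParam k s g w)‖ := by
    unfold gradient
    fun_prop
  rw [integral_withDensity_eq_integral_toReal_smul hc.measurable.ennreal_ofReal
    (Eventually.of_forall fun _ => ENNReal.ofReal_lt_top)]
  refine integral_congr_ae (Eventually.of_forall fun w => ?_)
  simp only [smul_eq_mul, ENNReal.toReal_ofReal (norm_nonneg _)]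

/-- The divergence theorem for the region below a graph: the shear reduces it to a half space. -/
theorem integral_fderiv_subgraph (hs : s * s = 1) (hg : ContDiff ℝ 1 g) {h : Space (m + 1) → ℝ}
    (hh : ContDiff ℝ 1 h) (hc : HasCompactSupport h) (e : Space (m + 1)) :
    ∫ y in {y | graphFun k s g y < 0}, fderiv ℝ h y e
      = ∫ w, h (graphParam k s g w) * fderiv ℝ (graphFun k s g) (graphParam k s g w) e := by
  obtain ⟨⟨b, a⟩, rfl⟩ := (insCoord k).surjective e
  set H : Space m × ℝ → ℝ := h ∘ shear k s g with hH
  have hHd : ContDiff ℝ 1 H := hh.comp (contDiff_shear hg)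
  have hHc : HasCompactSupport H :=
    hc.comp_isClosedEmbedding (shearHomeomorph k hs hg).isClosedEmbedding
  set q : Space m → ℝ := fun w => s * a - fderiv ℝ g w b with hq
  have hgc := hg.continuous_fderiv (by norm_num)
  have hqc : Continuous q := by fun_prop
  have hHdc := hHd.continuous_fderiv (by norm_num)
  have hHdiff := hHd.differentiable (by norm_num)
  -- In the sheared variables the derivative along `e` is a derivative along `b` plus `q ∂_τ`.
  have hpt : ∀ p : Space m × ℝ, fderiv ℝ h (shear k s g p) (insCoord k (b, a))
      = fderiv ℝ H p (b, 0) + q p.1 * fderiv ℝ H p (0, 1) := by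
    intro p
    have h1 : fderiv ℝ H p = (fderiv ℝ h (shear k s g p)).comp (fderiv ℝ (shear k s g) p) :=
      fderiv_comp p (hh.differentiable (by norm_num) _)
        ((contDiff_shear hg).differentiable (by norm_num) _)
    have h2 : (b, (0 : ℝ)) + q p.1 • ((0 : Space m), (1 : ℝ)) = (b, q p.1) := by
      ext1 <;> simp
    rw [← smul_eq_mul, ← map_smul, ← map_add, h2, h1, ContinuousLinearMap.comp_apply,
      fderiv_shear_apply hg]
    congr 3
    simp only [hq]
    linear_combination (-a) * hs
  have hcs1 : HasCompactSupport fun p => fderiv ℝ H p (b, 0) := hHc.fderiv_apply ℝ _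
  have hcs2 : HasCompactSupport fun p : Space m × ℝ => q p.1 * fderiv ℝ H p (0, 1) :=
    (hHc.fderiv_apply ℝ _).mul_left
  have hi1 : Integrable fun p : Space m × ℝ => fderiv ℝ H p (b, 0) :=
    (by fun_prop : Continuous _).integrable_of_hasCompactSupport hcs1
  have hi2 : Integrable fun p : Space m × ℝ => q p.1 * fderiv ℝ H p (0, 1) :=
    (by fun_prop : Continuous _).integrable_of_hasCompactSupport hcs2
  have hset : shear k s g ⁻¹' {y | graphFun k s g y < 0} = univ ×ˢ Iio 0 := by
    ext p
    simp [graphFun_shear hs]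
  have hmp := measurePreserving_shear (k := k) hs hg
  rw [← hmp.setIntegral_preimage_emb
    (shearHomeomorph k hs hg).toMeasurableEquiv.measurableEmbedding, hset]
  simp only [hpt]
  rw [integral_add hi1.integrableOn hi2.integrableOn]
  -- The tangential part integrates to zero on every slice.
  have hz1 : ∫ p in univ ×ˢ Iio (0 : ℝ), fderiv ℝ H p (b, 0) = 0 := by
    rw [Measure.volume_eq_prod, ← Measure.prod_restrict, integral_prod_symm]
    · refine integral_eq_zero_of_ae (Eventually.of_forall fun τ => ?_)
      simp only [Pi.zero_apply]
      rw [Measure.restrict_univ]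
      have hd : ∀ w, HasFDerivAt (fun w => H (w, τ))
          ((fderiv ℝ H (w, τ)).comp (ContinuousLinearMap.inl ℝ _ _)) w := fun w =>
        HasFDerivAt.comp (g := H) w (hHdiff (w, τ)).hasFDerivAt (hasFDerivAt_prodMk_left w τ)
      have hcsl : HasCompactSupport fun w => H (w, τ) :=
        hHc.comp_isClosedEmbedding (isClosedEmbedding_prodMkLeft τ)
      have hcd : ContDiff ℝ 1 fun w => H (w, τ) := hHd.comp (by fun_prop)
      refine Eq.trans ?_ (integral_fderiv_apply_eq_zero (μ := volume) hcd hcsl b)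
      refine integral_congr_ae (Eventually.of_forall fun w => ?_)
      simp [(hd w).fderiv]
    · rw [Measure.prod_restrict]
      exact hi1.integrableOn
  rw [hz1, zero_add]
  have hi2' : IntegrableOn (fun p : Space m × ℝ => q p.1 * fderiv ℝ H p (0, 1))
      (univ ×ˢ Iio 0) (volume.prod volume) := hi2.integrableOn
  rw [Measure.volume_eq_prod, setIntegral_prod _ hi2', Measure.restrict_univ]
  refine integral_congr_ae (Eventually.of_forall fun w => ?_)
  simp only
  rw [integral_const_mul, fderiv_graphFun_apply hg, mul_comm]
  have hw : ((insCoord k).symm (graphParam k s g w)).1 = w := by simp [graphParam, shear]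
  rw [hw]
  congr 1
  have hd : ∀ τ, HasDerivAt (fun τ => H (w, τ)) (fderiv ℝ H (w, τ) (0, 1)) τ := fun τ => by
    have := ((hHdiff (w, τ)).hasFDerivAt).comp_hasDerivAt τ
      ((hasDerivAt_const τ w).prodMk (hasDerivAt_id τ))
    simpa [Function.comp_def] using this
  have hcsr : HasCompactSupport fun τ => H (w, τ) :=
    hHc.comp_isClosedEmbedding (isClosedEmbedding_prodMkRight w)
  have hcdr : ContDiff ℝ 1 fun τ => H (w, τ) := hHd.comp (by fun_prop)
  have hIic := hcsr.integral_Iic_deriv_eq hcdr 0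
  rw [← integral_Iic_eq_integral_Iio]
  calc _ = ∫ τ in Iic 0, deriv (fun τ => H (w, τ)) τ := by
        refine integral_congr_ae (Eventually.of_forall fun τ => ?_)
        simp [(hd τ).deriv]
    _ = _ := hIic

end Graph

end

noncomputable section

open scoped ENNReal NNReal RealInnerProductSpace
open Module Filter

theorem IsGraphFunction.exists_eq_graphFun {m : ℕ} {φ : Space (m + 1) → ℝ}
    (h : IsGraphFunction φ) :
    ∃ (k : Fin (m + 1)) (s : ℝ) (g : Space m → ℝ), s * s = 1 ∧ ContDiff ℝ 1 g ∧
      φ = graphFun k s g := by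
  obtain ⟨k, s, g, hs, hg, hindep, hφ⟩ := h
  refine ⟨k, s, fun w => g (insCoord k (w, 0)), by rcases hs with rfl | rfl <;> norm_num,
    by fun_prop, ?_⟩
  ext y
  rw [hφ, graphFun]
  congr 1
  refine hindep _ _ fun j hj => ?_
  obtain ⟨i, rfl⟩ := Fin.exists_succAbove_eq hj
  rw [insCoord_succAbove]
  rfl

section GraphFunction

variable {d : ℕ} {φ : Space d → ℝ}

theorem IsGraphFunction.exists_dim (h : IsGraphFunction φ) : ∃ m, d = m + 1 := by
  obtain ⟨k, -⟩ := h
  exact ⟨d - 1, by have := k.pos; omega⟩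

theorem IsGraphFunction.contDiff (h : IsGraphFunction φ) : ContDiff ℝ 1 φ := by
  obtain ⟨m, rfl⟩ := h.exists_dim
  obtain ⟨k, s, g, hs, hg, rfl⟩ := h.exists_eq_graphFun
  exact contDiff_graphFun hg

theorem IsGraphFunction.gradient_ne_zero (h : IsGraphFunction φ) (y : Space d) :
    gradient φ y ≠ 0 := by
  obtain ⟨m, rfl⟩ := h.exists_dim
  obtain ⟨k, s, g, hs, hg, rfl⟩ := h.exists_eq_graphFun
  intro h0
  have := norm_gradient_graphFun_sq (k := k) hs hg y
  rw [h0, norm_zero] at this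
  nlinarith [sq_nonneg ‖gradient g ((insCoord k).symm y).1‖]

theorem IsGraphFunction.continuous_gradient (h : IsGraphFunction φ) :
    Continuous (gradient φ) := by
  have := h.contDiff.continuous_fderiv (by norm_num)
  unfold gradient
  fun_prop

theorem IsGraphFunction.mem_closure (h : IsGraphFunction φ) {y : Space d} (hy : φ y = 0) :
    y ∈ closure {z | φ z < 0} := by
  obtain ⟨m, rfl⟩ := h.exists_dim
  obtain ⟨k, s, g, hs, hg, rfl⟩ := h.exists_eq_graphFun
  have hy' : y ∈ range (graphParam k s g) := by rw [range_graphParam hs hg]; exact hy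
  obtain ⟨w, rfl⟩ := hy'
  have ht : Tendsto (fun τ : ℝ => shear k s g (w, τ)) (𝓝[<] 0) (𝓝 (graphParam k s g w)) := by
    have hc : Continuous fun τ : ℝ => shear k s g (w, τ) :=
      (contDiff_shear hg).continuous.comp (by fun_prop)
    exact (hc.tendsto 0).mono_left nhdsWithin_le_nhds
  refine mem_closure_of_tendsto ht ?_
  filter_upwards [self_mem_nhdsWithin] with τ hτ
  rw [graphFun_shear hs]
  exact hτ

theorem IsGraphFunction.surf_inter_lt_top (h : IsGraphFunction φ) {K : Set (Space d)}
    (hK : IsCompact K) : surf d (K ∩ {y | φ y = 0}) < ⊤ := by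
  obtain ⟨m, rfl⟩ := h.exists_dim
  obtain ⟨k, s, g, hs, hg, rfl⟩ := h.exists_eq_graphFun
  have hcl := isClosedEmbedding_graphParam (k := k) hs hg
  rw [← range_graphParam hs hg, ← image_preimage_eq_inter_range]
  show μHE[m] _ < ⊤
  rw [← hcl.measurableEmbedding.comap_apply, comap_graphParam hs hg]
  have hK' : IsCompact (graphParam k s g ⁻¹' K) := hcl.isCompact_preimage hK
  rw [withDensity_apply _ hK'.measurableSet]
  have hc : Continuous fun w => ‖gradient (graphFun k s g) (graphParam k s g w)‖ :=
    (h.continuous_gradient.comp (contDiff_graphParam hg).continuous).norm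
  exact (hc.continuousOn.integrableOn_compact hK').lintegral_lt_top

theorem IsGraphFunction.surf_inter_pos (h : IsGraphFunction φ) {U : Set (Space d)}
    (hU : IsOpen U) {y : Space d} (hyU : y ∈ U) (hy : φ y = 0) :
    0 < surf d (U ∩ {y | φ y = 0}) := by
  obtain ⟨m, rfl⟩ := h.exists_dim
  obtain ⟨k, s, g, hs, hg, rfl⟩ := h.exists_eq_graphFun
  have hcl := isClosedEmbedding_graphParam (k := k) hs hg
  have hy' : y ∈ range (graphParam k s g) := by rw [range_graphParam hs hg]; exact hy
  obtain ⟨w, rfl⟩ := hy'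
  rw [← range_graphParam hs hg, ← image_preimage_eq_inter_range]
  show 0 < μHE[m] _
  rw [← hcl.measurableEmbedding.comap_apply, comap_graphParam hs hg]
  have hc : Continuous fun w => ‖gradient (graphFun k s g) (graphParam k s g w)‖ :=
    (h.continuous_gradient.comp (contDiff_graphParam hg).continuous).norm
  have hopen : IsOpen (graphParam k s g ⁻¹' U) := hU.preimage hcl.continuous
  rw [pos_iff_ne_zero, Ne, withDensity_apply_eq_zero hc.measurable.ennreal_ofReal]
  have hall : {w | ENNReal.ofReal ‖gradient (graphFun k s g) (graphParam k s g w)‖ ≠ 0}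
      = univ := by
    ext w
    simpa using h.gradient_ne_zero _
  rw [hall, univ_inter]
  exact (hopen.measure_pos volume ⟨w, hyU⟩).ne'

/-- The divergence theorem for the region on one side of a graph. -/
theorem IsGraphFunction.integral_fderiv (h : IsGraphFunction φ) {f : Space d → ℝ}
    (hf : ContDiff ℝ 1 f) (hc : HasCompactSupport f) (e : Space d) :
    ∫ y in {y | φ y < 0}, fderiv ℝ f y e
      = ∫ y in {y | φ y = 0}, f y * ⟪‖gradient φ y‖⁻¹ • gradient φ y, e⟫ ∂surf d := by
  have hne := h.gradient_ne_zero
  obtain ⟨m, rfl⟩ := h.exists_dim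
  obtain ⟨k, s, g, hs, hg, rfl⟩ := h.exists_eq_graphFun
  rw [integral_fderiv_subgraph hs hg hf hc]
  refine Eq.trans ?_ (integral_graph hs hg _).symm
  refine integral_congr_ae (Eventually.of_forall fun w => ?_)
  have h1 : ‖gradient (graphFun k s g) (graphParam k s g w)‖ ≠ 0 := norm_ne_zero_iff.2 (hne _)
  simp only [real_inner_smul_left]
  rw [show ⟪gradient (graphFun k s g) (graphParam k s g w), e⟫
    = fderiv ℝ (graphFun k s g) (graphParam k s g w) e from
    InnerProductSpace.toDual_symm_apply]
  field_simp

end GraphFunction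

/-! ### The divergence theorem on bounded `C¹` domains -/

section Domain

variable {d : ℕ} {Ω : Set (Space d)} {ν : Space d → Space d}

/-- In a boundary chart the boundary is the zero set of the defining function. -/
theorem IsC1Domain.exists_chart (hΩ : IsC1Domain Ω ν) {x : Space d} (hx : x ∈ frontier Ω) :
    ∃ (φ : Space d → ℝ) (r : ℝ), 0 < r ∧ IsGraphFunction φ ∧
      (∀ y ∈ Metric.ball x r, y ∈ Ω ↔ φ y < 0) ∧
      (∀ y ∈ Metric.ball x r, y ∈ frontier Ω ↔ φ y = 0) ∧
      ∀ y ∈ Metric.ball x r ∩ frontier Ω, ν y = ‖gradient φ y‖⁻¹ • gradient φ y := by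
  obtain ⟨φ, r, hr, hφ, hΩφ, hν⟩ := hΩ.chart x hx
  refine ⟨φ, r, hr, hφ, hΩφ, fun y hy => ?_, hν⟩
  rw [hΩ.isOpen.frontier_eq, Set.mem_sdiff, hΩφ y hy]
  have hball : closure Ω ∩ Metric.ball x r ⊆ {z | φ z ≤ 0} := by
    have h1 : Metric.ball x r ∩ closure Ω ⊆ closure (Metric.ball x r ∩ Ω) :=
      Metric.isOpen_ball.inter_closure
    have h2 : closure (Metric.ball x r ∩ Ω) ⊆ {z | φ z ≤ 0} :=
      closure_minimal (fun z hz => ((hΩφ z hz.1).1 hz.2).le)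
        (isClosed_le hφ.contDiff.continuous continuous_const)
    rw [inter_comm]
    exact h1.trans h2
  constructor
  · rintro ⟨h1, h2⟩
    exact le_antisymm (hball ⟨h1, hy⟩) (not_lt.1 h2)
  · intro h0
    refine ⟨?_, by simp [h0]⟩
    have h1 := Metric.isOpen_ball.inter_closure (t := {z | φ z < 0}) ⟨hy, hφ.mem_closure h0⟩
    exact closure_mono (fun z hz => (hΩφ z hz.1).2 hz.2) h1

theorem IsC1Domain.isCompact_closure (hΩ : IsC1Domain Ω ν) : IsCompact (closure Ω) :=
  hΩ.isBounded.isCompact_closure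

theorem IsC1Domain.isCompact_frontier (hΩ : IsC1Domain Ω ν) : IsCompact (frontier Ω) :=
  hΩ.isCompact_closure.of_isClosed_subset isClosed_frontier frontier_subset_closure

theorem IsC1Domain.norm_normal (hΩ : IsC1Domain Ω ν) {x : Space d} (hx : x ∈ frontier Ω) :
    ‖ν x‖ = 1 := by
  obtain ⟨φ, r, hr, hφ, -, hν⟩ := hΩ.chart x hx
  rw [hν x ⟨Metric.mem_ball_self hr, hx⟩, norm_smul, norm_inv, norm_norm,
    inv_mul_cancel₀ (norm_ne_zero_iff.2 (hφ.gradient_ne_zero x))]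

theorem IsC1Domain.continuousOn_normal (hΩ : IsC1Domain Ω ν) : ContinuousOn ν (frontier Ω) := by
  intro x hx
  obtain ⟨φ, r, hr, hφ, -, hν⟩ := hΩ.chart x hx
  have hc : Continuous fun y => ‖gradient φ y‖⁻¹ • gradient φ y :=
    (hφ.continuous_gradient.norm.inv₀ fun y => norm_ne_zero_iff.2 (hφ.gradient_ne_zero y)).smul
      hφ.continuous_gradient
  refine hc.continuousWithinAt.congr_of_eventuallyEq ?_ (hν x ⟨Metric.mem_ball_self hr, hx⟩)
  filter_upwards [self_mem_nhdsWithin, mem_nhdsWithin_of_mem_nhds (Metric.ball_mem_nhds x hr)]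
    with y hy1 hy2 using hν y ⟨hy2, hy1⟩

theorem IsC1Domain.surf_frontier_lt_top (hΩ : IsC1Domain Ω ν) : surf d (frontier Ω) < ⊤ := by
  refine hΩ.isCompact_frontier.measure_lt_top_of_nhdsWithin fun x hx => ?_
  obtain ⟨φ, r, hr, hφ, -, hfr, -⟩ := hΩ.exists_chart hx
  refine ⟨Metric.closedBall x (r / 2) ∩ frontier Ω, ?_, ?_⟩
  · rw [inter_comm]
    exact inter_mem self_mem_nhdsWithin
      (mem_nhdsWithin_of_mem_nhds (Metric.closedBall_mem_nhds x (by linarith)))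
  · refine (measure_mono fun y hy => ?_).trans_lt
      (hφ.surf_inter_lt_top (isCompact_closedBall x (r / 2)))
    exact ⟨hy.1, (hfr y (Metric.closedBall_subset_ball (by linarith) hy.1)).1 hy.2⟩

theorem IsC1Domain.isFiniteMeasure_surf (hΩ : IsC1Domain Ω ν) {Γ : Set (Space d)}
    (hΓ : Γ ⊆ frontier Ω) : IsFiniteMeasure ((surf d).restrict Γ) :=
  ⟨by rw [Measure.restrict_apply_univ]
      exact (measure_mono hΓ).trans_lt hΩ.surf_frontier_lt_top⟩

/-- Every boundary point lies in the support of the surface measure. -/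
theorem IsC1Domain.surf_inter_frontier_pos (hΩ : IsC1Domain Ω ν) {U : Set (Space d)}
    (hU : IsOpen U) {x : Space d} (hxU : x ∈ U) (hx : x ∈ frontier Ω) :
    0 < surf d (U ∩ frontier Ω) := by
  obtain ⟨φ, r, hr, hφ, -, hfr, -⟩ := hΩ.exists_chart hx
  refine (hφ.surf_inter_pos (hU.inter Metric.isOpen_ball) ⟨hxU, Metric.mem_ball_self hr⟩
    ((hfr x (Metric.mem_ball_self hr)).1 hx)).trans_le (measure_mono fun y hy => ?_)
  exact ⟨hy.1.1, (hfr y hy.1.2).2 hy.2⟩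

/-- The divergence theorem holds for functions supported near a given point. -/
theorem IsC1Domain.exists_local_integral_fderiv (hΩ : IsC1Domain Ω ν) {x : Space d}
    (hx : x ∈ closure Ω) :
    ∃ r : ℝ, 0 < r ∧ ∀ f : Space d → ℝ, ContDiff ℝ 1 f → tsupport f ⊆ Metric.ball x r →
      ∀ e, ∫ y in Ω, fderiv ℝ f y e = ∫ y in frontier Ω, f y * ⟪ν y, e⟫ ∂surf d := by
  have hcs : ∀ {r : ℝ} {f : Space d → ℝ}, tsupport f ⊆ Metric.ball x r → HasCompactSupport f :=
    fun {r f} h => (isCompact_closedBall x r).of_isClosed_subset (isClosed_tsupport f)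
      (h.trans Metric.ball_subset_closedBall)
  have hz : ∀ {f : Space d → ℝ} {y : Space d}, y ∉ tsupport f → f y = 0 ∧ fderiv ℝ f y = 0 :=
    fun {f y} h => ⟨image_eq_zero_of_notMem_tsupport h, by
      by_contra h0
      exact h (support_fderiv_subset ℝ h0)⟩
  by_cases hxΩ : x ∈ Ω
  · obtain ⟨r, hr, hball⟩ := Metric.isOpen_iff.1 hΩ.isOpen x hxΩ
    refine ⟨r, hr, fun f hf hsupp e => ?_⟩
    have h1 : ∫ y in Ω, fderiv ℝ f y e = ∫ y, fderiv ℝ f y e := by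
      refine setIntegral_eq_integral_of_forall_compl_eq_zero fun y hy => ?_
      rw [(hz fun h => hy (hball (hsupp h))).2]
      rfl
    rw [h1, integral_fderiv_apply_eq_zero hf (hcs hsupp) e, eq_comm]
    refine setIntegral_eq_zero_of_forall_eq_zero fun y hy => ?_
    rw [hΩ.isOpen.frontier_eq] at hy
    rw [(hz (f := f) (y := y) fun h => hy.2 (hball (hsupp h))).1, zero_mul]
  · have hxf : x ∈ frontier Ω := by
      rw [hΩ.isOpen.frontier_eq]
      exact ⟨hx, hxΩ⟩
    obtain ⟨φ, r, hr, hφ, hΩφ, hfr, hν⟩ := hΩ.exists_chart hxf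
    refine ⟨r, hr, fun f hf hsupp e => ?_⟩
    have hφc := hφ.contDiff.continuous
    have hm1 : MeasurableSet {y | φ y < 0} := (isOpen_lt hφc continuous_const).measurableSet
    have hm2 : MeasurableSet {y | φ y = 0} := (isClosed_eq hφc continuous_const).measurableSet
    have h1 : ∫ y in Ω, fderiv ℝ f y e = ∫ y in {y | φ y < 0}, fderiv ℝ f y e := by
      rw [← integral_indicator hΩ.isOpen.measurableSet, ← integral_indicator hm1]
      congr 1
      ext y
      by_cases hy : y ∈ tsupport f
      · have : y ∈ Ω ↔ y ∈ {y | φ y < 0} := hΩφ y (hsupp hy)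
        by_cases hyΩ : y ∈ Ω
        · rw [indicator_of_mem hyΩ, indicator_of_mem (this.1 hyΩ)]
        · rw [indicator_of_notMem hyΩ, indicator_of_notMem fun h => hyΩ (this.2 h)]
      · simp [indicator, (hz hy).2]
    rw [h1, hφ.integral_fderiv hf (hcs hsupp) e,
      ← integral_indicator isClosed_frontier.measurableSet, ← integral_indicator hm2]
    congr 1
    ext y
    by_cases hy : y ∈ tsupport f
    · have : y ∈ frontier Ω ↔ y ∈ {y | φ y = 0} := hfr y (hsupp hy)
      by_cases hyΩ : y ∈ frontier Ω
      · rw [indicator_of_mem hyΩ, indicator_of_mem (this.1 hyΩ), hν y ⟨hsupp hy, hyΩ⟩]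
      · rw [indicator_of_notMem hyΩ, indicator_of_notMem fun h => hyΩ (this.2 h)]
    · simp [indicator, (hz hy).1]

theorem IsC1Domain.integrableOn_frontier (hΩ : IsC1Domain Ω ν) {F : Space d → ℝ}
    (hF : ContinuousOn F (frontier Ω)) : IntegrableOn F (frontier Ω) (surf d) := by
  have := hΩ.isFiniteMeasure_surf (Subset.refl (frontier Ω))
  obtain ⟨C, hC⟩ := hΩ.isCompact_frontier.exists_bound_of_continuousOn hF
  refine Integrable.of_bound (hF.aestronglyMeasurable isClosed_frontier.measurableSet) C ?_
  filter_upwards [ae_restrict_mem isClosed_frontier.measurableSet] with y hy using hC y hy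

open scoped Manifold in
/-- The divergence theorem on a bounded domain with `C¹` boundary. -/
theorem IsC1Domain.integral_fderiv (hΩ : IsC1Domain Ω ν) {f : Space d → ℝ}
    (hf : ContDiff ℝ 1 f) (e : Space d) :
    ∫ y in Ω, fderiv ℝ f y e = ∫ y in frontier Ω, f y * ⟪ν y, e⟫ ∂surf d := by
  choose! r hr hloc using fun x hx => hΩ.exists_local_integral_fderiv (x := x) hx
  obtain ⟨t, ht, hcov⟩ := hΩ.isCompact_closure.elim_nhds_subcover (fun x => Metric.ball x (r x))
    fun x hx => Metric.ball_mem_nhds x (hr x hx)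
  obtain ⟨ρ, hρ⟩ := SmoothPartitionOfUnity.exists_isSubordinate 𝓘(ℝ, Space d)
    (isClosed_closure (s := Ω)) (fun x : t => Metric.ball (x : Space d) (r x))
    (fun _ => Metric.isOpen_ball) (by rwa [iUnion_subtype])
  have hρd : ∀ i, ContDiff ℝ 1 (ρ i) := fun i =>
    ((ρ i).contMDiff.contDiff).of_le (by exact_mod_cast le_top)
  have hfd : ∀ i, ContDiff ℝ 1 fun y => ρ i y * f y := fun i => (hρd i).mul hf
  have hsum : ∀ y ∈ closure Ω, ∑ i, ρ i y = 1 := fun y hy => by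
    rw [← finsum_eq_sum_of_fintype]
    exact ρ.sum_eq_one hy
  have heach : ∀ i, ∫ y in Ω, fderiv ℝ (fun y => ρ i y * f y) y e
      = ∫ y in frontier Ω, ρ i y * f y * ⟪ν y, e⟫ ∂surf d := fun i =>
    hloc i (ht i i.2) _ (hfd i) ((tsupport_mul_subset_left).trans (hρ i)) e
  have hL : ∫ y in Ω, fderiv ℝ f y e
      = ∑ i, ∫ y in Ω, fderiv ℝ (fun y => ρ i y * f y) y e := by
    rw [← integral_finsetSum]
    · refine setIntegral_congr_fun hΩ.isOpen.measurableSet fun y hy => ?_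
      have heq : f =ᶠ[𝓝 y] fun y => ∑ i, ρ i y * f y := by
        filter_upwards [hΩ.isOpen.mem_nhds hy] with z hz
        rw [← Finset.sum_mul, hsum z (subset_closure hz), one_mul]
      rw [heq.fderiv_eq, fderiv_fun_sum fun i _ => (hfd i).differentiable (by norm_num) y,
        sum_apply]
    · intro i _
      have := (hfd i).continuous_fderiv (by norm_num)
      exact ((by fun_prop : Continuous fun y => fderiv ℝ (fun y => ρ i y * f y) y e).continuousOn
        |>.integrableOn_compact hΩ.isCompact_closure).mono_set subset_closure
  have hR : ∫ y in frontier Ω, f y * ⟪ν y, e⟫ ∂surf d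
      = ∑ i, ∫ y in frontier Ω, ρ i y * f y * ⟪ν y, e⟫ ∂surf d := by
    rw [← integral_finsetSum]
    · refine setIntegral_congr_fun isClosed_frontier.measurableSet fun y hy => ?_
      rw [← Finset.sum_mul, ← Finset.sum_mul, hsum y (frontier_subset_closure hy), one_mul]
    · intro i _
      refine hΩ.integrableOn_frontier ?_
      exact (hfd i).continuous.continuousOn.mul
        (hΩ.continuousOn_normal.inner continuousOn_const)
  rw [hL, hR]
  exact Finset.sum_congr rfl fun i _ => heach i

end Domain

end

noncomputable section

/-! ### The Legendre transform -/

section Legendre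

variable {n d : ℕ}

theorem dotU_comm (P U : State n d) : dotU P U = dotU U P := by
  simp only [dotU, mul_comm]

theorem dotL_comm (L F : Flux n d) : dotL L F = dotL F L := by
  simp only [dotL, mul_comm]

@[simp] theorem dotUCLM_apply (P U : State n d) : dotUCLM P U = dotU P U := rfl

@[simp] theorem dotLCLM_apply (L F : Flux n d) : dotLCLM L F = dotL L F := rfl

/-- The pairing `P · U` as a continuous bilinear map. -/
def dotUBilin (n d : ℕ) : State n d →L[ℝ] State n d →L[ℝ] ℝ :=
  LinearMap.toContinuousLinearMap
    { toFun := dotUCLM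
      map_add' := fun P Q => by
        refine ContinuousLinearMap.ext fun U => ?_
        rw [add_apply]
        simp only [dotUCLM_apply]
        rw [dotU_comm, dotU_comm P, dotU_comm Q, ← dotUCLM_apply, map_add]
        rfl
      map_smul' := fun c P => by
        refine ContinuousLinearMap.ext fun U => ?_
        rw [RingHom.id_apply, smul_apply]
        simp only [dotUCLM_apply]
        rw [dotU_comm, dotU_comm P, ← dotUCLM_apply, map_smul]
        rfl }

@[simp] theorem dotUBilin_apply (P U : State n d) : dotUBilin n d P U = dotU P U := rfl

/-- The pairing `L · F` as a continuous bilinear map. -/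
def dotLBilin (n d : ℕ) : Flux n d →L[ℝ] Flux n d →L[ℝ] ℝ :=
  LinearMap.toContinuousLinearMap
    { toFun := dotLCLM
      map_add' := fun P Q => by
        refine ContinuousLinearMap.ext fun U => ?_
        rw [add_apply]
        simp only [dotLCLM_apply]
        rw [dotL_comm, dotL_comm P, dotL_comm Q, ← dotLCLM_apply, map_add]
        rfl
      map_smul' := fun c P => by
        refine ContinuousLinearMap.ext fun U => ?_
        rw [RingHom.id_apply, smul_apply]
        simp only [dotLCLM_apply]
        rw [dotL_comm, dotL_comm P, ← dotLCLM_apply, map_smul]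
        rfl }

@[simp] theorem dotLBilin_apply (L F : Flux n d) : dotLBilin n d L F = dotL L F := rfl

theorem PrimalSystem.contDiff_F {sys : PrimalSystem n d} (hf : ContDiff ℝ ∞ sys.f)
    (ha : ContDiff ℝ ∞ sys.a) : ContDiff ℝ ∞ sys.F :=
  hf.prodMk ha

/-- The envelope property of the Legendre transform: at a critical point of
`U ↦ U · P - M(U, L, x, t)` the derivative of `U_H` drops out. -/
theorem hasFDerivAt_Mstar {sys : PrimalSystem n d} (hf : ContDiff ℝ ∞ sys.f)
    (ha : ContDiff ℝ ∞ sys.a) {H : State n d → Space d → ℝ → ℝ}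
    {UH : State n d × Flux n d × Space d × ℝ → State n d} {P : State n d} {L : Flux n d}
    {x : Space d} {t : ℝ} (hUH : DifferentiableAt ℝ UH (P, L, x, t))
    (hcrit : HasFDerivAt (fun U => sys.M H U L x t) (dotUCLM P) (UH (P, L, x, t))) :
    HasFDerivAt (fun q : State n d × Flux n d => sys.Mstar H UH q.1 q.2 x t)
      ((dotUCLM (UH (P, L, x, t))).comp (ContinuousLinearMap.fst ℝ _ _)
        + (dotLCLM (sys.F (UH (P, L, x, t)))).comp (ContinuousLinearMap.snd ℝ _ _)) (P, L) := by
  set U := UH (P, L, x, t) with hU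
  set V : State n d × Flux n d → State n d := fun q => UH (q.1, q.2, x, t) with hV
  have hVd : DifferentiableAt ℝ V (P, L) := by
    have h1 : DifferentiableAt ℝ (fun q : State n d × Flux n d => (q.1, q.2, x, t)) (P, L) := by
      fun_prop
    exact DifferentiableAt.comp (g := UH) (P, L) hUH h1
  have hV' := hVd.hasFDerivAt
  have hF : HasFDerivAt sys.F (fderiv ℝ sys.F U) U :=
    ((PrimalSystem.contDiff_F hf ha).differentiable (by simp) U).hasFDerivAt
  have hLF : HasFDerivAt (fun W => dotL L (sys.F W)) ((dotLCLM L).comp (fderiv ℝ sys.F U)) U :=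
    (dotLCLM L).hasFDerivAt.comp U hF
  have hH : HasFDerivAt (fun W => H W x t) (dotUCLM P + (dotLCLM L).comp (fderiv ℝ sys.F U)) U := by
    have := hcrit.add hLF
    refine this.congr_of_eventuallyEq (Filter.Eventually.of_forall fun W => ?_)
    simp [PrimalSystem.M]
  have hHV := HasFDerivAt.comp (g := fun W => H W x t) (f := V) (P, L) hH hV'
  have hFV := HasFDerivAt.comp (g := sys.F) (f := V) (P, L) hF hV'
  have h1 := (dotUBilin n d).hasFDerivAt_of_bilinear hV' (hasFDerivAt_fst (𝕜 := ℝ) (p := (P, L)))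
  have h2 := (dotLBilin n d).hasFDerivAt_of_bilinear (hasFDerivAt_snd (𝕜 := ℝ) (p := (P, L))) hFV
  have h3 := (h1.sub hHV).add h2
  refine (h3.congr_of_eventuallyEq (Filter.Eventually.of_forall fun q => ?_)).congr_fderiv ?_
  · simp [PrimalSystem.Mstar, PrimalSystem.M, hV]
    ring
  · refine ContinuousLinearMap.ext fun q => ?_
    simp [hV, ← hU]
    rw [dotU_comm _ P, dotL_comm q.2]
    ring

end Legendre

end

noncomputable section

/-! ### Calculus in space-time -/

section SpaceTime

open Filter

variable {n d : ℕ}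

section Scalar

variable {f g : Space d → ℝ → ℝ} {x : Space d} {t : ℝ}

theorem hasDerivAt_time (h : DifferentiableAt ℝ (Function.uncurry f) (x, t)) :
    HasDerivAt (fun s => f x s) (fderiv ℝ (Function.uncurry f) (x, t) (0, 1)) t := by
  have := HasFDerivAt.comp_hasDerivAt (l := Function.uncurry f) t h.hasFDerivAt
    ((hasDerivAt_const t x).prodMk (hasDerivAt_id t))
  exact this

theorem hasFDerivAt_space (h : DifferentiableAt ℝ (Function.uncurry f) (x, t)) :
    HasFDerivAt (fun y => f y t) ((fderiv ℝ (Function.uncurry f) (x, t)).comp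
      (ContinuousLinearMap.inl ℝ (Space d) ℝ)) x :=
  HasFDerivAt.comp (g := Function.uncurry f) (f := fun y => (y, t)) x h.hasFDerivAt
    (hasFDerivAt_prodMk_left x t)

theorem dt_eq_fderiv (h : DifferentiableAt ℝ (Function.uncurry f) (x, t)) :
    dt f x t = fderiv ℝ (Function.uncurry f) (x, t) (0, 1) :=
  (hasDerivAt_time h).deriv

theorem dx_eq_fderiv (h : DifferentiableAt ℝ (Function.uncurry f) (x, t)) (k : Fin d) :
    dx k f x t = fderiv ℝ (Function.uncurry f) (x, t) (EuclideanSpace.single k 1, 0) := by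
  rw [dx, (hasFDerivAt_space h).fderiv]
  rfl

theorem dt_add_mul (hf : DifferentiableAt ℝ (Function.uncurry f) (x, t))
    (hg : DifferentiableAt ℝ (Function.uncurry g) (x, t)) (ε : ℝ) :
    dt (fun y s => f y s + ε * g y s) x t = dt f x t + ε * dt g x t := by
  rw [dt_eq_fderiv hf, dt_eq_fderiv hg]
  exact ((hasDerivAt_time hf).add ((hasDerivAt_time hg).const_mul ε)).deriv

theorem dx_add_mul (hf : DifferentiableAt ℝ (Function.uncurry f) (x, t))
    (hg : DifferentiableAt ℝ (Function.uncurry g) (x, t)) (ε : ℝ) (k : Fin d) :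
    dx k (fun y s => f y s + ε * g y s) x t = dx k f x t + ε * dx k g x t := by
  have h := (hasFDerivAt_space hf).add ((hasFDerivAt_space hg).const_mul ε)
  rw [dx_eq_fderiv hf, dx_eq_fderiv hg, dx]
  have h' : HasFDerivAt (fun y => f y t + ε * g y t) _ x := h
  rw [h'.fderiv]
  simp

theorem dt_mul (hf : DifferentiableAt ℝ (Function.uncurry f) (x, t))
    (hg : DifferentiableAt ℝ (Function.uncurry g) (x, t)) :
    dt (fun y s => f y s * g y s) x t = dt f x t * g x t + f x t * dt g x t := by
  rw [dt_eq_fderiv hf, dt_eq_fderiv hg]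
  exact ((hasDerivAt_time hf).mul (hasDerivAt_time hg)).deriv

theorem dx_mul (hf : DifferentiableAt ℝ (Function.uncurry f) (x, t))
    (hg : DifferentiableAt ℝ (Function.uncurry g) (x, t)) (k : Fin d) :
    dx k (fun y s => f y s * g y s) x t = dx k f x t * g x t + f x t * dx k g x t := by
  have h : HasFDerivAt (fun y => f y t * g y t) _ x :=
    (hasFDerivAt_space hf).mul (hasFDerivAt_space hg)
  rw [dx_eq_fderiv hf, dx_eq_fderiv hg, dx, h.fderiv]
  simp
  ring

theorem dt_sum {ι : Type*} (s : Finset ι) {F : ι → Space d → ℝ → ℝ}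
    (hF : ∀ i ∈ s, DifferentiableAt ℝ (Function.uncurry (F i)) (x, t)) :
    dt (fun y r => ∑ i ∈ s, F i y r) x t = ∑ i ∈ s, dt (F i) x t := by
  rw [Finset.sum_congr rfl fun i hi => dt_eq_fderiv (hF i hi)]
  exact (HasDerivAt.fun_sum fun i hi => hasDerivAt_time (hF i hi)).deriv

theorem dx_sum {ι : Type*} (s : Finset ι) {F : ι → Space d → ℝ → ℝ}
    (hF : ∀ i ∈ s, DifferentiableAt ℝ (Function.uncurry (F i)) (x, t)) (k : Fin d) :
    dx k (fun y r => ∑ i ∈ s, F i y r) x t = ∑ i ∈ s, dx k (F i) x t := by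
  rw [Finset.sum_congr rfl fun i hi => dx_eq_fderiv (hF i hi) k, dx,
    (HasFDerivAt.fun_sum fun i hi => hasFDerivAt_space (hF i hi)).fderiv]
  simp

theorem contDiff_dt {r : ℕ∞ω} (hf : ContDiff ℝ (r + 1) (Function.uncurry f)) :
    ContDiff ℝ r fun p : Space d × ℝ => dt f p.1 p.2 := by
  have h0 : r + 1 ≠ 0 := by simp
  have : (fun p : Space d × ℝ => dt f p.1 p.2) = fun p => fderiv ℝ (Function.uncurry f) p (0, 1) :=
    funext fun p => dt_eq_fderiv (hf.differentiable h0 _)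
  rw [this]
  exact (hf.fderiv_right le_rfl).clm_apply contDiff_const

theorem contDiff_dx {r : ℕ∞ω} (hf : ContDiff ℝ (r + 1) (Function.uncurry f)) (k : Fin d) :
    ContDiff ℝ r fun p : Space d × ℝ => dx k f p.1 p.2 := by
  have h0 : r + 1 ≠ 0 := by simp
  have : (fun p : Space d × ℝ => dx k f p.1 p.2)
      = fun p => fderiv ℝ (Function.uncurry f) p (EuclideanSpace.single k 1, 0) :=
    funext fun p => dx_eq_fderiv (hf.differentiable h0 _) k
  rw [this]
  exact (hf.fderiv_right le_rfl).clm_apply contDiff_const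

end Scalar

section Fields

variable {D E : Space d → ℝ → State n d}

theorem contDiff_fst_apply {r : ℕ∞ω} (hD : ContDiff ℝ r (Function.uncurry D)) (I : Fin n) :
    ContDiff ℝ r (Function.uncurry fun y s => (D y s).1 I) :=
  (contDiff_apply ℝ ℝ I).comp hD.fst

theorem contDiff_snd_apply {r : ℕ∞ω} (hD : ContDiff ℝ r (Function.uncurry D)) (I : Fin n)
    (i : Fin d) : ContDiff ℝ r (Function.uncurry fun y s => (D y s).2.1 I i) :=
  (contDiff_apply_apply ℝ ℝ I i).comp hD.snd.fst

theorem contDiff_trd_apply {r : ℕ∞ω} (hD : ContDiff ℝ r (Function.uncurry D)) (I : Fin n)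
    (i j : Fin d) : ContDiff ℝ r (Function.uncurry fun y s => (D y s).2.2 I i j) :=
  (contDiff_apply_apply ℝ ℝ i j).comp ((contDiff_apply ℝ (Fin d → Fin d → ℝ) I).comp hD.snd.snd)

theorem contDiff_P (sys : PrimalSystem n d) (hD : ContDiff ℝ 2 (Function.uncurry D)) :
    ContDiff ℝ 1 fun p : Space d × ℝ => sys.P D p.1 p.2 := by
  have hD1 : ContDiff ℝ 1 (Function.uncurry D) := hD.of_le (by norm_num)
  have hD' : ContDiff ℝ (1 + 1) (Function.uncurry D) := by
    rw [one_add_one_eq_two]; exact hD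
  have h1 := contDiff_fst_apply hD1
  have h2 := contDiff_snd_apply hD1
  have h3 := contDiff_trd_apply hD1
  have k1 := fun I => contDiff_dt (contDiff_fst_apply hD' I)
  have k2 := fun I k => contDiff_dx (contDiff_fst_apply hD' I) k
  have k3 := fun I i k => contDiff_dx (contDiff_snd_apply hD' I i) k
  have k4 := fun I i j k => contDiff_dx (contDiff_trd_apply hD' I i j) k
  unfold Function.uncurry at h1 h2 h3
  refine ContDiff.prodMk (contDiff_pi.2 fun I => ?_) (ContDiff.prodMk
    (contDiff_pi.2 fun I => contDiff_pi.2 fun i => ?_)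
    (contDiff_pi.2 fun I => contDiff_pi.2 fun i => contDiff_pi.2 fun j => h3 I i j))
  · refine (((k1 I).add (ContDiff.sum fun i _ => k3 I i i)).add
      (ContDiff.sum fun J _ => contDiff_const.mul (h1 J))).sub
      (ContDiff.sum fun J _ => ContDiff.sum fun k _ => contDiff_const.mul (k2 J k))
  · exact ((h2 I i).add (ContDiff.sum fun j _ => k4 I i j j)).sub
      (ContDiff.sum fun J _ => ContDiff.sum fun l _ => contDiff_const.mul (k2 J l))

theorem contDiff_arrL (hD : ContDiff ℝ 2 (Function.uncurry D)) :
    ContDiff ℝ 1 fun p : Space d × ℝ => arrL D p.1 p.2 := by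
  have hD1 : ContDiff ℝ 1 (Function.uncurry D) := hD.of_le (by norm_num)
  have hD' : ContDiff ℝ (1 + 1) (Function.uncurry D) := by
    rw [one_add_one_eq_two]; exact hD
  exact ContDiff.prodMk (contDiff_pi.2 fun I => contDiff_fst_apply hD1 I)
    (contDiff_pi.2 fun I => contDiff_pi.2 fun k =>
      (contDiff_dx (contDiff_fst_apply hD' I) k).neg)

theorem P_add_smul (sys : PrimalSystem n d) (hD : ContDiff ℝ 2 (Function.uncurry D))
    (hE : ContDiff ℝ 2 (Function.uncurry E)) (ε : ℝ) (x : Space d) (t : ℝ) :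
    sys.P (fun x t => D x t + ε • E x t) x t = sys.P D x t + ε • sys.P E x t := by
  have h1 := fun I => (contDiff_fst_apply hD I).differentiable (by norm_num) (x, t)
  have h2 := fun I i => (contDiff_snd_apply hD I i).differentiable (by norm_num) (x, t)
  have h3 := fun I i j => (contDiff_trd_apply hD I i j).differentiable (by norm_num) (x, t)
  have k1 := fun I => (contDiff_fst_apply hE I).differentiable (by norm_num) (x, t)
  have k2 := fun I i => (contDiff_snd_apply hE I i).differentiable (by norm_num) (x, t)
  have k3 := fun I i j => (contDiff_trd_apply hE I i j).differentiable (by norm_num) (x, t)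
  refine Prod.ext ?_ (Prod.ext ?_ ?_)
  · ext I
    simp only [PrimalSystem.P, Prod.fst_add, Prod.snd_add, Prod.smul_fst, Prod.smul_snd,
      Pi.add_apply, Pi.smul_apply, smul_eq_mul, dt_add_mul (h1 _) (k1 _),
      dx_add_mul (h1 _) (k1 _), dx_add_mul (h2 _ _) (k2 _ _), mul_add, Finset.sum_add_distrib,
      Finset.mul_sum, mul_sub, mul_left_comm ε]
    ring
  · ext I i
    simp only [PrimalSystem.P, Prod.fst_add, Prod.snd_add, Prod.smul_fst, Prod.smul_snd,
      Pi.add_apply, Pi.smul_apply, smul_eq_mul,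
      dx_add_mul (h1 _) (k1 _), dx_add_mul (h3 _ _ _) (k3 _ _ _), mul_add, Finset.sum_add_distrib,
      Finset.mul_sum, mul_sub, mul_left_comm ε]
    ring
  · rfl

theorem arrL_add_smul (hD : ContDiff ℝ 2 (Function.uncurry D))
    (hE : ContDiff ℝ 2 (Function.uncurry E)) (ε : ℝ) (x : Space d) (t : ℝ) :
    arrL (fun x t => D x t + ε • E x t) x t = arrL D x t + ε • arrL E x t := by
  have h1 := fun I => (contDiff_fst_apply hD I).differentiable (by norm_num) (x, t)
  have k1 := fun I => (contDiff_fst_apply hE I).differentiable (by norm_num) (x, t)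
  refine Prod.ext rfl ?_
  ext I i
  simp only [arrL, Prod.fst_add, Prod.snd_add, Prod.smul_fst, Prod.smul_snd,
      Pi.add_apply, Pi.smul_apply, smul_eq_mul, dx_add_mul (h1 _) (k1 _)]
  ring

end Fields

open scoped Manifold in
/-- A function that is `C^r` near a compact set agrees near that set with a function that is `C^r`
everywhere. -/
theorem exists_contDiff_eventuallyEq {X Y : Type*} [NormedAddCommGroup X] [NormedSpace ℝ X]
    [FiniteDimensional ℝ X] [NormedAddCommGroup Y] [NormedSpace ℝ Y] {r : ℕ} {K : Set X}
    (hK : IsCompact K) {f : X → Y} (hf : ∀ p ∈ K, ContDiffAt ℝ r f p) :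
    ∃ F : X → Y, ContDiff ℝ r F ∧ ∀ p ∈ K, F =ᶠ[𝓝 p] f := by
  set O : Set X := {p | ContDiffAt ℝ r f p} with hO
  have hOo : IsOpen O := isOpen_iff_eventually.2 fun p hp => by
    have hp' : ContDiffAt ℝ r f p := hp
    exact hp'.eventually (by simp)
  obtain ⟨K', hK', hKK', hK'O⟩ := exists_compact_between hK hOo hf
  obtain ⟨χ, h1, h0, -⟩ := exists_contMDiffMap_one_nhds_of_subset_interior (n := r) 𝓘(ℝ, X)
    hK.isClosed hKK'
  have hχ : ContDiff ℝ r χ := χ.contMDiff.contDiff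
  refine ⟨fun p => χ p • f p, contDiff_iff_contDiffAt.2 fun p => ?_, fun p hp => ?_⟩
  · by_cases hp : p ∈ K'
    · exact hχ.contDiffAt.smul (hK'O hp)
    · have : (fun p => χ p • f p) =ᶠ[𝓝 p] fun _ => 0 := by
        filter_upwards [hK'.isClosed.isOpen_compl.mem_nhds hp] with q hq
        rw [h0 q hq, zero_smul]
      exact contDiffAt_const.congr_of_eventuallyEq this
  · filter_upwards [h1.filter_mono (nhds_le_nhdsSet hp)] with q hq
    rw [hq, one_smul]

end SpaceTime

end

noncomputable section

/-! ### Differentiation of the dual functional -/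

section Variation

open Filter

variable {n d : ℕ}

/-- Differentiation under the integral sign: the derivative of `∫ M*` along a line in the space of
arrays `(P, L)`. -/
theorem hasDerivAt_integral_Mstar {sys : PrimalSystem n d} (hf : ContDiff ℝ ∞ sys.f)
    (ha : ContDiff ℝ ∞ sys.a) {H : State n d → Space d → ℝ → ℝ}
    (hH : Continuous fun q : State n d × Space d × ℝ => H q.1 q.2.1 q.2.2)
    {O : Set (State n d × Flux n d × Space d × ℝ)} (hO : IsOpen O)
    {UH : State n d × Flux n d × Space d × ℝ → State n d} (hUH : ContDiffOn ℝ 1 UH O)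
    {K A : Set (Space d × ℝ)} (hK : IsCompact K) (hA : MeasurableSet A) (hAK : A ⊆ K)
    (hinv : ∀ P L, ∀ p ∈ K, (P, L, p) ∈ O →
      HasFDerivAt (fun U => sys.M H U L p.1 p.2) (dotUCLM P) (UH (P, L, p)))
    {P₀ P₁ : Space d × ℝ → State n d} {L₀ L₁ : Space d × ℝ → Flux n d}
    (hP₀ : Continuous P₀) (hP₁ : Continuous P₁) (hL₀ : Continuous L₀) (hL₁ : Continuous L₁)
    (hKO : ∀ p ∈ K, (P₀ p, L₀ p, p) ∈ O) :
    Integrable (fun p => dotU (UH (P₀ p, L₀ p, p)) (P₁ p)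
      + dotL (sys.F (UH (P₀ p, L₀ p, p))) (L₁ p)) (volume.restrict A) ∧
    HasDerivAt (fun ε : ℝ => ∫ p in A,
        sys.Mstar H UH (P₀ p + ε • P₁ p) (L₀ p + ε • L₁ p) p.1 p.2)
      (∫ p in A, (dotU (UH (P₀ p, L₀ p, p)) (P₁ p)
        + dotL (sys.F (UH (P₀ p, L₀ p, p))) (L₁ p))) 0 := by
  set Q : ℝ × (Space d × ℝ) → State n d × Flux n d × Space d × ℝ := fun q =>
    (P₀ q.2 + q.1 • P₁ q.2, L₀ q.2 + q.1 • L₁ q.2, q.2) with hQ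
  have hQc : Continuous Q := by fun_prop
  have hQ0 : ∀ p, Q (0, p) = (P₀ p, L₀ p, p) := fun p => by simp [hQ]
  -- The perturbed arrays stay in `O` for small `ε`, uniformly on the compact set `K`.
  obtain ⟨u, v, hu, -, h0u, hKv, huv⟩ := generalized_tube_lemma (isCompact_singleton (x := (0 : ℝ)))
    hK (hO.preimage hQc) (by
      rintro ⟨ε, p⟩ ⟨hε, hp⟩
      rw [mem_singleton_iff] at hε
      subst hε
      show Q (0, p) ∈ O
      rw [hQ0]
      exact hKO p hp)
  obtain ⟨η, hη, hball⟩ := Metric.nhds_basis_closedBall.mem_iff.1 (hu.mem_nhds (h0u rfl))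
  have hmem : ∀ ε ∈ Metric.closedBall (0 : ℝ) η, ∀ p ∈ K, Q (ε, p) ∈ O := fun ε hε p hp =>
    huv ⟨hball hε, hKv hp⟩
  have hFc : Continuous sys.F := (PrimalSystem.contDiff_F hf ha).continuous
  have hUc : ContinuousOn (fun q => UH (Q q)) (Metric.closedBall (0 : ℝ) η ×ˢ K) :=
    hUH.continuousOn.comp hQc.continuousOn fun q hq => hmem q.1 hq.1 q.2 hq.2
  have hdU : Continuous fun q : State n d × State n d => dotU q.1 q.2 :=
    (dotUBilin n d).continuous₂
  have hdL : Continuous fun q : Flux n d × Flux n d => dotL q.1 q.2 :=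
    (dotLBilin n d).continuous₂
  set F' : ℝ → Space d × ℝ → ℝ := fun ε p => dotU (UH (Q (ε, p))) (P₁ p)
    + dotL (sys.F (UH (Q (ε, p)))) (L₁ p) with hF'
  have hF'c : ContinuousOn (fun q : ℝ × (Space d × ℝ) => F' q.1 q.2)
      (Metric.closedBall (0 : ℝ) η ×ˢ K) :=
    (hdU.comp_continuousOn (f := fun q : ℝ × (Space d × ℝ) => (UH (Q q), P₁ q.2))
        (hUc.prodMk (by fun_prop))).add
      (hdL.comp_continuousOn (f := fun q : ℝ × (Space d × ℝ) => (sys.F (UH (Q q)), L₁ q.2))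
        ((hFc.comp_continuousOn hUc).prodMk (by fun_prop)))
  have hslice : ∀ ε ∈ Metric.closedBall (0 : ℝ) η, ContinuousOn (fun p => UH (Q (ε, p))) K :=
    fun ε hε => hUc.comp (f := fun p => (ε, p)) (by fun_prop) fun p hp => ⟨hε, hp⟩
  have hMc : ∀ ε ∈ Metric.closedBall (0 : ℝ) η, ContinuousOn (fun p =>
      sys.Mstar H UH (P₀ p + ε • P₁ p) (L₀ p + ε • L₁ p) p.1 p.2) K := by
    intro ε hε
    have hU := hslice ε hε
    have h1 : ContinuousOn (fun p => dotU (UH (Q (ε, p))) (P₀ p + ε • P₁ p)) K :=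
      hdU.comp_continuousOn (f := fun p => (UH (Q (ε, p)), P₀ p + ε • P₁ p))
        (hU.prodMk (by fun_prop))
    have h2 : ContinuousOn (fun p => H (UH (Q (ε, p))) p.1 p.2) K :=
      hH.comp_continuousOn (f := fun p => (UH (Q (ε, p)), p.1, p.2)) (hU.prodMk (by fun_prop))
    have h3 : ContinuousOn (fun p => dotL (L₀ p + ε • L₁ p) (sys.F (UH (Q (ε, p))))) K :=
      hdL.comp_continuousOn (f := fun p => (L₀ p + ε • L₁ p, sys.F (UH (Q (ε, p)))))
        (ContinuousOn.prodMk (by fun_prop) (hFc.comp_continuousOn hU))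
    exact h1.sub (h2.sub h3)
  have h0 : (0 : ℝ) ∈ Metric.closedBall (0 : ℝ) η := Metric.mem_closedBall_self hη.le
  have hF'0 : ContinuousOn (F' 0) K :=
    hF'c.comp (f := fun p => ((0 : ℝ), p)) (by fun_prop) fun p hp => ⟨h0, hp⟩
  obtain ⟨C, hC⟩ := ((isCompact_closedBall (0 : ℝ) η).prod hK).exists_bound_of_continuousOn hF'c
  have hAfin : volume A < ⊤ := (measure_mono hAK).trans_lt hK.measure_lt_top
  have hres := hasDerivAt_integral_of_dominated_loc_of_deriv_le (μ := volume.restrict A)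
    (F := fun ε p => sys.Mstar H UH (P₀ p + ε • P₁ p) (L₀ p + ε • L₁ p) p.1 p.2) (F' := F')
    (x₀ := (0 : ℝ)) (s := Metric.ball 0 η) (bound := fun _ => C) (Metric.ball_mem_nhds _ hη)
    (by
      filter_upwards [Metric.ball_mem_nhds _ hη] with ε hε
      exact ((hMc ε (Metric.ball_subset_closedBall hε)).mono hAK).aestronglyMeasurable hA)
    (((hMc 0 h0).integrableOn_compact hK).mono_set hAK)
    ((hF'0.mono hAK).aestronglyMeasurable hA)
    (by
      filter_upwards [ae_restrict_mem hA] with p hp ε hε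
      exact hC (ε, p) ⟨Metric.ball_subset_closedBall hε, hAK hp⟩)
    (by
      have : IsFiniteMeasure (volume.restrict A) := ⟨by rwa [Measure.restrict_apply_univ]⟩
      exact integrable_const C)
    (by
      filter_upwards [ae_restrict_mem hA] with p hp ε hε
      have hpO := hmem ε (Metric.ball_subset_closedBall hε) p (hAK hp)
      have h1 := hasFDerivAt_Mstar hf ha (x := p.1) (t := p.2)
        ((hUH.differentiableOn (by norm_num)).differentiableAt (hO.mem_nhds hpO))
        (hinv _ _ p (hAK hp) hpO)
      have hline : HasDerivAt (fun ε : ℝ => (P₀ p + ε • P₁ p, L₀ p + ε • L₁ p))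
          ((1 : ℝ) • P₁ p, (1 : ℝ) • L₁ p) ε :=
        (((hasDerivAt_id ε).smul_const (P₁ p)).const_add (P₀ p)).prodMk
          (((hasDerivAt_id ε).smul_const (L₁ p)).const_add (L₀ p))
      rw [one_smul, one_smul] at hline
      have h2 := HasFDerivAt.comp_hasDerivAt
        (l := fun q : State n d × Flux n d => sys.Mstar H UH q.1 q.2 p.1 p.2) ε h1 hline
      refine HasDerivAt.congr_deriv h2 ?_
      rw [add_apply, ContinuousLinearMap.comp_apply, ContinuousLinearMap.comp_apply,
        ContinuousLinearMap.coe_fst', ContinuousLinearMap.coe_snd', dotUCLM_apply, dotLCLM_apply])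
  simp only [hF', hQ0] at hres
  exact hres

end Variation

end

noncomputable section

/-! ### Green's identity for the dual pairing -/

section Green

open scoped RealInnerProductSpace
open Filter

section Algebra

open Finset

/-- The finite-sum identity behind `pairing_eq_residual`: `ut`, `ux`, `lt`, … stand for the
derivatives of `u`, `l`, …, and the last two summands on the right for the time derivative of
`∑ u l` and the divergence of the flux, expanded by the product rule. -/
theorem green_pairing_algebra {n d : ℕ} (cA : Fin n → Fin n → ℝ) (cB : Fin n → Fin n → Fin d → ℝ)
    (cC : Fin n → Fin n → Fin d → Fin d → ℝ) (u ut f l lt : Fin n → ℝ)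
    (ux B a ax lx g gx : Fin n → Fin d → ℝ) (Bx C r rx : Fin n → Fin d → Fin d → ℝ) :
    -(((∑ I, u I * (lt I + (∑ i, gx I i) + (∑ J, cA J I * l J)
          - ∑ J, ∑ k, cB J I k * lx J k))
        + (∑ I, ∑ i, B I i * (g I i + (∑ j, rx I i j) - ∑ J, ∑ k, cC J I i k * lx J k))
        + ∑ I, ∑ i, ∑ j, C I i j * r I i j)
      + ((∑ I, f I * l I) + ∑ I, ∑ k, a I k * -lx I k))
    = ((∑ I, (ut I - ((∑ J, cA I J * u J) + (∑ J, ∑ k, cB I J k * ux J k)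
            + (∑ J, ∑ i, ∑ k, cC I J i k * Bx J i k) + f I + ∑ k, ax I k)) * l I)
        + (∑ I, ∑ i, (ux I i - B I i) * g I i)
        + ∑ I, ∑ i, ∑ j, (Bx I i j - C I i j) * r I i j)
      - (∑ I, (ut I * l I + u I * lt I))
      + ∑ k, ((∑ I, (lx I k * (a I k + ((∑ J, cB I J k * u J) + ∑ J, ∑ i, cC I J i k * B J i))
            + l I * (ax I k + ((∑ J, cB I J k * ux J k) + ∑ J, ∑ i, cC I J i k * Bx J i k))))
          - (∑ I, (ux I k * g I k + u I * gx I k))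
          - ∑ I, ∑ i, (Bx I i k * r I i k + B I i * rx I i k)) := by
  simp only [mul_add, add_mul, mul_sub, sub_mul, mul_sum, sum_mul, sum_add_distrib,
    sum_sub_distrib, mul_neg, sum_neg_distrib]
  have c3 : ∀ {α β γ : Type} [Fintype α] [Fintype β] [Fintype γ] (F : α → β → γ → ℝ),
      ∑ x, ∑ y, ∑ z, F x y z = ∑ z, ∑ x, ∑ y, F x y z := fun F => by
    rw [sum_congr rfl fun x _ => sum_comm, sum_comm]
  have h1 : ∑ I, ∑ J, u I * (cA J I * l J) = ∑ I, ∑ J, cA I J * u J * l I := by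
    rw [sum_comm]
    exact sum_congr rfl fun _ _ => sum_congr rfl fun _ _ => by ring
  have h2 : ∑ I, ∑ J, ∑ k, u I * (cB J I k * lx J k)
      = ∑ k, ∑ J, ∑ I, lx J k * (cB J I k * u I) := by
    rw [c3]
    refine sum_congr rfl fun _ _ => ?_
    rw [sum_comm]
    exact sum_congr rfl fun _ _ => sum_congr rfl fun _ _ => by ring
  have h3 : ∑ I, ∑ i, ∑ J, ∑ k, B I i * (cC J I i k * lx J k)
      = ∑ k, ∑ J, ∑ I, ∑ i, lx J k * (cC J I i k * B I i) := by
    rw [sum_congr rfl fun I _ => c3 _, sum_comm]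
    refine sum_congr rfl fun _ _ => ?_
    rw [sum_congr rfl fun I _ => sum_comm, sum_comm]
    exact sum_congr rfl fun _ _ => sum_congr rfl fun _ _ => sum_congr rfl fun _ _ => by ring
  have h4 : ∑ I, ∑ J, ∑ k, cB I J k * ux J k * l I
      = ∑ k, ∑ I, ∑ J, l I * (cB I J k * ux J k) := by
    rw [c3]
    exact sum_congr rfl fun _ _ => sum_congr rfl fun _ _ => sum_congr rfl fun _ _ => by ring
  have h5 : ∑ I, ∑ J, ∑ i, ∑ k, cC I J i k * Bx J i k * l I
      = ∑ k, ∑ I, ∑ J, ∑ i, l I * (cC I J i k * Bx J i k) := by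
    rw [sum_congr rfl fun I _ => c3 _, sum_comm]
    exact sum_congr rfl fun _ _ => sum_congr rfl fun _ _ => sum_congr rfl fun _ _ =>
      sum_congr rfl fun _ _ => by ring
  have h6 : ∑ I, ∑ k, a I k * lx I k = ∑ k, ∑ I, lx I k * a I k := by
    rw [sum_comm]
    exact sum_congr rfl fun _ _ => sum_congr rfl fun _ _ => by ring
  have h7 : ∑ I, ∑ k, ax I k * l I = ∑ k, ∑ I, l I * ax I k := by
    rw [sum_comm]
    exact sum_congr rfl fun _ _ => sum_congr rfl fun _ _ => by ring
  have h8 : ∑ I, ∑ k, ux I k * g I k = ∑ k, ∑ I, ux I k * g I k := sum_comm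
  have h9 : ∑ I, ∑ k, u I * gx I k = ∑ k, ∑ I, u I * gx I k := sum_comm
  have h10 := c3 fun I i k => Bx I i k * r I i k
  have h11 := c3 fun I i k => B I i * rx I i k
  linarith

end Algebra

variable {n d : ℕ}

section Rules

variable {f g : Space d → ℝ → ℝ} {x : Space d} {t : ℝ}

theorem dx_add (hf : DifferentiableAt ℝ (Function.uncurry f) (x, t))
    (hg : DifferentiableAt ℝ (Function.uncurry g) (x, t)) (k : Fin d) :
    dx k (fun y s => f y s + g y s) x t = dx k f x t + dx k g x t := by
  simpa using dx_add_mul hf hg 1 k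

theorem dx_sub (hf : DifferentiableAt ℝ (Function.uncurry f) (x, t))
    (hg : DifferentiableAt ℝ (Function.uncurry g) (x, t)) (k : Fin d) :
    dx k (fun y s => f y s - g y s) x t = dx k f x t - dx k g x t := by
  simpa [sub_eq_add_neg] using dx_add_mul hf hg (-1) k

theorem dx_const_mul (hf : DifferentiableAt ℝ (Function.uncurry f) (x, t)) (c : ℝ) (k : Fin d) :
    dx k (fun y s => c * f y s) x t = c * dx k f x t := by
  have h : HasFDerivAt (fun y => c * f y t) _ x := (hasFDerivAt_space hf).const_mul c
  rw [dx_eq_fderiv hf, dx, h.fderiv]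
  simp

end Rules

/-- The amount by which the field `U` fails to satisfy the first-order system. -/
def residual (sys : PrimalSystem n d) (U : Space d → ℝ → State n d) (x : Space d) (t : ℝ) :
    State n d :=
  (fun I => dt (fun y s => (U y s).1 I) x t -
      ((∑ J, sys.cA I J * (U x t).1 J)
      + (∑ J, ∑ k, sys.cB I J k * dx k (fun y s => (U y s).1 J) x t)
      + (∑ J, ∑ k, ∑ l, sys.cC I J k l * dx l (fun y s => (U y s).2.1 J k) x t)
      + sys.f (U x t) I
      + ∑ k, dx k (fun y s => sys.a (U y s) I k) x t),
   fun I i => dx i (fun y s => (U y s).1 I) x t - (U x t).2.1 I i,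
   fun I i j => dx j (fun y s => (U y s).2.1 I i) x t - (U x t).2.2 I i j)

/-- The flux whose normal component is prescribed by the traction condition. -/
def tractionFlux (sys : PrimalSystem n d) (U : Space d → ℝ → State n d) (x : Space d) (t : ℝ)
    (I : Fin n) (k : Fin d) : ℝ :=
  sys.a (U x t) I k
    + ((∑ J, sys.cB I J k * (U x t).1 J) + ∑ J, ∑ i, sys.cC I J i k * (U x t).2.1 J i)

/-- The space part of the vector field whose divergence is left over when the derivatives in the
dual pairing are moved to the primal field. -/
def dualFlux (sys : PrimalSystem n d) (U E : Space d → ℝ → State n d) (k : Fin d) (x : Space d)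
    (t : ℝ) : ℝ :=
  (∑ I, (E x t).1 I * tractionFlux sys U x t I k) - (∑ I, (U x t).1 I * (E x t).2.1 I k)
    - ∑ I, ∑ i, (U x t).2.1 I i * (E x t).2.2 I i k

variable {sys : PrimalSystem n d} {U E : Space d → ℝ → State n d}

theorem contDiff_a_apply (ha : ContDiff ℝ ∞ sys.a) (hU : ContDiff ℝ 1 (Function.uncurry U))
    (I : Fin n) (k : Fin d) :
    ContDiff ℝ 1 (Function.uncurry fun y s => sys.a (U y s) I k) :=
  (contDiff_apply_apply ℝ ℝ I k).comp ((ha.of_le (by exact_mod_cast le_top)).comp hU)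

theorem contDiff_tractionFlux (ha : ContDiff ℝ ∞ sys.a) (hU : ContDiff ℝ 1 (Function.uncurry U))
    (I : Fin n) (k : Fin d) :
    ContDiff ℝ 1 (Function.uncurry fun y s => tractionFlux sys U y s I k) :=
  (contDiff_a_apply ha hU I k).add
    ((ContDiff.sum fun J _ => contDiff_const.mul (contDiff_fst_apply hU J)).add
      (ContDiff.sum fun J _ => ContDiff.sum fun i _ =>
        contDiff_const.mul (contDiff_snd_apply hU J i)))

theorem contDiff_dualFlux (ha : ContDiff ℝ ∞ sys.a) (hU : ContDiff ℝ 1 (Function.uncurry U))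
    (hE : ContDiff ℝ 1 (Function.uncurry E)) (k : Fin d) :
    ContDiff ℝ 1 (Function.uncurry (dualFlux sys U E k)) :=
  ((ContDiff.sum fun I _ => (contDiff_fst_apply hE I).mul (contDiff_tractionFlux ha hU I k)).sub
    (ContDiff.sum fun I _ => (contDiff_fst_apply hU I).mul (contDiff_snd_apply hE I k))).sub
    (ContDiff.sum fun I _ => ContDiff.sum fun i _ =>
      (contDiff_snd_apply hU I i).mul (contDiff_trd_apply hE I i k))

theorem dx_tractionFlux (ha : ContDiff ℝ ∞ sys.a) (hU : ContDiff ℝ 1 (Function.uncurry U))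
    (I : Fin n) (k l : Fin d) (x : Space d) (t : ℝ) :
    dx l (fun y s => tractionFlux sys U y s I k) x t
      = dx l (fun y s => sys.a (U y s) I k) x t
        + ((∑ J, sys.cB I J k * dx l (fun y s => (U y s).1 J) x t)
          + ∑ J, ∑ i, sys.cC I J i k * dx l (fun y s => (U y s).2.1 J i) x t) := by
  have h1 := fun J => (contDiff_fst_apply hU J).differentiable (by norm_num) (x, t)
  have h2 := fun J i => (contDiff_snd_apply hU J i).differentiable (by norm_num) (x, t)
  have h3 := (contDiff_a_apply ha hU I k).differentiable (by norm_num) (x, t)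
  have k1 : ∀ J, DifferentiableAt ℝ
      (Function.uncurry fun y s => sys.cB I J k * (U y s).1 J) (x, t) :=
    fun J => (h1 J).const_mul _
  have k2 : ∀ J i, DifferentiableAt ℝ
      (Function.uncurry fun y s => sys.cC I J i k * (U y s).2.1 J i) (x, t) :=
    fun J i => (h2 J i).const_mul _
  have k3 : ∀ J, DifferentiableAt ℝ
      (Function.uncurry fun y s => ∑ i, sys.cC I J i k * (U y s).2.1 J i) (x, t) :=
    fun J => DifferentiableAt.fun_sum fun i _ => k2 J i
  have k4 : DifferentiableAt ℝ
      (Function.uncurry fun y s => ∑ J, sys.cB I J k * (U y s).1 J) (x, t) :=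
    DifferentiableAt.fun_sum fun J _ => k1 J
  have k5 : DifferentiableAt ℝ
      (Function.uncurry fun y s => ∑ J, ∑ i, sys.cC I J i k * (U y s).2.1 J i) (x, t) :=
    DifferentiableAt.fun_sum fun J _ => k3 J
  have k6 : DifferentiableAt ℝ (Function.uncurry fun y s =>
      (∑ J, sys.cB I J k * (U y s).1 J) + ∑ J, ∑ i, sys.cC I J i k * (U y s).2.1 J i) (x, t) :=
    k4.add k5
  unfold tractionFlux
  rw [dx_add h3 k6, dx_add k4 k5, dx_sum _ fun J _ => k1 J, dx_sum _ fun J _ => k3 J]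
  simp only [fun J => dx_sum (Finset.univ (α := Fin d)) (fun i _ => k2 J i) l,
    fun J => dx_const_mul (h1 J), fun J i => dx_const_mul (h2 J i)]

theorem dx_dualFlux (ha : ContDiff ℝ ∞ sys.a) (hU : ContDiff ℝ 1 (Function.uncurry U))
    (hE : ContDiff ℝ 1 (Function.uncurry E)) (k : Fin d) (x : Space d) (t : ℝ) :
    dx k (dualFlux sys U E k) x t
      = (∑ I, (dx k (fun y s => (E y s).1 I) x t * tractionFlux sys U x t I k
          + (E x t).1 I * dx k (fun y s => tractionFlux sys U y s I k) x t))
        - (∑ I, (dx k (fun y s => (U y s).1 I) x t * (E x t).2.1 I k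
          + (U x t).1 I * dx k (fun y s => (E y s).2.1 I k) x t))
        - ∑ I, ∑ i, (dx k (fun y s => (U y s).2.1 I i) x t * (E x t).2.2 I i k
          + (U x t).2.1 I i * dx k (fun y s => (E y s).2.2 I i k) x t) := by
  have hz : (1 : ℕ∞ω) ≠ 0 := by norm_num
  have u1 := fun J => (contDiff_fst_apply hU J).differentiable hz (x, t)
  have u2 := fun J i => (contDiff_snd_apply hU J i).differentiable hz (x, t)
  have e1 := fun J => (contDiff_fst_apply hE J).differentiable hz (x, t)
  have e2 := fun J i => (contDiff_snd_apply hE J i).differentiable hz (x, t)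
  have e3 := fun J i j => (contDiff_trd_apply hE J i j).differentiable hz (x, t)
  have f1 := fun I => (contDiff_tractionFlux ha hU I k).differentiable hz (x, t)
  have m1 : ∀ I, DifferentiableAt ℝ
      (Function.uncurry fun y s => (E y s).1 I * tractionFlux sys U y s I k) (x, t) :=
    fun I => (e1 I).mul (f1 I)
  have m2 : ∀ I, DifferentiableAt ℝ
      (Function.uncurry fun y s => (U y s).1 I * (E y s).2.1 I k) (x, t) :=
    fun I => (u1 I).mul (e2 I k)
  have m3 : ∀ I i, DifferentiableAt ℝ
      (Function.uncurry fun y s => (U y s).2.1 I i * (E y s).2.2 I i k) (x, t) :=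
    fun I i => (u2 I i).mul (e3 I i k)
  have n1 : DifferentiableAt ℝ
      (Function.uncurry fun y s => ∑ I, (E y s).1 I * tractionFlux sys U y s I k) (x, t) :=
    DifferentiableAt.fun_sum fun I _ => m1 I
  have n2 : DifferentiableAt ℝ
      (Function.uncurry fun y s => ∑ I, (U y s).1 I * (E y s).2.1 I k) (x, t) :=
    DifferentiableAt.fun_sum fun I _ => m2 I
  have n3 : ∀ I, DifferentiableAt ℝ
      (Function.uncurry fun y s => ∑ i, (U y s).2.1 I i * (E y s).2.2 I i k) (x, t) :=
    fun I => DifferentiableAt.fun_sum fun i _ => m3 I i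
  have n4 : DifferentiableAt ℝ
      (Function.uncurry fun y s => ∑ I, ∑ i, (U y s).2.1 I i * (E y s).2.2 I i k) (x, t) :=
    DifferentiableAt.fun_sum fun I _ => n3 I
  show dx k (fun y s => dualFlux sys U E k y s) x t = _
  unfold dualFlux
  have n5 : DifferentiableAt ℝ (Function.uncurry fun y s =>
      (∑ I, (E y s).1 I * tractionFlux sys U y s I k) - ∑ I, (U y s).1 I * (E y s).2.1 I k)
      (x, t) := n1.sub n2
  rw [dx_sub n5 n4, dx_sub n1 n2, dx_sum _ fun I _ => m1 I, dx_sum _ fun I _ => m2 I,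
    dx_sum _ fun I _ => n3 I]
  simp only [fun I => dx_sum (Finset.univ (α := Fin d)) (fun i _ => m3 I i) k,
    fun I => dx_mul (e1 I) (f1 I), fun I => dx_mul (u1 I) (e2 I k),
    fun I i => dx_mul (u2 I i) (e3 I i k)]

/-- Green's identity: up to a space-time divergence, the pairing of `(U, F(U))` with the arrays
`(P, L)` of `E` is minus the pairing of the residual of `U` with `E`. -/
theorem pairing_eq_residual (ha : ContDiff ℝ ∞ sys.a) (hU : ContDiff ℝ 1 (Function.uncurry U))
    (hE : ContDiff ℝ 1 (Function.uncurry E)) (x : Space d) (t : ℝ) :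
    -(dotU (U x t) (sys.P E x t) + dotL (sys.F (U x t)) (arrL E x t))
      = dotU (residual sys U x t) (E x t)
        - dt (fun y s => ∑ I, (U y s).1 I * (E y s).1 I) x t
        + ∑ k, dx k (dualFlux sys U E k) x t := by
  have hz : (1 : ℕ∞ω) ≠ 0 := by norm_num
  have u1 := fun J => (contDiff_fst_apply hU J).differentiable hz (x, t)
  have e1 := fun J => (contDiff_fst_apply hE J).differentiable hz (x, t)
  have m1 : ∀ I, DifferentiableAt ℝ
      (Function.uncurry fun y s => (U y s).1 I * (E y s).1 I) (x, t) :=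
    fun I => (u1 I).mul (e1 I)
  rw [dt_sum _ fun I _ => m1 I]
  simp only [fun I => dt_mul (u1 I) (e1 I), dx_dualFlux ha hU hE, dx_tractionFlux ha hU]
  exact green_pairing_algebra sys.cA sys.cB sys.cC (U x t).1
    (fun I => dt (fun y s => (U y s).1 I) x t) (sys.f (U x t)) (E x t).1
    (fun I => dt (fun y s => (E y s).1 I) x t)
    (fun I k => dx k (fun y s => (U y s).1 I) x t) (U x t).2.1 (sys.a (U x t))
    (fun I k => dx k (fun y s => sys.a (U y s) I k) x t)
    (fun I k => dx k (fun y s => (E y s).1 I) x t) (E x t).2.1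
    (fun I k => dx k (fun y s => (E y s).2.1 I k) x t)
    (fun I i k => dx k (fun y s => (U y s).2.1 I i) x t) (U x t).2.2 (E x t).2.2
    (fun I i k => dx k (fun y s => (E y s).2.2 I i k) x t)

end Green

end

noncomputable section

/-! ### Integration over the space-time cylinder and its lateral boundary -/

section Cylinder

open Filter
open scoped RealInnerProductSpace

variable {n d : ℕ} {Ω Γ : Set (Space d)} {ν : Space d → Space d} {T : ℝ}

/-- The product of the surface measure on `∂Ω` and Lebesgue measure in time. -/
def lateralMeasure (Ω : Set (Space d)) : Measure (Space d × ℝ) :=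
  ((surf d).restrict (frontier Ω)).prod volume

theorem IsC1Domain.lateralMeasure_restrict (hΩ : IsC1Domain Ω ν) (hΓ : Γ ⊆ frontier Ω)
    (hΓm : MeasurableSet Γ) (s : Set ℝ) :
    (lateralMeasure Ω).restrict (Γ ×ˢ s) = ((surf d).restrict Γ).prod (volume.restrict s) := by
  have := hΩ.isFiniteMeasure_surf (Subset.refl (frontier Ω))
  rw [lateralMeasure, ← Measure.prod_restrict, Measure.restrict_restrict hΓm,
    inter_eq_self_of_subset_left hΓ]

theorem IsC1Domain.lateralMeasure_lt_top (hΩ : IsC1Domain Ω ν) :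
    lateralMeasure Ω (Γ ×ˢ Ioo 0 T) < ⊤ := by
  have := hΩ.isFiniteMeasure_surf (Subset.refl (frontier Ω))
  rw [lateralMeasure, Measure.prod_prod]
  exact ENNReal.mul_lt_top (measure_lt_top _ _) (by simp)

/-- The iterated integral over a part of the lateral boundary as an integral over a set. -/
theorem IsC1Domain.integral_lateral (hΩ : IsC1Domain Ω ν) (hΓ : Γ ⊆ frontier Ω)
    (hΓm : MeasurableSet Γ) {F : Space d → ℝ → ℝ}
    (hF : IntegrableOn (fun p => F p.1 p.2) (Γ ×ˢ Ioo 0 T) (lateralMeasure Ω)) :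
    ∫ t in Ioo 0 T, ∫ x in Γ, F x t ∂surf d
      = ∫ p in Γ ×ˢ Ioo 0 T, F p.1 p.2 ∂lateralMeasure Ω := by
  have := hΩ.isFiniteMeasure_surf hΓ
  rw [IntegrableOn, hΩ.lateralMeasure_restrict hΓ hΓm] at hF
  rw [hΩ.lateralMeasure_restrict hΓ hΓm, integral_prod_symm _ hF]

theorem IsC1Domain.integrableOn_lateral (hΩ : IsC1Domain Ω ν) (hΓm : MeasurableSet Γ)
    {F : Space d × ℝ → ℝ} (hF : ContinuousOn F (Γ ×ˢ Ioc 0 T)) {C : ℝ}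
    (hC : ∀ p ∈ Γ ×ˢ Ioc 0 T, ‖F p‖ ≤ C) :
    IntegrableOn F (Γ ×ˢ Ioo 0 T) (lateralMeasure Ω) := by
  have hsub : Γ ×ˢ Ioo 0 T ⊆ Γ ×ˢ Ioc 0 T := prod_mono_right Ioo_subset_Ioc_self
  have hm : MeasurableSet (Γ ×ˢ Ioo 0 T) := hΓm.prod measurableSet_Ioo
  have : IsFiniteMeasure ((lateralMeasure Ω).restrict (Γ ×ˢ Ioo 0 T)) :=
    ⟨by rw [Measure.restrict_apply_univ]; exact hΩ.lateralMeasure_lt_top⟩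
  refine Integrable.of_bound ((hF.mono hsub).aestronglyMeasurable hm) C ?_
  filter_upwards [ae_restrict_mem hm] with p hp using hC p (hsub hp)

theorem IsC1Domain.integrableOn_lateral_of_continuousOn (hΩ : IsC1Domain Ω ν)
    (hΓ : Γ ⊆ frontier Ω) (hΓm : MeasurableSet Γ) {F : Space d × ℝ → ℝ}
    (hF : ContinuousOn F (frontier Ω ×ˢ Icc 0 T)) :
    IntegrableOn F (Γ ×ˢ Ioo 0 T) (lateralMeasure Ω) := by
  obtain ⟨C, hC⟩ := (hΩ.isCompact_frontier.prod isCompact_Icc).exists_bound_of_continuousOn hF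
  have hsub : Γ ×ˢ Ioc 0 T ⊆ frontier Ω ×ˢ Icc 0 T := prod_mono hΓ Ioc_subset_Icc_self
  exact hΩ.integrableOn_lateral hΓm (hF.mono hsub) fun p hp => hC p (hsub hp)

theorem IsC1Domain.integrableOn_lateral_mul (hΩ : IsC1Domain Ω ν) (hΓ : Γ ⊆ frontier Ω)
    (hΓm : MeasurableSet Γ) {F G : Space d × ℝ → ℝ}
    (hG : ContinuousOn G (frontier Ω ×ˢ Icc 0 T))
    (hF : IntegrableOn F (Γ ×ˢ Ioo 0 T) (lateralMeasure Ω)) :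
    IntegrableOn (fun p => G p * F p) (Γ ×ˢ Ioo 0 T) (lateralMeasure Ω) :=
  hF.continuousOn_mul_of_subset hG (hΩ.isCompact_frontier.prod isCompact_Icc)
    (hΓm.prod measurableSet_Ioo) (prod_mono hΓ Ioo_subset_Icc_self)

theorem IsC1Domain.integrableOn_cylinder (hΩ : IsC1Domain Ω ν) {F : Space d × ℝ → ℝ}
    (hF : Continuous F) : IntegrableOn F (Ω ×ˢ Ioo 0 T) :=
  (hF.continuousOn.integrableOn_compact (hΩ.isCompact_closure.prod isCompact_Icc)).mono_set
    (prod_mono subset_closure Ioo_subset_Icc_self)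

theorem IsC1Domain.continuousOn_normal_apply (hΩ : IsC1Domain Ω ν) (k : Fin d) :
    ContinuousOn (fun p : Space d × ℝ => ν p.1 k) (frontier Ω ×ˢ Icc 0 T) := by
  have h1 : ContinuousOn (fun p : Space d × ℝ => ν p.1) (frontier Ω ×ˢ Icc 0 T) :=
    hΩ.continuousOn_normal.comp continuousOn_fst fun p hp => hp.1
  exact (EuclideanSpace.proj (𝕜 := ℝ) k).continuous.comp_continuousOn h1

/-- The divergence theorem on the space-time cylinder for a space derivative. -/
theorem IsC1Domain.integral_dx (hΩ : IsC1Domain Ω ν) {F : Space d → ℝ → ℝ}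
    (hF : ContDiff ℝ 1 (Function.uncurry F)) (k : Fin d) :
    ∫ p in Ω ×ˢ Ioo 0 T, dx k F p.1 p.2
      = ∫ p in frontier Ω ×ˢ Ioo 0 T, F p.1 p.2 * ν p.1 k ∂lateralMeasure Ω := by
  have hc : Continuous fun p : Space d × ℝ => dx k F p.1 p.2 :=
    (contDiff_dx (r := 0) (by simpa using hF) k).continuous
  have hcont : ContinuousOn (fun p : Space d × ℝ => F p.1 p.2 * ν p.1 k)
      (frontier Ω ×ˢ Icc 0 T) := hF.continuous.continuousOn.mul (hΩ.continuousOn_normal_apply k)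
  rw [← hΩ.integral_lateral (F := fun x t => F x t * ν x k) Subset.rfl
    isClosed_frontier.measurableSet
    (hΩ.integrableOn_lateral_of_continuousOn Subset.rfl isClosed_frontier.measurableSet hcont)]
  have hi := hΩ.integrableOn_cylinder (T := T) hc
  rw [IntegrableOn, Measure.volume_eq_prod, ← Measure.prod_restrict] at hi
  rw [Measure.volume_eq_prod, ← Measure.prod_restrict, integral_prod_symm _ hi]
  congr 1
  ext t
  have hFt : ContDiff ℝ 1 fun y => F y t := hF.comp (by fun_prop : ContDiff ℝ 1 fun y => (y, t))
  have := hΩ.integral_fderiv hFt (EuclideanSpace.single k 1)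
  simp only [EuclideanSpace.inner_single_right, one_mul, conj_trivial] at this
  exact this

theorem IsC1Domain.integral_dt (hΩ : IsC1Domain Ω ν) (hT : 0 ≤ T) {F : Space d → ℝ → ℝ}
    (hF : ContDiff ℝ 1 (Function.uncurry F)) :
    ∫ p in Ω ×ˢ Ioo 0 T, dt F p.1 p.2 = ∫ x in Ω, (F x T - F x 0) := by
  have hc : Continuous fun p : Space d × ℝ => dt F p.1 p.2 :=
    (contDiff_dt (r := 0) (by simpa using hF)).continuous
  have hi := hΩ.integrableOn_cylinder (T := T) hc
  rw [Measure.volume_eq_prod] at hi ⊢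
  rw [setIntegral_prod _ hi]
  congr 1
  ext x
  have hFx : ContDiff ℝ 1 (F x) := hF.comp (by fun_prop : ContDiff ℝ 1 fun s => (x, s))
  rw [← integral_Ioc_eq_integral_Ioo, ← intervalIntegral.integral_of_le hT]
  refine intervalIntegral.integral_eq_sub_of_hasDerivAt
    (fun t _ => (hFx.differentiable (by norm_num) t).hasDerivAt) ?_
  exact (hc.comp (by fun_prop : Continuous fun s => (x, s))).intervalIntegrable _ _

end Cylinder

end

noncomputable section

/-! ### The first variation of the dual functional -/

section FirstVariation

open Filter
open scoped RealInnerProductSpace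

variable {n d : ℕ} {Ω : Set (Space d)} {ν : Space d → Space d} {T : ℝ} {bd : IBData n d}
  {sys : PrimalSystem n d} {U E : Space d → ℝ → State n d}

section Data

theorem integrableOn_tau (hΩ : IsC1Domain Ω ν) (hbd : bd.Regular Ω T) (I : Fin n) :
    IntegrableOn (fun p => bd.tau p.1 p.2 I) (bd.Γτ ×ˢ Ioo 0 T) (lateralMeasure Ω) := by
  obtain ⟨C, hC⟩ := hbd.bddTau.exists_norm_le
  exact hΩ.integrableOn_lateral hbd.partτ.measurableSet
    (continuousOn_pi.1 hbd.contTau I) (C := C)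
    fun p hp => (norm_le_pi_norm (bd.tau p.1 p.2) I).trans (hC _ (mem_image_of_mem _ hp))

theorem integrableOn_uBdry (hΩ : IsC1Domain Ω ν) (hbd : bd.Regular Ω T) (I : Fin n) :
    IntegrableOn (fun p => bd.uBdry p.1 p.2 I) (bd.Γu ×ˢ Ioo 0 T) (lateralMeasure Ω) := by
  obtain ⟨C, hC⟩ := hbd.bddBdry.exists_norm_le
  exact hΩ.integrableOn_lateral hbd.partu.measurableSet
    (continuousOn_pi.1 hbd.contBdry I) (C := C)
    fun p hp => (norm_le_pi_norm (bd.uBdry p.1 p.2) I).trans (hC _ (mem_image_of_mem _ hp))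

theorem integrableOn_gBdry (hΩ : IsC1Domain Ω ν) (hbd : bd.Regular Ω T) (I : Fin n)
    (i : Fin d) :
    IntegrableOn (fun p => bd.gBdry p.1 p.2 I i) (bd.Γg ×ˢ Ioo 0 T) (lateralMeasure Ω) := by
  obtain ⟨C, hC⟩ := hbd.bddGrad.exists_norm_le
  exact hΩ.integrableOn_lateral hbd.partg.measurableSet
    (continuousOn_pi.1 (continuousOn_pi.1 hbd.contGrad I) i) (C := C)
    fun p hp => ((norm_le_pi_norm (bd.gBdry p.1 p.2 I) i).trans
      (norm_le_pi_norm (bd.gBdry p.1 p.2) I)).trans (hC _ (mem_image_of_mem _ hp))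

theorem integrableOn_uInit (hΩ : IsC1Domain Ω ν) (hbd : bd.Regular Ω T) (I : Fin n) :
    IntegrableOn (fun x => bd.uInit x I) Ω := by
  obtain ⟨C, hC⟩ := hbd.bddInit.exists_norm_le
  have : IsFiniteMeasure ((volume : Measure (Space d)).restrict Ω) :=
    ⟨by rw [Measure.restrict_apply_univ]
        exact (measure_mono subset_closure).trans_lt hΩ.isCompact_closure.measure_lt_top⟩
  refine Integrable.of_bound ((continuousOn_pi.1 hbd.contInit I).aestronglyMeasurable
    hΩ.isOpen.measurableSet) C ?_
  filter_upwards [ae_restrict_mem hΩ.isOpen.measurableSet] with x hx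
  exact (norm_le_pi_norm (bd.uInit x) I).trans (hC _ (mem_image_of_mem _ hx))

theorem integrableOn_tau_pairing (hΩ : IsC1Domain Ω ν) (hbd : bd.Regular Ω T)
    (hE : Continuous (Function.uncurry E)) :
    IntegrableOn (fun p => ∑ I, (E p.1 p.2).1 I * bd.tau p.1 p.2 I) (bd.Γτ ×ˢ Ioo 0 T)
      (lateralMeasure Ω) := by
  refine integrable_finsetSum _ fun I _ => ?_
  have hc := ((contDiff_fst_apply (contDiff_zero.2 hE)) I).continuous
  exact hΩ.integrableOn_lateral_mul hbd.partτ.subset hbd.partτ.measurableSet hc.continuousOn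
    (integrableOn_tau hΩ hbd I)

theorem integrableOn_uBdry_pairing (hΩ : IsC1Domain Ω ν) (hbd : bd.Regular Ω T)
    (hE : Continuous (Function.uncurry E)) :
    IntegrableOn (fun p => ∑ I, ∑ i, (E p.1 p.2).2.1 I i * bd.uBdry p.1 p.2 I * ν p.1 i)
      (bd.Γu ×ˢ Ioo 0 T) (lateralMeasure Ω) := by
  refine integrable_finsetSum _ fun I _ => integrable_finsetSum _ fun i _ => ?_
  have hc := ((contDiff_snd_apply (contDiff_zero.2 hE)) I i).continuous
  have := hΩ.integrableOn_lateral_mul hbd.partu.subset hbd.partu.measurableSet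
    (hc.continuousOn.mul (hΩ.continuousOn_normal_apply i)) (integrableOn_uBdry hΩ hbd I)
  refine this.congr (Eventually.of_forall fun p => ?_)
  simp only [Pi.mul_apply, Function.uncurry]
  ring

theorem integrableOn_gBdry_pairing (hΩ : IsC1Domain Ω ν) (hbd : bd.Regular Ω T)
    (hE : Continuous (Function.uncurry E)) :
    IntegrableOn
      (fun p => ∑ I, ∑ i, ∑ j, (E p.1 p.2).2.2 I i j * bd.gBdry p.1 p.2 I i * ν p.1 j)
      (bd.Γg ×ˢ Ioo 0 T) (lateralMeasure Ω) := by
  refine integrable_finsetSum _ fun I _ => integrable_finsetSum _ fun i _ =>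
    integrable_finsetSum _ fun j _ => ?_
  have hc := ((contDiff_trd_apply (contDiff_zero.2 hE)) I i j).continuous
  have := hΩ.integrableOn_lateral_mul hbd.partg.subset hbd.partg.measurableSet
    (hc.continuousOn.mul (hΩ.continuousOn_normal_apply j)) (integrableOn_gBdry hΩ hbd I i)
  refine this.congr (Eventually.of_forall fun p => ?_)
  simp only [Pi.mul_apply, Function.uncurry]
  ring

theorem integrableOn_uInit_pairing (hΩ : IsC1Domain Ω ν) (hbd : bd.Regular Ω T)
    (hE : Continuous (Function.uncurry E)) :
    IntegrableOn (fun x => ∑ I, (E x 0).1 I * bd.uInit x I) Ω := by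
  refine integrable_finsetSum _ fun I _ => ?_
  have hc : Continuous fun x => (E x 0).1 I :=
    ((contDiff_fst_apply (contDiff_zero.2 hE)) I).continuous.comp
      (by fun_prop : Continuous fun x => (x, (0 : ℝ)))
  exact (integrableOn_uInit hΩ hbd I).continuousOn_mul_of_subset hc.continuousOn
    hΩ.isCompact_closure hΩ.isOpen.measurableSet subset_closure

end Data

/-- The data terms of the dual functional, a linear functional of the dual fields. -/
def dataTerm (bd : IBData n d) (Ω : Set (Space d)) (ν : Space d → Space d) (T : ℝ)
    (E : Space d → ℝ → State n d) : ℝ :=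
  - (∫ x in Ω, ∑ I, (E x 0).1 I * bd.uInit x I)
  - (∫ p in bd.Γτ ×ˢ Ioo 0 T, ∑ I, (E p.1 p.2).1 I * bd.tau p.1 p.2 I ∂lateralMeasure Ω)
  + (∫ p in bd.Γu ×ˢ Ioo 0 T,
      ∑ I, ∑ i, (E p.1 p.2).2.1 I i * bd.uBdry p.1 p.2 I * ν p.1 i ∂lateralMeasure Ω)
  + (∫ p in bd.Γg ×ˢ Ioo 0 T,
      ∑ I, ∑ i, ∑ j, (E p.1 p.2).2.2 I i j * bd.gBdry p.1 p.2 I i * ν p.1 j ∂lateralMeasure Ω)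

theorem S_eq_add_dataTerm (hΩ : IsC1Domain Ω ν) (hbd : bd.Regular Ω T)
    (hE : Continuous (Function.uncurry E)) (H : State n d → Space d → ℝ → ℝ)
    (UH : State n d × Flux n d × Space d × ℝ → State n d) :
    sys.S bd Ω ν T H UH E
      = -(∫ p in Ω ×ˢ Ioo 0 T, sys.Mstar H UH (sys.P E p.1 p.2) (arrL E p.1 p.2) p.1 p.2)
        + dataTerm bd Ω ν T E := by
  rw [PrimalSystem.S, dataTerm,
    hΩ.integral_lateral (F := fun x t => ∑ I, (E x t).1 I * bd.tau x t I)
      hbd.partτ.subset hbd.partτ.measurableSet (integrableOn_tau_pairing hΩ hbd hE),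
    hΩ.integral_lateral
      (F := fun x t => ∑ I, ∑ i, (E x t).2.1 I i * bd.uBdry x t I * ν x i)
      hbd.partu.subset hbd.partu.measurableSet (integrableOn_uBdry_pairing hΩ hbd hE),
    hΩ.integral_lateral
      (F := fun x t => ∑ I, ∑ i, ∑ j, (E x t).2.2 I i j * bd.gBdry x t I i * ν x j)
      hbd.partg.subset hbd.partg.measurableSet (integrableOn_gBdry_pairing hΩ hbd hE)]
  ring

theorem dataTerm_add_smul (hΩ : IsC1Domain Ω ν) (hbd : bd.Regular Ω T)
    {D : Space d → ℝ → State n d} (hD : Continuous (Function.uncurry D))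
    (hE : Continuous (Function.uncurry E)) (ε : ℝ) :
    dataTerm bd Ω ν T (fun x t => D x t + ε • E x t)
      = dataTerm bd Ω ν T D + ε * dataTerm bd Ω ν T E := by
  have h1 := integral_add (integrableOn_uInit_pairing hΩ hbd hD)
    ((integrableOn_uInit_pairing hΩ hbd hE).const_mul ε)
  have h2 := integral_add (integrableOn_tau_pairing hΩ hbd hD)
    ((integrableOn_tau_pairing hΩ hbd hE).const_mul ε)
  have h3 := integral_add (integrableOn_uBdry_pairing hΩ hbd hD)
    ((integrableOn_uBdry_pairing hΩ hbd hE).const_mul ε)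
  have h4 := integral_add (integrableOn_gBdry_pairing hΩ hbd hD)
    ((integrableOn_gBdry_pairing hΩ hbd hE).const_mul ε)
  rw [integral_const_mul] at h1 h2 h3 h4
  have e1 : ∀ x, (∑ I, (D x 0).1 I * bd.uInit x I) + ε * ∑ I, (E x 0).1 I * bd.uInit x I
      = ∑ I, (D x 0 + ε • E x 0).1 I * bd.uInit x I := fun x => by
    simp [add_mul, Finset.sum_add_distrib, Finset.mul_sum, mul_assoc]
  have e2 : ∀ p : Space d × ℝ, (∑ I, (D p.1 p.2).1 I * bd.tau p.1 p.2 I)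
      + ε * ∑ I, (E p.1 p.2).1 I * bd.tau p.1 p.2 I
      = ∑ I, (D p.1 p.2 + ε • E p.1 p.2).1 I * bd.tau p.1 p.2 I := fun x => by
    simp [add_mul, Finset.sum_add_distrib, Finset.mul_sum, mul_assoc]
  have e3 : ∀ p : Space d × ℝ,
      (∑ I, ∑ i, (D p.1 p.2).2.1 I i * bd.uBdry p.1 p.2 I * ν p.1 i)
      + ε * ∑ I, ∑ i, (E p.1 p.2).2.1 I i * bd.uBdry p.1 p.2 I * ν p.1 i
      = ∑ I, ∑ i, (D p.1 p.2 + ε • E p.1 p.2).2.1 I i * bd.uBdry p.1 p.2 I * ν p.1 i :=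
    fun x => by simp [add_mul, Finset.sum_add_distrib, Finset.mul_sum, mul_assoc]
  have e4 : ∀ p : Space d × ℝ,
      (∑ I, ∑ i, ∑ j, (D p.1 p.2).2.2 I i j * bd.gBdry p.1 p.2 I i * ν p.1 j)
      + ε * ∑ I, ∑ i, ∑ j, (E p.1 p.2).2.2 I i j * bd.gBdry p.1 p.2 I i * ν p.1 j
      = ∑ I, ∑ i, ∑ j, (D p.1 p.2 + ε • E p.1 p.2).2.2 I i j * bd.gBdry p.1 p.2 I i * ν p.1 j :=
    fun x => by simp [add_mul, Finset.sum_add_distrib, Finset.mul_sum, mul_assoc]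
  simp only [e1, e2, e3, e4] at h1 h2 h3 h4
  rw [dataTerm, dataTerm, dataTerm, h1, h2, h3, h4]
  ring

/-- The first variation of the dual functional before integration by parts. -/
theorem hasDerivAt_S (hΩ : IsC1Domain Ω ν) (hf : ContDiff ℝ ∞ sys.f) (ha : ContDiff ℝ ∞ sys.a)
    (hbd : bd.Regular Ω T) {H : State n d → Space d → ℝ → ℝ}
    (hH : Continuous fun q : State n d × Space d × ℝ => H q.1 q.2.1 q.2.2)
    {O : Set (State n d × Flux n d × Space d × ℝ)} (hO : IsOpen O)
    {UH : State n d × Flux n d × Space d × ℝ → State n d} (hUH : ContDiffOn ℝ 1 UH O)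
    (hinv : ∀ P L x t, (P, L, x, t) ∈ O → x ∈ closure Ω → t ∈ Icc 0 T →
      HasFDerivAt (fun U => sys.M H U L x t) (dotUCLM P) (UH (P, L, x, t)))
    {D : Space d → ℝ → State n d} (hD : ContDiff ℝ 2 (Function.uncurry D))
    (hDO : ∀ x ∈ closure Ω, ∀ t ∈ Icc 0 T, (sys.P D x t, arrL D x t, x, t) ∈ O)
    (hE : ContDiff ℝ 2 (Function.uncurry E)) :
    HasDerivAt (fun ε : ℝ => sys.S bd Ω ν T H UH (fun x t => D x t + ε • E x t))
      (-(∫ p in Ω ×ˢ Ioo 0 T, (dotU (sys.primal UH D p.1 p.2) (sys.P E p.1 p.2)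
        + dotL (sys.F (sys.primal UH D p.1 p.2)) (arrL E p.1 p.2))) + dataTerm bd Ω ν T E) 0 := by
  have hmain := (hasDerivAt_integral_Mstar hf ha hH hO hUH
    (hΩ.isCompact_closure.prod (isCompact_Icc (a := (0 : ℝ)) (b := T)))
    (hΩ.isOpen.measurableSet.prod measurableSet_Ioo)
    (prod_mono subset_closure Ioo_subset_Icc_self)
    (fun P L p hp hpO => hinv P L p.1 p.2 hpO hp.1 hp.2)
    (contDiff_P sys hD).continuous (contDiff_P sys hE).continuous
    (contDiff_arrL hD).continuous (contDiff_arrL hE).continuous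
    (fun p hp => hDO p.1 hp.1 p.2 hp.2)).2
  have hlin : HasDerivAt (fun ε : ℝ => dataTerm bd Ω ν T D + ε * dataTerm bd Ω ν T E)
      (dataTerm bd Ω ν T E) 0 := by
    simpa using ((hasDerivAt_id (0 : ℝ)).mul_const (dataTerm bd Ω ν T E)).const_add
      (dataTerm bd Ω ν T D)
  refine (hmain.neg.add hlin).congr_of_eventuallyEq (Eventually.of_forall fun ε => ?_)
  have hc : Continuous (Function.uncurry fun x t => D x t + ε • E x t) :=
    hD.continuous.add (hE.continuous.const_smul ε)
  simp only [Pi.add_apply, Pi.neg_apply]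
  rw [S_eq_add_dataTerm hΩ hbd hc, dataTerm_add_smul hΩ hbd hD.continuous hE.continuous]
  simp only [P_add_smul sys hD hE, arrL_add_smul hD hE]

end FirstVariation

end

noncomputable section

section FirstVariation

open Filter
open scoped RealInnerProductSpace

variable {n d : ℕ} {Ω Γ : Set (Space d)} {ν : Space d → Space d} {T : ℝ} {bd : IBData n d}
  {sys : PrimalSystem n d} {U E : Space d → ℝ → State n d}

theorem continuous_residual (ha : ContDiff ℝ ∞ sys.a) (hf : ContDiff ℝ ∞ sys.f)
    (hU : ContDiff ℝ 1 (Function.uncurry U)) :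
    Continuous fun p : Space d × ℝ => residual sys U p.1 p.2 := by
  have u1 := fun I => (contDiff_fst_apply hU I).continuous
  have u2 := fun I i => (contDiff_snd_apply hU I i).continuous
  have u3 := fun I i j => (contDiff_trd_apply hU I i j).continuous
  have t1 := fun I => (contDiff_dt (r := 0) (by simpa using contDiff_fst_apply hU I)).continuous
  have x1 := fun I k =>
    (contDiff_dx (r := 0) (by simpa using contDiff_fst_apply hU I) k).continuous
  have x2 := fun I i k =>
    (contDiff_dx (r := 0) (by simpa using contDiff_snd_apply hU I i) k).continuous
  have x3 := fun I i k =>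
    (contDiff_dx (r := 0) (by simpa using contDiff_a_apply ha hU I i) k).continuous
  have f1 : ∀ I, Continuous fun p : Space d × ℝ => sys.f (U p.1 p.2) I := fun I =>
    (continuous_apply I).comp (hf.continuous.comp hU.continuous)
  simp only [Function.uncurry_def] at u1 u2 u3
  unfold residual
  fun_prop

theorem continuous_dotU {X : Type*} [TopologicalSpace X] {V W : X → State n d}
    (hV : Continuous V) (hW : Continuous W) : Continuous fun p => dotU (V p) (W p) := by
  unfold dotU
  fun_prop

theorem sum_dualFlux_mul (ν : Fin d → ℝ) (x : Space d) (t : ℝ) :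
    ∑ k, dualFlux sys U E k x t * ν k
      = (∑ I, (E x t).1 I * ∑ k, tractionFlux sys U x t I k * ν k)
        - (∑ I, ∑ i, (E x t).2.1 I i * ((U x t).1 I * ν i))
        - ∑ I, ∑ i, ∑ j, (E x t).2.2 I i j * ((U x t).2.1 I i * ν j) := by
  simp only [dualFlux, sub_mul, Finset.sum_mul, Finset.sum_sub_distrib, Finset.mul_sum]
  congr 1
  · congr 1
    · rw [Finset.sum_comm]
      exact Finset.sum_congr rfl fun _ _ => Finset.sum_congr rfl fun _ _ => by ring
    · rw [Finset.sum_comm]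
      exact Finset.sum_congr rfl fun _ _ => Finset.sum_congr rfl fun _ _ => by ring
  · rw [Finset.sum_comm]
    refine Finset.sum_congr rfl fun _ _ => ?_
    rw [Finset.sum_comm]
    exact Finset.sum_congr rfl fun _ _ => Finset.sum_congr rfl fun _ _ => by ring

/-- A function on the lateral boundary which vanishes off `Γ` need only be integrated over `Γ`. -/
theorem setIntegral_lateral_eq_of_forall_eq_zero (hΓ : Γ ⊆ frontier Ω) {F : Space d × ℝ → ℝ}
    (h : ∀ x ∈ frontier Ω \ Γ, ∀ t ∈ Ioc 0 T, F (x, t) = 0) :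
    ∫ p in frontier Ω ×ˢ Ioo 0 T, F p ∂lateralMeasure Ω
      = ∫ p in Γ ×ˢ Ioo 0 T, F p ∂lateralMeasure Ω := by
  refine setIntegral_eq_of_subset_of_forall_sdiff_eq_zero
    (isClosed_frontier.measurableSet.prod measurableSet_Ioo) (prod_mono_left hΓ) ?_
  rintro ⟨x, t⟩ ⟨hp, hp'⟩
  exact h x ⟨hp.1, fun hx => hp' ⟨hx, hp.2⟩⟩ t (Ioo_subset_Ioc_self hp.2)

/-- The sum of the pairings of the components of `E` with the amounts by which `U` fails to satisfy
the system and the initial and boundary conditions. -/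
def firstVariation (sys : PrimalSystem n d) (bd : IBData n d) (Ω : Set (Space d))
    (ν : Space d → Space d) (T : ℝ) (U E : Space d → ℝ → State n d) : ℝ :=
  (∫ p in Ω ×ˢ Ioo 0 T, dotU (residual sys U p.1 p.2) (E p.1 p.2))
    + (∫ x in Ω, ∑ I, (E x 0).1 I * ((U x 0).1 I - bd.uInit x I))
    + (∫ p in bd.Γτ ×ˢ Ioo 0 T, ∑ I, (E p.1 p.2).1 I *
        ((∑ k, tractionFlux sys U p.1 p.2 I k * ν p.1 k) - bd.tau p.1 p.2 I)
        ∂lateralMeasure Ω)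
    + (∫ p in bd.Γu ×ˢ Ioo 0 T, ∑ I, ∑ i, (E p.1 p.2).2.1 I i *
        ((bd.uBdry p.1 p.2 I - (U p.1 p.2).1 I) * ν p.1 i) ∂lateralMeasure Ω)
    + (∫ p in bd.Γg ×ˢ Ioo 0 T, ∑ I, ∑ i, ∑ j, (E p.1 p.2).2.2 I i j *
        ((bd.gBdry p.1 p.2 I i - (U p.1 p.2).2.1 I i) * ν p.1 j) ∂lateralMeasure Ω)

/-- Integration by parts in the first variation of the dual functional, for an admissible variation
`E`. -/
theorem firstVariation_eq (hΩ : IsC1Domain Ω ν) (hT : 0 ≤ T) (hbd : bd.Regular Ω T)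
    (hf : ContDiff ℝ ∞ sys.f) (ha : ContDiff ℝ ∞ sys.a)
    (hU : ContDiff ℝ 1 (Function.uncurry U)) (hE : ContDiff ℝ 1 (Function.uncurry E))
    (hE0 : bd.Agrees Ω T E fun _ _ => 0) :
    -(∫ p in Ω ×ˢ Ioo 0 T, (dotU (U p.1 p.2) (sys.P E p.1 p.2)
        + dotL (sys.F (U p.1 p.2)) (arrL E p.1 p.2))) + dataTerm bd Ω ν T E
      = firstVariation sys bd Ω ν T U E := by
  have u1 := fun I => (contDiff_fst_apply hU I).continuous
  have u2 := fun I i => (contDiff_snd_apply hU I i).continuous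
  have e1 := fun I => (contDiff_fst_apply hE I).continuous
  have e2 := fun I i => (contDiff_snd_apply hE I i).continuous
  have e3 := fun I i j => (contDiff_trd_apply hE I i j).continuous
  have f1 := fun I k => (contDiff_tractionFlux ha hU I k).continuous
  have hν := fun k => hΩ.continuousOn_normal_apply (T := T) k
  simp only [Function.uncurry_def] at u1 u2 e1 e2 e3 f1
  -- the volume integral
  have hpair : ContDiff ℝ 1 (Function.uncurry fun y s => ∑ I, (U y s).1 I * (E y s).1 I) :=
    ContDiff.sum fun I _ => (contDiff_fst_apply hU I).mul (contDiff_fst_apply hE I)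
  have hflux := fun k => contDiff_dualFlux ha hU hE k
  have i1 : IntegrableOn (fun p : Space d × ℝ => dotU (residual sys U p.1 p.2) (E p.1 p.2))
      (Ω ×ˢ Ioo 0 T) :=
    hΩ.integrableOn_cylinder (continuous_dotU (continuous_residual ha hf hU) hE.continuous)
  have i2 : IntegrableOn
      (fun p : Space d × ℝ => dt (fun y s => ∑ I, (U y s).1 I * (E y s).1 I) p.1 p.2)
      (Ω ×ˢ Ioo 0 T) :=
    hΩ.integrableOn_cylinder (contDiff_dt (r := 0) (by simpa using hpair)).continuous
  have i3 : ∀ k, IntegrableOn (fun p : Space d × ℝ => dx k (dualFlux sys U E k) p.1 p.2)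
      (Ω ×ˢ Ioo 0 T) := fun k =>
    hΩ.integrableOn_cylinder (contDiff_dx (r := 0) (by simpa using hflux k) k).continuous
  have hvol : -(∫ p in Ω ×ˢ Ioo 0 T, (dotU (U p.1 p.2) (sys.P E p.1 p.2)
        + dotL (sys.F (U p.1 p.2)) (arrL E p.1 p.2)))
      = (∫ p in Ω ×ˢ Ioo 0 T, dotU (residual sys U p.1 p.2) (E p.1 p.2))
        + (∫ x in Ω, ∑ I, (E x 0).1 I * (U x 0).1 I)
        + ∫ p in frontier Ω ×ˢ Ioo 0 T, ∑ k, dualFlux sys U E k p.1 p.2 * ν p.1 k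
            ∂lateralMeasure Ω := by
    rw [← integral_neg]
    simp only [pairing_eq_residual ha hU hE]
    have i4 : IntegrableOn (fun p : Space d × ℝ => dotU (residual sys U p.1 p.2) (E p.1 p.2)
        - dt (fun y s => ∑ I, (U y s).1 I * (E y s).1 I) p.1 p.2) (Ω ×ˢ Ioo 0 T) := i1.sub i2
    have i5 : ∀ k, IntegrableOn (fun p : Space d × ℝ => dualFlux sys U E k p.1 p.2 * ν p.1 k)
        (frontier Ω ×ˢ Ioo 0 T) (lateralMeasure Ω) := fun k =>
      hΩ.integrableOn_lateral_of_continuousOn Subset.rfl isClosed_frontier.measurableSet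
        ((hflux k).continuous.continuousOn.mul (hν k))
    rw [integral_add i4 (integrable_finsetSum _ fun k _ => i3 k), integral_sub i1 i2,
      integral_finsetSum _ fun k _ => i3 k, hΩ.integral_dt hT hpair,
      Finset.sum_congr rfl fun k _ => hΩ.integral_dx (hflux k) k,
      integral_finsetSum _ fun k _ => i5 k,
      sub_eq_add_neg (∫ p in Ω ×ˢ Ioo 0 T, dotU (residual sys U p.1 p.2) (E p.1 p.2)),
      ← integral_neg]
    congr 2
    refine setIntegral_congr_fun hΩ.isOpen.measurableSet fun x hx => ?_
    have h0 : ∀ I, (E x T).1 I = 0 := fun I => congrFun (hE0.final x hx) I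
    simp [h0, mul_comm]
  -- the lateral boundary
  have c1 : ContinuousOn (fun p : Space d × ℝ =>
      ∑ I, (E p.1 p.2).1 I * ∑ k, tractionFlux sys U p.1 p.2 I k * ν p.1 k)
      (frontier Ω ×ˢ Icc 0 T) :=
    continuousOn_finsetSum _ fun I _ => (e1 I).continuousOn.mul
      (continuousOn_finsetSum _ fun k _ => (f1 I k).continuousOn.mul (hν k))
  have c2 : ContinuousOn (fun p : Space d × ℝ =>
      ∑ I, ∑ i, (E p.1 p.2).2.1 I i * ((U p.1 p.2).1 I * ν p.1 i))
      (frontier Ω ×ˢ Icc 0 T) :=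
    continuousOn_finsetSum _ fun I _ => continuousOn_finsetSum _ fun i _ =>
      (e2 I i).continuousOn.mul ((u1 I).continuousOn.mul (hν i))
  have c3 : ContinuousOn (fun p : Space d × ℝ =>
      ∑ I, ∑ i, ∑ j, (E p.1 p.2).2.2 I i j * ((U p.1 p.2).2.1 I i * ν p.1 j))
      (frontier Ω ×ˢ Icc 0 T) :=
    continuousOn_finsetSum _ fun I _ => continuousOn_finsetSum _ fun i _ =>
      continuousOn_finsetSum _ fun j _ =>
        (e3 I i j).continuousOn.mul ((u2 I i).continuousOn.mul (hν j))
  have hfr := isClosed_frontier (s := Ω) |>.measurableSet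
  have hlat : ∫ p in frontier Ω ×ˢ Ioo 0 T, ∑ k, dualFlux sys U E k p.1 p.2 * ν p.1 k
        ∂lateralMeasure Ω
      = (∫ p in bd.Γτ ×ˢ Ioo 0 T, ∑ I, (E p.1 p.2).1 I *
          ∑ k, tractionFlux sys U p.1 p.2 I k * ν p.1 k ∂lateralMeasure Ω)
        - (∫ p in bd.Γu ×ˢ Ioo 0 T, ∑ I, ∑ i, (E p.1 p.2).2.1 I i *
            ((U p.1 p.2).1 I * ν p.1 i) ∂lateralMeasure Ω)
        - (∫ p in bd.Γg ×ˢ Ioo 0 T, ∑ I, ∑ i, ∑ j, (E p.1 p.2).2.2 I i j *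
            ((U p.1 p.2).2.1 I i * ν p.1 j) ∂lateralMeasure Ω) := by
    simp only [sum_dualFlux_mul]
    have j1 := hΩ.integrableOn_lateral_of_continuousOn Subset.rfl hfr c1
    have j2 := hΩ.integrableOn_lateral_of_continuousOn Subset.rfl hfr c2
    have j3 := hΩ.integrableOn_lateral_of_continuousOn Subset.rfl hfr c3
    have j4 : IntegrableOn (fun p : Space d × ℝ =>
        (∑ I, (E p.1 p.2).1 I * ∑ k, tractionFlux sys U p.1 p.2 I k * ν p.1 k)
        - ∑ I, ∑ i, (E p.1 p.2).2.1 I i * ((U p.1 p.2).1 I * ν p.1 i))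
        (frontier Ω ×ˢ Ioo 0 T) (lateralMeasure Ω) := j1.sub j2
    rw [integral_sub j4 j3, integral_sub j1 j2,
      setIntegral_lateral_eq_of_forall_eq_zero hbd.partτ.subset fun x hx t ht => by
        simp [hE0.lam x hx t ht],
      setIntegral_lateral_eq_of_forall_eq_zero hbd.partu.subset fun x hx t ht => by
        simp [hE0.gam x hx t ht],
      setIntegral_lateral_eq_of_forall_eq_zero hbd.partg.subset fun x hx t ht => by
        simp [hE0.rho x hx t ht]]
  -- collecting the data terms
  have k1 := hΩ.integrableOn_lateral_of_continuousOn hbd.partτ.subset hbd.partτ.measurableSet c1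
  have k2 := hΩ.integrableOn_lateral_of_continuousOn hbd.partu.subset hbd.partu.measurableSet c2
  have k3 := hΩ.integrableOn_lateral_of_continuousOn hbd.partg.subset hbd.partg.measurableSet c3
  have k0 : IntegrableOn (fun x => ∑ I, (E x 0).1 I * (U x 0).1 I) Ω := by
    have e0 : Continuous fun x : Space d => (x, (0 : ℝ)) := by fun_prop
    have : Continuous fun x => ∑ I, (E x 0).1 I * (U x 0).1 I :=
      continuous_finsetSum _ fun I _ => ((e1 I).comp e0).mul ((u1 I).comp e0)
    exact (this.continuousOn.integrableOn_compact hΩ.isCompact_closure).mono_set subset_closure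
  have s0 := integral_sub k0 (integrableOn_uInit_pairing hΩ hbd hE.continuous)
  have s1 := integral_sub k1 (integrableOn_tau_pairing hΩ hbd hE.continuous)
  have s2 := integral_sub (integrableOn_uBdry_pairing hΩ hbd hE.continuous) k2
  have s3 := integral_sub (integrableOn_gBdry_pairing hΩ hbd hE.continuous) k3
  simp only [← mul_assoc] at s0 s1 s2 s3 hlat
  rw [hvol, dataTerm, hlat, firstVariation]
  simp only [mul_sub, sub_mul, Finset.sum_sub_distrib, ← mul_assoc]
  rw [s0, s1, s2, s3]
  ring

end FirstVariation

end

noncomputable section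

/-! ### The fundamental lemma on the cylinder, at the initial time and on the lateral boundary -/

section Fundamental

open Filter

/-- The fundamental lemma of the calculus of variations for a function continuous on `s`, at a point
of `s` all of whose neighbourhoods in `s` have positive measure. -/
theorem eq_zero_of_forall_setIntegral_mul_eq_zero {X : Type*} [NormedAddCommGroup X]
    [NormedSpace ℝ X] [FiniteDimensional ℝ X] [MeasurableSpace X] [BorelSpace X] {μ : Measure X}
    {W s : Set X} (hW : IsOpen W) (hs : MeasurableSet s) {F : X → ℝ} (hF : IntegrableOn F s μ)
    (hc : ContinuousOn F s)
    (h : ∀ g : X → ℝ, ContDiff ℝ ∞ g → tsupport g ⊆ W → ∫ x in s, g x * F x ∂μ = 0)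
    {x : X} (hxW : x ∈ W) (hx : x ∈ s) (hpos : ∀ N, IsOpen N → x ∈ N → 0 < μ (s ∩ N)) :
    F x = 0 := by
  by_contra hne
  have hae := hW.ae_eq_zero_of_integral_contDiff_smul_eq_zero (μ := μ.restrict s)
    (hF.locallyIntegrable.locallyIntegrableOn W) fun g hg _ hgW => h g hg hgW
  obtain ⟨N, hN, hxN, hNs⟩ := mem_nhdsWithin.1 ((hc x hx).eventually_ne hne)
  refine (hpos (N ∩ W) (hN.inter hW) ⟨hxN, hxW⟩).ne' ?_
  rw [ae_restrict_iff' hs] at hae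
  refine measure_mono_null (fun y hy => ?_) hae
  exact fun hys => hNs ⟨hy.2.1, hy.1⟩ (hys hy.1 hy.2.2)

variable {d : ℕ} {Ω Γ : Set (Space d)} {ν : Space d → Space d} {T : ℝ}

theorem IsC1Domain.lateralMeasure_pos (hΩ : IsC1Domain Ω ν) {N : Set (Space d × ℝ)}
    (hN : IsOpen N) {x : Space d} {t : ℝ} (hx : x ∈ frontier Ω) (hp : (x, t) ∈ N) :
    0 < lateralMeasure Ω N := by
  have := hΩ.isFiniteMeasure_surf (Subset.refl (frontier Ω))
  obtain ⟨V, J, hV, hJ, hxV, htJ, hVJ⟩ := isOpen_prod_iff.1 hN x t hp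
  refine lt_of_lt_of_le ?_ (measure_mono hVJ)
  rw [lateralMeasure, Measure.prod_prod, Measure.restrict_apply hV.measurableSet]
  exact ENNReal.mul_pos (hΩ.surf_inter_frontier_pos hV hxV hx).ne' (hJ.measure_pos _ ⟨t, htJ⟩).ne'

/-- The fundamental lemma on a part of the lateral boundary, with test functions that vanish on the
rest of the boundary and outside the time interval. -/
theorem IsBoundaryPart.eq_zero_of_forall_setIntegral_mul_eq_zero (hΩ : IsC1Domain Ω ν)
    (hΓ : IsBoundaryPart Ω Γ) {F : Space d × ℝ → ℝ}
    (hF : IntegrableOn F (Γ ×ˢ Ioo 0 T) (lateralMeasure Ω))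
    (hc : ContinuousOn F (Γ ×ˢ Ioc 0 T))
    (h : ∀ g : Space d × ℝ → ℝ, ContDiff ℝ ∞ g → (∀ x ∈ frontier Ω \ Γ, ∀ t, g (x, t) = 0) →
      (∀ x, ∀ t ∉ Ioo 0 T, g (x, t) = 0) →
      ∫ p in Γ ×ˢ Ioo 0 T, g p * F p ∂lateralMeasure Ω = 0)
    {x : Space d} (hx : x ∈ Γ) {t : ℝ} (ht : t ∈ Ioc 0 T) : F (x, t) = 0 := by
  have hsub : Γ ×ˢ Ioo 0 T ⊆ Γ ×ˢ Ioc 0 T := prod_mono_right Ioo_subset_Ioc_self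
  set Γ' : Set (Space d) := {x | x ∈ Γ ∧ Γ ∈ 𝓝[frontier Ω] x} with hΓ'
  have hΓ'Γ : Γ' ⊆ Γ := fun y hy => hy.1
  -- at relative interior points, by localization to a set which meets `∂Ω` inside `Γ`
  have hint : ∀ p ∈ Γ' ×ˢ Ioo 0 T, F p = 0 := by
    rintro ⟨y, s⟩ ⟨⟨hy, hyΓ⟩, hs⟩
    obtain ⟨V, hV, hyV, hVΓ⟩ := mem_nhdsWithin.1 hyΓ
    refine DualIBVP.eq_zero_of_forall_setIntegral_mul_eq_zero (hV.prod isOpen_Ioo)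
      (hΓ.measurableSet.prod measurableSet_Ioo) hF (hc.mono hsub) (fun g hg hgW => ?_)
      (show (y, s) ∈ V ×ˢ Ioo 0 T from ⟨hyV, hs⟩) ⟨hy, hs⟩ fun N hN hpN => ?_
    · have h0 : ∀ p ∉ V ×ˢ Ioo 0 T, g p = 0 := fun p hp =>
        image_eq_zero_of_notMem_tsupport fun hp' => hp (hgW hp')
      exact h g hg (fun z hz r => h0 _ fun hzr => hz.2 (hVΓ ⟨hzr.1, hz.1⟩))
        fun z r hr => h0 _ fun hzr => hr hzr.2
    · refine lt_of_lt_of_le (hΩ.lateralMeasure_pos (hN.inter (hV.prod isOpen_Ioo))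
        (hΓ.subset hy) ⟨hpN, hyV, hs⟩) ?_
      -- the surface measure does not see points off `∂Ω`
      have hnull : lateralMeasure Ω ((frontier Ω)ᶜ ×ˢ univ) = 0 := by
        have := hΩ.isFiniteMeasure_surf (Subset.refl (frontier Ω))
        rw [lateralMeasure, Measure.prod_prod,
          Measure.restrict_apply isClosed_frontier.isOpen_compl.measurableSet]
        simp
      refine (measure_mono (t := (Γ ×ˢ Ioo 0 T ∩ N) ∪ (frontier Ω)ᶜ ×ˢ univ) ?_).trans
        ((measure_union_le _ _).trans (by rw [hnull, add_zero]))
      rintro ⟨z, r⟩ ⟨hzN, hzV, hr⟩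
      by_cases hz : z ∈ frontier Ω
      · exact Or.inl ⟨⟨hVΓ ⟨hzV, hz⟩, hr⟩, hzN⟩
      · exact Or.inr ⟨hz, mem_univ _⟩
  have hT : (0 : ℝ) ≠ T := (ht.1.trans_le ht.2).ne
  have hcl : (x, t) ∈ closure (Γ' ×ˢ Ioo 0 T) := by
    rw [closure_prod_eq, closure_Ioo hT]
    exact ⟨hΓ.subset_closure hx, Ioc_subset_Icc_self ht⟩
  have himg := ((hc (x, t) ⟨hx, ht⟩).mono
    ((prod_mono_left hΓ'Γ).trans hsub)).mem_closure_image hcl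
  have : F '' (Γ' ×ˢ Ioo 0 T) ⊆ {0} := image_subset_iff.2 hint
  simpa using closure_mono this himg

end Fundamental

/-! ### Solutions of the primal problem annihilate the first variation -/

section Weak

open Filter

variable {n d : ℕ} {Ω Γ : Set (Space d)} {ν : Space d → Space d} {T : ℝ} {bd : IBData n d}
  {sys : PrimalSystem n d} {U V : Space d → ℝ → State n d}

theorem dotU_zero_left (V : State n d) : dotU 0 V = 0 := by
  simp [dotU]

theorem dotU_self_eq_zero {V : State n d} (h : dotU V V = 0) : V = 0 := by
  have h1 : 0 ≤ ∑ I, V.1 I * V.1 I := Finset.sum_nonneg fun _ _ => mul_self_nonneg _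
  have h2 : 0 ≤ ∑ I, ∑ i, V.2.1 I i * V.2.1 I i :=
    Finset.sum_nonneg fun _ _ => Finset.sum_nonneg fun _ _ => mul_self_nonneg _
  have h3 : 0 ≤ ∑ I, ∑ i, ∑ j, V.2.2 I i j * V.2.2 I i j :=
    Finset.sum_nonneg fun _ _ => Finset.sum_nonneg fun _ _ =>
      Finset.sum_nonneg fun _ _ => mul_self_nonneg _
  rw [dotU] at h
  have k1 : ∑ I, V.1 I * V.1 I = 0 := by linarith
  have k2 : ∑ I, ∑ i, V.2.1 I i * V.2.1 I i = 0 := by linarith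
  have k3 : ∑ I, ∑ i, ∑ j, V.2.2 I i j * V.2.2 I i j = 0 := by linarith
  refine Prod.ext ?_ (Prod.ext ?_ ?_)
  · funext I
    have := (Finset.sum_eq_zero_iff_of_nonneg fun _ _ => mul_self_nonneg _).1 k1 I
      (Finset.mem_univ _)
    exact mul_self_eq_zero.1 this
  · funext I i
    have := (Finset.sum_eq_zero_iff_of_nonneg fun _ _ =>
      Finset.sum_nonneg fun _ _ => mul_self_nonneg _).1 k2 I (Finset.mem_univ _)
    have := (Finset.sum_eq_zero_iff_of_nonneg fun _ _ => mul_self_nonneg _).1 this i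
      (Finset.mem_univ _)
    exact mul_self_eq_zero.1 this
  · funext I i j
    have := (Finset.sum_eq_zero_iff_of_nonneg fun _ _ => Finset.sum_nonneg fun _ _ =>
      Finset.sum_nonneg fun _ _ => mul_self_nonneg _).1 k3 I (Finset.mem_univ _)
    have := (Finset.sum_eq_zero_iff_of_nonneg fun _ _ =>
      Finset.sum_nonneg fun _ _ => mul_self_nonneg _).1 this i (Finset.mem_univ _)
    have := (Finset.sum_eq_zero_iff_of_nonneg fun _ _ => mul_self_nonneg _).1 this j
      (Finset.mem_univ _)
    exact mul_self_eq_zero.1 this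

theorem SolvesIBVP.residual_eq_zero (h : SolvesIBVP sys bd Ω ν T U) {x : Space d} (hx : x ∈ Ω)
    {t : ℝ} (ht : t ∈ Ioo 0 T) : residual sys U x t = 0 :=
  Prod.ext (funext fun I => sub_eq_zero.2 (h.evolution x hx t ht I))
    (Prod.ext (funext fun I => funext fun i => sub_eq_zero.2 (h.grad_u x hx t ht I i))
      (funext fun I => funext fun i => funext fun j => sub_eq_zero.2 (h.grad_B x hx t ht I i j)))

theorem sum_tractionFlux_mul (U : Space d → ℝ → State n d) (x : Space d) (t : ℝ) (I : Fin n)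
    (ν : Fin d → ℝ) :
    ∑ k, tractionFlux sys U x t I k * ν k
      = (∑ k, sys.a (U x t) I k * ν k)
        + (∑ k, ((∑ J, sys.cB I J k * (U x t).1 J)
          + ∑ J, ∑ i, sys.cC I J i k * (U x t).2.1 J i) * ν k) := by
  rw [← Finset.sum_add_distrib]
  exact Finset.sum_congr rfl fun k _ => add_mul _ _ _

theorem SolvesIBVP.firstVariation_eq_zero
    (h : SolvesIBVP sys bd Ω ν T U) (E : Space d → ℝ → State n d) :
    firstVariation sys bd Ω ν T U E = 0 := by
  have h1 : ∀ p ∈ Ω ×ˢ Ioo 0 T, dotU (residual sys U p.1 p.2) (E p.1 p.2) = 0 := fun p hp => by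
    rw [h.residual_eq_zero hp.1 hp.2, dotU_zero_left]
  have h2 : ∀ x ∈ Ω, ∑ I, (E x 0).1 I * ((U x 0).1 I - bd.uInit x I) = 0 := fun x hx => by
    simp [h.initial x hx]
  have h3 : ∀ p ∈ bd.Γτ ×ˢ Ioo 0 T, ∑ I, (E p.1 p.2).1 I *
      ((∑ k, tractionFlux sys U p.1 p.2 I k * ν p.1 k) - bd.tau p.1 p.2 I) = 0 := fun p hp =>
    Finset.sum_eq_zero fun I _ => by
      rw [sum_tractionFlux_mul, h.traction p.1 hp.1 p.2 (Ioo_subset_Ioc_self hp.2), sub_self,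
        mul_zero]
  have h4 : ∀ p ∈ bd.Γu ×ˢ Ioo 0 T, ∑ I, ∑ i, (E p.1 p.2).2.1 I i *
      ((bd.uBdry p.1 p.2 I - (U p.1 p.2).1 I) * ν p.1 i) = 0 := fun p hp => by
    simp [h.displacement p.1 hp.1 p.2 (Ioo_subset_Ioc_self hp.2)]
  have h5 : ∀ p ∈ bd.Γg ×ˢ Ioo 0 T, ∑ I, ∑ i, ∑ j, (E p.1 p.2).2.2 I i j *
      ((bd.gBdry p.1 p.2 I i - (U p.1 p.2).2.1 I i) * ν p.1 j) = 0 := fun p hp => by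
    simp [fun I i => (h.gradient p.1 hp.1 p.2 (Ioo_subset_Ioc_self hp.2) I i).2]
  rw [firstVariation, MeasureTheory.setIntegral_eq_zero_of_forall_eq_zero h1,
    MeasureTheory.setIntegral_eq_zero_of_forall_eq_zero h2,
    MeasureTheory.setIntegral_eq_zero_of_forall_eq_zero h3,
    MeasureTheory.setIntegral_eq_zero_of_forall_eq_zero h4,
    MeasureTheory.setIntegral_eq_zero_of_forall_eq_zero h5]
  simp

end Weak

end

noncomputable section

/-! ### Weak solutions solve the primal problem -/

section Strong

open Filter

variable {n d : ℕ} {Ω Γ : Set (Space d)} {ν : Space d → Space d} {T : ℝ} {bd : IBData n d}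
  {sys : PrimalSystem n d} {U V : Space d → ℝ → State n d}

theorem contDiff_smul_const {g : Space d × ℝ → ℝ} (hg : ContDiff ℝ ∞ g) (e : State n d) :
    ContDiff ℝ 2 (Function.uncurry fun x t => g (x, t) • e) :=
  (show ContDiff ℝ 2 g by exact_mod_cast contDiff_infty.1 hg 2).smul contDiff_const

theorem IsC1Domain.exists_normal_apply_ne_zero (hΩ : IsC1Domain Ω ν) {x : Space d}
    (hx : x ∈ frontier Ω) : ∃ i, ν x i ≠ 0 := by
  by_contra! h
  have h0 : ν x = 0 := PiLp.ext h
  simpa [h0] using hΩ.norm_normal hx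

/-- `U` is a weak solution: its defects give zero when paired with any admissible variation, of
class `C²` and zero where the dual fields are prescribed. -/
def IsWeakSolution (sys : PrimalSystem n d) (bd : IBData n d) (Ω : Set (Space d))
    (ν : Space d → Space d) (T : ℝ) (U : Space d → ℝ → State n d) : Prop :=
  ∀ E : Space d → ℝ → State n d, ContDiff ℝ 2 (Function.uncurry E) →
    bd.Agrees Ω T E (fun _ _ => 0) → firstVariation sys bd Ω ν T U E = 0

/-- Variations supported in the open cylinder give the system. -/
theorem IsWeakSolution.residual_eq_zero (h : IsWeakSolution sys bd Ω ν T U)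
    (hΩ : IsC1Domain Ω ν) (hbd : bd.Regular Ω T) (hf : ContDiff ℝ ∞ sys.f)
    (ha : ContDiff ℝ ∞ sys.a) (hU : ContDiff ℝ 1 (Function.uncurry U)) {x : Space d}
    (hx : x ∈ Ω) {t : ℝ} (ht : t ∈ Ioo 0 T) : residual sys U x t = 0 := by
  refine dotU_self_eq_zero ?_
  set e := residual sys U x t
  have hW : IsOpen (Ω ×ˢ Ioo 0 T) := hΩ.isOpen.prod isOpen_Ioo
  have hc : Continuous fun p : Space d × ℝ => dotU (residual sys U p.1 p.2) e :=
    continuous_dotU (continuous_residual ha hf hU) continuous_const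
  refine eq_zero_of_forall_setIntegral_mul_eq_zero (μ := volume) (x := (x, t))
    (F := fun p => dotU (residual sys U p.1 p.2) e) hW
    hW.measurableSet (hΩ.integrableOn_cylinder hc) hc.continuousOn (fun g hg hgW => ?_) ⟨hx, ht⟩
    ⟨hx, ht⟩ fun N hN hpN => (hW.inter hN).measure_pos _ ⟨_, ⟨hx, ht⟩, hpN⟩
  have h0 : ∀ p ∉ Ω ×ˢ Ioo 0 T, g p = 0 := fun p hp =>
    image_eq_zero_of_notMem_tsupport fun hp' => hp (hgW hp')
  have hfr : ∀ y ∈ frontier Ω, ∀ s, g (y, s) = 0 := fun y hy s => h0 _ fun hp =>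
    (hΩ.isOpen.frontier_eq ▸ hy).2 hp.1
  have hT : ∀ y, g (y, T) = 0 := fun y => h0 _ fun hp => lt_irrefl _ hp.2.2
  have hi : ∀ y, g (y, 0) = 0 := fun y => h0 _ fun hp => lt_irrefl _ hp.2.1
  have := h (fun x t => g (x, t) • e) (contDiff_smul_const hg e)
    ⟨fun y _ => by simp [hT], fun y hy s _ => by simp [hfr y hy.1],
      fun y hy s _ => by simp [hfr y hy.1], fun y hy s _ => by simp [hfr y hy.1]⟩
  rw [firstVariation,
    setIntegral_eq_zero_of_forall_eq_zero (μ := lateralMeasure Ω) (t := bd.Γτ ×ˢ Ioo 0 T)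
      fun p hp => by simp [hfr p.1 (hbd.partτ.subset hp.1)],
    setIntegral_eq_zero_of_forall_eq_zero (μ := lateralMeasure Ω) (t := bd.Γu ×ˢ Ioo 0 T)
      fun p hp => by simp [hfr p.1 (hbd.partu.subset hp.1)],
    setIntegral_eq_zero_of_forall_eq_zero (μ := lateralMeasure Ω) (t := bd.Γg ×ˢ Ioo 0 T)
      fun p hp => by simp [hfr p.1 (hbd.partg.subset hp.1)]] at this
  simp only [hi, zero_smul, Prod.fst_zero, Pi.zero_apply, zero_mul, Finset.sum_const_zero,
    integral_zero, add_zero] at this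
  refine Eq.trans (integral_congr_ae (Eventually.of_forall fun p => ?_)) this
  simp only [← dotUCLM_apply, map_smul, smul_eq_mul]

/-- Variations of `λ` supported over the interior of `Ω` give the initial condition. -/
theorem IsWeakSolution.initial (h : IsWeakSolution sys bd Ω ν T U) (hΩ : IsC1Domain Ω ν)
    (hT : 0 < T) (hbd : bd.Regular Ω T) (hU : Continuous (Function.uncurry U))
    (hR : ∀ x ∈ Ω, ∀ t ∈ Ioo 0 T, residual sys U x t = 0) {x : Space d} (hx : x ∈ Ω)
    (I : Fin n) : (U x 0).1 I = bd.uInit x I := by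
  have hU0 : Continuous fun x => (U x 0).1 I :=
    (contDiff_fst_apply (contDiff_zero.2 hU) I).continuous.comp
      (by fun_prop : Continuous fun x : Space d => (x, (0 : ℝ)))
  have hc : ContinuousOn (fun x => T * ((U x 0).1 I - bd.uInit x I)) Ω :=
    continuousOn_const.mul (hU0.continuousOn.sub (continuousOn_pi.1 hbd.contInit I))
  have hF : IntegrableOn (fun x => T * ((U x 0).1 I - bd.uInit x I)) Ω :=
    (((hU0.continuousOn.integrableOn_compact hΩ.isCompact_closure).mono_set subset_closure).sub
      (integrableOn_uInit hΩ hbd I)).const_mul T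
  have := eq_zero_of_forall_setIntegral_mul_eq_zero (x := x) hΩ.isOpen hΩ.isOpen.measurableSet
    hF hc (fun g hg hgW => ?_) hx hx fun N hN hxN =>
      (hΩ.isOpen.inter hN).measure_pos _ ⟨_, hx, hxN⟩
  · exact sub_eq_zero.1 ((mul_eq_zero.1 this).resolve_left hT.ne')
  -- the factor `T - t` makes the variation vanish at the final time
  have hfr : ∀ y ∈ frontier Ω, g y = 0 := fun y hy =>
    image_eq_zero_of_notMem_tsupport fun hy' => (hΩ.isOpen.frontier_eq ▸ hy).2 (hgW hy')
  have hG : ContDiff ℝ ∞ fun p : Space d × ℝ => g p.1 * (T - p.2) :=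
    (hg.comp contDiff_fst).mul (contDiff_const.sub contDiff_snd)
  have := h (fun x t => (g x * (T - t)) • (Pi.single I 1, 0, 0)) (contDiff_smul_const hG _)
    ⟨fun y _ => by simp, fun y hy s _ => by simp [hfr y hy.1],
      fun y hy s _ => by simp, fun y hy s _ => by simp⟩
  rw [firstVariation,
    setIntegral_eq_zero_of_forall_eq_zero (t := Ω ×ˢ Ioo 0 T)
      fun p hp => by rw [hR p.1 hp.1 p.2 hp.2, dotU_zero_left],
    setIntegral_eq_zero_of_forall_eq_zero (μ := lateralMeasure Ω) (t := bd.Γτ ×ˢ Ioo 0 T)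
      fun p hp => by simp [hfr p.1 (hbd.partτ.subset hp.1)]] at this
  simpa [Pi.single_apply, mul_assoc] using this

/-- Variations of `λ` supported near the relative interior of `∂Ω_τ` give the traction condition. -/
theorem IsWeakSolution.traction (h : IsWeakSolution sys bd Ω ν T U) (hΩ : IsC1Domain Ω ν)
    (hbd : bd.Regular Ω T) (ha : ContDiff ℝ ∞ sys.a)
    (hU : ContDiff ℝ 1 (Function.uncurry U))
    (hR : ∀ x ∈ Ω, ∀ t ∈ Ioo 0 T, residual sys U x t = 0) {x : Space d} (hx : x ∈ bd.Γτ)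
    {t : ℝ} (ht : t ∈ Ioc 0 T) (I : Fin n) :
    ∑ k, tractionFlux sys U x t I k * ν x k = bd.tau x t I := by
  have hc1 : ContinuousOn (fun p : Space d × ℝ => ∑ k, tractionFlux sys U p.1 p.2 I k * ν p.1 k)
      (frontier Ω ×ˢ Icc 0 T) :=
    continuousOn_finsetSum _ fun k _ =>
      (contDiff_tractionFlux ha hU I k).continuous.continuousOn.mul (hΩ.continuousOn_normal_apply k)
  refine sub_eq_zero.1 (hbd.partτ.eq_zero_of_forall_setIntegral_mul_eq_zero hΩ (F := fun p =>
    (∑ k, tractionFlux sys U p.1 p.2 I k * ν p.1 k) - bd.tau p.1 p.2 I) ?_ ?_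
    (fun g hg hgΓ hgT => ?_) hx ht)
  · exact (hΩ.integrableOn_lateral_of_continuousOn hbd.partτ.subset hbd.partτ.measurableSet
      hc1).sub (integrableOn_tau hΩ hbd I)
  · exact (hc1.mono (prod_mono hbd.partτ.subset Ioc_subset_Icc_self)).sub
      (continuousOn_pi.1 hbd.contTau I)
  have := h (fun x t => g (x, t) • (Pi.single I 1, 0, 0)) (contDiff_smul_const hg _)
    ⟨fun y _ => by simp [hgT], fun y hy s _ => by simp [hgΓ y hy],
      fun y hy s _ => by simp, fun y hy s _ => by simp⟩
  rw [firstVariation,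
    setIntegral_eq_zero_of_forall_eq_zero (t := Ω ×ˢ Ioo 0 T)
      fun p hp => by rw [hR p.1 hp.1 p.2 hp.2, dotU_zero_left]] at this
  simpa [Pi.single_apply, hgT] using this

/-- Variations of `γ` supported near the relative interior of `∂Ω_u` give the displacement
condition, because some component of the normal is not zero. -/
theorem IsWeakSolution.displacement (h : IsWeakSolution sys bd Ω ν T U) (hΩ : IsC1Domain Ω ν)
    (hbd : bd.Regular Ω T) (hU : Continuous (Function.uncurry U))
    (hR : ∀ x ∈ Ω, ∀ t ∈ Ioo 0 T, residual sys U x t = 0) {x : Space d} (hx : x ∈ bd.Γu)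
    {t : ℝ} (ht : t ∈ Ioc 0 T) (I : Fin n) : (U x t).1 I = bd.uBdry x t I := by
  obtain ⟨i, hi⟩ := hΩ.exists_normal_apply_ne_zero (hbd.partu.subset hx)
  have hc1 : ContinuousOn (fun p : Space d × ℝ => (U p.1 p.2).1 I) (frontier Ω ×ˢ Icc 0 T) :=
    (contDiff_fst_apply (contDiff_zero.2 hU) I).continuous.continuousOn
  have hF : IntegrableOn (fun p : Space d × ℝ => bd.uBdry p.1 p.2 I - (U p.1 p.2).1 I)
      (bd.Γu ×ˢ Ioo 0 T) (lateralMeasure Ω) :=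
    (integrableOn_uBdry hΩ hbd I).sub
      (hΩ.integrableOn_lateral_of_continuousOn hbd.partu.subset hbd.partu.measurableSet hc1)
  have hsub : bd.Γu ×ˢ Ioc 0 T ⊆ frontier Ω ×ˢ Icc 0 T :=
    prod_mono hbd.partu.subset Ioc_subset_Icc_self
  have := hbd.partu.eq_zero_of_forall_setIntegral_mul_eq_zero hΩ (F := fun p =>
    (bd.uBdry p.1 p.2 I - (U p.1 p.2).1 I) * ν p.1 i) ?_ ?_ (fun g hg hgΓ hgT => ?_) hx ht
  · exact (sub_eq_zero.1 ((mul_eq_zero.1 this).resolve_right hi)).symm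
  · simpa only [mul_comm] using hΩ.integrableOn_lateral_mul hbd.partu.subset
      hbd.partu.measurableSet (hΩ.continuousOn_normal_apply i) hF
  · exact ((continuousOn_pi.1 hbd.contBdry I).sub (hc1.mono hsub)).mul
      ((hΩ.continuousOn_normal_apply i).mono hsub)
  have := h (fun x t => g (x, t) • (0, Pi.single I (Pi.single i 1), 0)) (contDiff_smul_const hg _)
    ⟨fun y _ => by simp, fun y hy s _ => by simp,
      fun y hy s _ => by simp [hgΓ y hy], fun y hy s _ => by simp⟩
  rw [firstVariation,
    setIntegral_eq_zero_of_forall_eq_zero (t := Ω ×ˢ Ioo 0 T)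
      fun p hp => by rw [hR p.1 hp.1 p.2 hp.2, dotU_zero_left]] at this
  have e : ∀ p : Space d × ℝ, ∑ J, ∑ j,
      g p * (Pi.single I (Pi.single i 1) : Fin n → Fin d → ℝ) J j *
        ((bd.uBdry p.1 p.2 J - (U p.1 p.2).1 J) * ν p.1 j)
      = g p * ((bd.uBdry p.1 p.2 I - (U p.1 p.2).1 I) * ν p.1 i) := fun p => by
    rw [Finset.sum_eq_single_of_mem I (Finset.mem_univ _) fun J _ hJ => by simp [hJ],
      Finset.sum_eq_single_of_mem i (Finset.mem_univ _) fun j _ hj => by simp [hj]]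
    simp
  simpa [e] using this

/-- Variations of `ρ` supported near the relative interior of `∂Ω_∇u` give the gradient
condition, because some component of the normal is not zero. -/
theorem IsWeakSolution.gradient (h : IsWeakSolution sys bd Ω ν T U) (hΩ : IsC1Domain Ω ν)
    (hbd : bd.Regular Ω T) (hU : Continuous (Function.uncurry U))
    (hR : ∀ x ∈ Ω, ∀ t ∈ Ioo 0 T, residual sys U x t = 0) {x : Space d} (hx : x ∈ bd.Γg)
    {t : ℝ} (ht : t ∈ Ioc 0 T) (I : Fin n) (i : Fin d) :
    (U x t).2.1 I i = bd.gBdry x t I i := by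
  obtain ⟨j, hj⟩ := hΩ.exists_normal_apply_ne_zero (hbd.partg.subset hx)
  have hc1 : ContinuousOn (fun p : Space d × ℝ => (U p.1 p.2).2.1 I i)
      (frontier Ω ×ˢ Icc 0 T) :=
    (contDiff_snd_apply (contDiff_zero.2 hU) I i).continuous.continuousOn
  have hF : IntegrableOn (fun p : Space d × ℝ => bd.gBdry p.1 p.2 I i - (U p.1 p.2).2.1 I i)
      (bd.Γg ×ˢ Ioo 0 T) (lateralMeasure Ω) :=
    (integrableOn_gBdry hΩ hbd I i).sub
      (hΩ.integrableOn_lateral_of_continuousOn hbd.partg.subset hbd.partg.measurableSet hc1)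
  have hsub : bd.Γg ×ˢ Ioc 0 T ⊆ frontier Ω ×ˢ Icc 0 T :=
    prod_mono hbd.partg.subset Ioc_subset_Icc_self
  have := hbd.partg.eq_zero_of_forall_setIntegral_mul_eq_zero hΩ (F := fun p =>
    (bd.gBdry p.1 p.2 I i - (U p.1 p.2).2.1 I i) * ν p.1 j) ?_ ?_ (fun g hg hgΓ hgT => ?_) hx ht
  · exact (sub_eq_zero.1 ((mul_eq_zero.1 this).resolve_right hj)).symm
  · simpa only [mul_comm] using hΩ.integrableOn_lateral_mul hbd.partg.subset
      hbd.partg.measurableSet (hΩ.continuousOn_normal_apply j) hF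
  · exact ((continuousOn_pi.1 (continuousOn_pi.1 hbd.contGrad I) i).sub (hc1.mono hsub)).mul
      ((hΩ.continuousOn_normal_apply j).mono hsub)
  have := h (fun x t => g (x, t) • (0, 0, Pi.single I (Pi.single i (Pi.single j 1))))
    (contDiff_smul_const hg _)
    ⟨fun y _ => by simp, fun y hy s _ => by simp,
      fun y hy s _ => by simp, fun y hy s _ => by simp [hgΓ y hy]⟩
  rw [firstVariation,
    setIntegral_eq_zero_of_forall_eq_zero (t := Ω ×ˢ Ioo 0 T)
      fun p hp => by rw [hR p.1 hp.1 p.2 hp.2, dotU_zero_left]] at this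
  have e : ∀ p : Space d × ℝ, ∑ I', ∑ i', ∑ j',
      g p * (Pi.single I (Pi.single i (Pi.single j 1)) : Fin n → Fin d → Fin d → ℝ) I' i' j' *
        ((bd.gBdry p.1 p.2 I' i' - (U p.1 p.2).2.1 I' i') * ν p.1 j')
      = g p * ((bd.gBdry p.1 p.2 I i - (U p.1 p.2).2.1 I i) * ν p.1 j) := fun p => by
    rw [Finset.sum_eq_single_of_mem I (Finset.mem_univ _) fun J _ hJ => by simp [hJ],
      Finset.sum_eq_single_of_mem i (Finset.mem_univ _) fun k _ hk => by simp [hk],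
      Finset.sum_eq_single_of_mem j (Finset.mem_univ _) fun k _ hk => by simp [hk]]
    simp
  simpa [e] using this

/-- A weak solution of class `C¹` solves the system with all the conditions. The identity
`∂_i u_I = B_{Ii}` on the boundary is the limit of the one in the interior. -/
theorem IsWeakSolution.solvesIBVP (h : IsWeakSolution sys bd Ω ν T U) (hΩ : IsC1Domain Ω ν)
    (hT : 0 < T) (hbd : bd.Regular Ω T) (hf : ContDiff ℝ ∞ sys.f) (ha : ContDiff ℝ ∞ sys.a)
    (hU : ContDiff ℝ 1 (Function.uncurry U)) : SolvesIBVP sys bd Ω ν T U := by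
  have hR : ∀ x ∈ Ω, ∀ t ∈ Ioo 0 T, residual sys U x t = 0 := fun x hx t ht =>
    h.residual_eq_zero hΩ hbd hf ha hU hx ht
  have hcl : ∀ x ∈ closure Ω, ∀ t ∈ Icc 0 T, residual sys U x t = 0 := fun x hx t ht => by
    have hp : (x, t) ∈ closure (Ω ×ˢ Ioo 0 T) := by
      rw [closure_prod_eq, closure_Ioo hT.ne]
      exact ⟨hx, ht⟩
    have hcl : IsClosed {p : Space d × ℝ | residual sys U p.1 p.2 = 0} :=
      isClosed_eq (continuous_residual ha hf hU) continuous_const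
    exact hcl.closure_subset_iff.2 (fun p hp => hR p.1 hp.1 p.2 hp.2) hp
  have hgrad : ∀ x ∈ closure Ω, ∀ t ∈ Icc 0 T, ∀ I i,
      dx i (fun y s => (U y s).1 I) x t = (U x t).2.1 I i := fun x hx t ht I i =>
    sub_eq_zero.1 (congrFun (congrFun (congrArg (fun V => V.2.1) (hcl x hx t ht)) I) i)
  exact
    { evolution := fun x hx t ht I =>
        sub_eq_zero.1 (congrFun (congrArg Prod.fst (hR x hx t ht)) I)
      grad_u := fun x hx t ht I i => hgrad x (subset_closure hx) t (Ioo_subset_Icc_self ht) I i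
      grad_B := fun x hx t ht I i j => sub_eq_zero.1
        (congrFun (congrFun (congrFun (congrArg (fun V => V.2.2) (hR x hx t ht)) I) i) j)
      initial := fun x hx I => h.initial hΩ hT hbd hU.continuous hR hx I
      traction := fun x hx t ht I => by
        rw [← sum_tractionFlux_mul]
        exact h.traction hΩ hbd ha hU hR hx ht I
      displacement := fun x hx t ht I => h.displacement hΩ hbd hU.continuous hR hx ht I
      gradient := fun x hx t ht I i =>
        ⟨hgrad x (frontier_subset_closure (hbd.partg.subset hx)) t (Ioc_subset_Icc_self ht) I i,
          h.gradient hΩ hbd hU.continuous hR hx ht I i⟩ }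

theorem isWeakSolution_iff_solvesIBVP (hΩ : IsC1Domain Ω ν)
    (hT : 0 < T) (hbd : bd.Regular Ω T) (hf : ContDiff ℝ ∞ sys.f) (ha : ContDiff ℝ ∞ sys.a)
    (hU : ContDiff ℝ 1 (Function.uncurry U)) :
    IsWeakSolution sys bd Ω ν T U ↔ SolvesIBVP sys bd Ω ν T U :=
  ⟨fun h => h.solvesIBVP hΩ hT hbd hf ha hU, fun h E _ _ => h.firstVariation_eq_zero E⟩

end Strong

end

noncomputable section

/-! ### Stationarity and the primal problem -/

section Transfer

open Filter

variable {n d : ℕ} {Ω : Set (Space d)} {ν : Space d → Space d} {T : ℝ} {bd : IBData n d}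
  {sys : PrimalSystem n d}

theorem dt_congr {f g : Space d → ℝ → ℝ} {x : Space d} {t : ℝ}
    (h : Function.uncurry f =ᶠ[𝓝 (x, t)] Function.uncurry g) : dt f x t = dt g x t :=
  EventuallyEq.deriv_eq
    ((by fun_prop : Continuous fun s : ℝ => (x, s)).continuousAt.eventually h)

theorem dx_congr {f g : Space d → ℝ → ℝ} {x : Space d} {t : ℝ}
    (h : Function.uncurry f =ᶠ[𝓝 (x, t)] Function.uncurry g) (k : Fin d) :
    dx k f x t = dx k g x t := by
  have h' : (fun y => f y t) =ᶠ[𝓝 x] fun y => g y t :=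
    (by fun_prop : Continuous fun y : Space d => (y, t)).continuousAt.eventually h
  rw [dx, dx, h'.fderiv_eq]

/-- The primal problem depends only on the germ of the field along `closure Ω × [0, T]`. -/
theorem SolvesIBVP.congr (hT : 0 ≤ T) (hbd : bd.Regular Ω T) {U V : Space d → ℝ → State n d}
    (hUV : ∀ p ∈ closure Ω ×ˢ Icc 0 T, Function.uncurry U =ᶠ[𝓝 p] Function.uncurry V)
    (h : SolvesIBVP sys bd Ω ν T U) : SolvesIBVP sys bd Ω ν T V := by
  have hmap : ∀ {x t}, x ∈ closure Ω → t ∈ Icc 0 T → ∀ G : State n d → ℝ,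
      (Function.uncurry fun y s => G (V y s)) =ᶠ[𝓝 (x, t)]
        Function.uncurry fun y s => G (U y s) := fun hx ht G => by
    filter_upwards [hUV _ ⟨hx, ht⟩] with q hq using (congrArg G hq).symm
  have hval : ∀ {x t}, x ∈ closure Ω → t ∈ Icc 0 T → V x t = U x t := fun {x t} hx ht =>
    (hUV (x, t) ⟨hx, ht⟩).eq_of_nhds.symm
  have hx0 : ∀ {x}, x ∈ Ω → x ∈ closure Ω := fun hx => subset_closure hx
  have ht0 : ∀ {t}, t ∈ Ioo 0 T → t ∈ Icc 0 T := fun ht => Ioo_subset_Icc_self ht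
  have ht1 : ∀ {t}, t ∈ Ioc 0 T → t ∈ Icc 0 T := fun ht => Ioc_subset_Icc_self ht
  have hfr : ∀ {x}, x ∈ frontier Ω → x ∈ closure Ω := fun hx => frontier_subset_closure hx
  refine ⟨fun x hx t ht I => ?_, fun x hx t ht I i => ?_, fun x hx t ht I i j => ?_,
    fun x hx I => ?_, fun x hx t ht I => ?_, fun x hx t ht I => ?_, fun x hx t ht I i => ?_⟩
  · have key := fun G => hmap (hx0 hx) (ht0 ht) G
    rw [hval (hx0 hx) (ht0 ht), dt_congr (key fun W => W.1 I),
      Finset.sum_congr rfl fun J _ => Finset.sum_congr rfl fun k _ => by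
        rw [dx_congr (key fun W => W.1 J) k],
      Finset.sum_congr rfl fun J _ => Finset.sum_congr rfl fun k _ =>
        Finset.sum_congr rfl fun l _ => by rw [dx_congr (key fun W => W.2.1 J k) l],
      Finset.sum_congr rfl fun k _ => dx_congr (key fun W => sys.a W I k) k]
    exact h.evolution x hx t ht I
  · rw [hval (hx0 hx) (ht0 ht), dx_congr (hmap (hx0 hx) (ht0 ht) fun W => W.1 I)]
    exact h.grad_u x hx t ht I i
  · rw [hval (hx0 hx) (ht0 ht), dx_congr (hmap (hx0 hx) (ht0 ht) fun W => W.2.1 I i)]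
    exact h.grad_B x hx t ht I i j
  · rw [hval (hx0 hx) ⟨le_rfl, hT⟩]
    exact h.initial x hx I
  · rw [hval (hfr (hbd.partτ.subset hx)) (ht1 ht)]
    exact h.traction x hx t ht I
  · rw [hval (hfr (hbd.partu.subset hx)) (ht1 ht)]
    exact h.displacement x hx t ht I
  · have hx' := hfr (hbd.partg.subset hx)
    rw [hval hx' (ht1 ht), dx_congr (hmap hx' (ht1 ht) fun W => W.1 I)]
    exact h.gradient x hx t ht I i

end Transfer

section Stationary

variable {n d : ℕ} {Ω : Set (Space d)} {ν : Space d → Space d} {T : ℝ} {bd : IBData n d}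
  {sys : PrimalSystem n d}

/-- The primal fields are `C¹` near `closure Ω × [0, T]`. -/
theorem contDiffAt_primal {O : Set (State n d × Flux n d × Space d × ℝ)} (hO : IsOpen O)
    {UH : State n d × Flux n d × Space d × ℝ → State n d} (hUH : ContDiffOn ℝ 1 UH O)
    {D : Space d → ℝ → State n d} (hD : ContDiff ℝ 2 (Function.uncurry D)) {p : Space d × ℝ}
    (hp : (sys.P D p.1 p.2, arrL D p.1 p.2, p.1, p.2) ∈ O) :
    ContDiffAt ℝ 1 (Function.uncurry (sys.primal UH D)) p := by
  have h1 : ContDiff ℝ 1 fun p : Space d × ℝ =>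
      (sys.P D p.1 p.2, arrL D p.1 p.2, p.1, p.2) :=
    (contDiff_P sys hD).prodMk ((contDiff_arrL hD).prodMk (contDiff_fst.prodMk contDiff_snd))
  exact ContDiffAt.comp (g := UH) p (hUH.contDiffAt (hO.mem_nhds hp)) h1.contDiffAt

/-- If `U` is a globally `C¹` field that agrees with the primal fields near
`closure Ω × [0, T]`, then stationarity of the dual fields says that `U` is a weak solution. -/
theorem isStationary_iff_isWeakSolution (hΩ : IsC1Domain Ω ν) (hT : 0 ≤ T)
    (hf : ContDiff ℝ ∞ sys.f) (ha : ContDiff ℝ ∞ sys.a)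
    (hbd : bd.Regular Ω T) {H : State n d → Space d → ℝ → ℝ}
    (hH : Continuous fun q : State n d × Space d × ℝ => H q.1 q.2.1 q.2.2)
    {O : Set (State n d × Flux n d × Space d × ℝ)} (hO : IsOpen O)
    {UH : State n d × Flux n d × Space d × ℝ → State n d} (hUH : ContDiffOn ℝ 1 UH O)
    (hinv : ∀ P L x t, (P, L, x, t) ∈ O → x ∈ closure Ω → t ∈ Icc 0 T →
      HasFDerivAt (fun U => sys.M H U L x t) (dotUCLM P) (UH (P, L, x, t)))
    {D : Space d → ℝ → State n d} (hD : ContDiff ℝ 2 (Function.uncurry D))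
    (hDO : ∀ x ∈ closure Ω, ∀ t ∈ Icc 0 T, (sys.P D x t, arrL D x t, x, t) ∈ O)
    {U : Space d → ℝ → State n d} (hU : ContDiff ℝ 1 (Function.uncurry U))
    (hUD : ∀ x ∈ closure Ω, ∀ t ∈ Icc 0 T, U x t = sys.primal UH D x t) :
    sys.IsStationary bd Ω ν T H UH D ↔ IsWeakSolution sys bd Ω ν T U := by
  have key : ∀ E : Space d → ℝ → State n d, ContDiff ℝ 2 (Function.uncurry E) →
      bd.Agrees Ω T E (fun _ _ => 0) →
      HasDerivAt (fun ε : ℝ => sys.S bd Ω ν T H UH (fun x t => D x t + ε • E x t))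
        (firstVariation sys bd Ω ν T U E) 0 := fun E hE hE0 => by
    have h := hasDerivAt_S hΩ hf ha hbd hH hO hUH hinv hD hDO hE
    have hcongr : ∀ p ∈ Ω ×ˢ Ioo 0 T, sys.primal UH D p.1 p.2 = U p.1 p.2 := fun p hp =>
      (hUD p.1 (subset_closure hp.1) p.2 (Ioo_subset_Icc_self hp.2)).symm
    rw [setIntegral_congr_fun (hΩ.isOpen.measurableSet.prod measurableSet_Ioo)
      (g := fun p => dotU (U p.1 p.2) (sys.P E p.1 p.2)
        + dotL (sys.F (U p.1 p.2)) (arrL E p.1 p.2)) fun p hp => by simp only [hcongr p hp],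
      firstVariation_eq hΩ hT hbd hf ha hU (hE.of_le (by norm_num)) hE0] at h
    exact h
  refine ⟨fun h E hE hE0 => (key E hE hE0).unique (h E hE hE0), fun h E hE hE0 => ?_⟩
  have := key E hE hE0
  rwa [h E hE hE0] at this

end Stationary

end

end DualIBVP

theorem mainTheorem4 (n d : ℕ) (hd : 1 ≤ d) (T : ℝ) (hT : 0 < T)
    (Ω : Set (DualIBVP.Space d)) (ν : DualIBVP.Space d → DualIBVP.Space d)
    (hΩ : DualIBVP.IsC1Domain Ω ν)
    (sys : DualIBVP.PrimalSystem n d) (hf : ContDiff ℝ ∞ sys.f) (ha : ContDiff ℝ ∞ sys.a)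
    (bd : DualIBVP.IBData n d) (hbd : bd.Regular Ω T)
    (H : DualIBVP.State n d → DualIBVP.Space d → ℝ → ℝ)
    (hH : Continuous fun q : DualIBVP.State n d × DualIBVP.Space d × ℝ => H q.1 q.2.1 q.2.2)
    (O : Set (DualIBVP.State n d × DualIBVP.Flux n d × DualIBVP.Space d × ℝ)) (hO : IsOpen O)
    (UH : DualIBVP.State n d × DualIBVP.Flux n d × DualIBVP.Space d × ℝ → DualIBVP.State n d)
    (hUH : ContDiffOn ℝ 1 UH O)
    (hinv : ∀ P L x t, (P, L, x, t) ∈ O → x ∈ closure Ω → t ∈ Icc 0 T →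
      HasFDerivAt (fun U => sys.M H U L x t) (DualIBVP.dotUCLM P) (UH (P, L, x, t))) :
    (∀ P L x t, (P, L, x, t) ∈ O → x ∈ closure Ω → t ∈ Icc 0 T →
      HasFDerivAt (fun P' => sys.Mstar H UH P' L x t) (DualIBVP.dotUCLM (UH (P, L, x, t))) P ∧
      HasFDerivAt (fun L' => sys.Mstar H UH P L' x t)
        (DualIBVP.dotLCLM (sys.F (UH (P, L, x, t)))) L) ∧
    ∀ D Dpre : DualIBVP.Space d → ℝ → DualIBVP.State n d,
      ContDiff ℝ 2 (Function.uncurry D) →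
      (∀ x ∈ closure Ω, ∀ t ∈ Icc 0 T, (sys.P D x t, DualIBVP.arrL D x t, x, t) ∈ O) →
      bd.Agrees Ω T D Dpre →
      (sys.IsStationary bd Ω ν T H UH D ↔
        DualIBVP.SolvesIBVP sys bd Ω ν T (sys.primal UH D)) := by
  refine ⟨fun P L x t hq hx ht => ?_, fun D _ hD hDO _ => ?_⟩
  · have h := DualIBVP.hasFDerivAt_Mstar hf ha
      ((hUH.contDiffAt (hO.mem_nhds hq)).differentiableAt one_ne_zero) (hinv P L x t hq hx ht)
    have h1 := HasFDerivAt.comp (f := fun P' => (P', L)) P h (hasFDerivAt_prodMk_left P L)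
    have h2 := HasFDerivAt.comp (f := fun L' => (P, L')) L h (hasFDerivAt_prodMk_right P L)
    exact ⟨h1.congr_fderiv (ContinuousLinearMap.ext fun V => by simp [DualIBVP.dotL]),
      h2.congr_fderiv (ContinuousLinearMap.ext fun V => by simp [DualIBVP.dotU])⟩
  -- off `closure Ω × [0, T]` the primal fields need not even be continuous, so they are replaced by
  -- a globally `C¹` field
  · obtain ⟨U, hU, hUD⟩ := DualIBVP.exists_contDiff_eventuallyEq (r := 1)
      (hΩ.isCompact_closure.prod (isCompact_Icc (a := (0 : ℝ)) (b := T)))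
      fun p hp => DualIBVP.contDiffAt_primal hO hUH hD (hDO p.1 hp.1 p.2 hp.2)
    rw [DualIBVP.isStationary_iff_isWeakSolution (U := fun x t => U (x, t)) hΩ hT.le hf ha hbd hH
        hO hUH hinv hD hDO (by exact_mod_cast hU)
        fun x hx t ht => (hUD (x, t) ⟨hx, ht⟩).eq_of_nhds,
      DualIBVP.isWeakSolution_iff_solvesIBVP hΩ hT hbd hf ha (by exact_mod_cast hU)]
    exact ⟨fun h => h.congr (U := fun x t => U (x, t)) hT.le hbd hUD,
      fun h => h.congr hT.le hbd fun p hp => (hUD p hp).symm⟩
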